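/- Setting. Let $\mathbb R^4_1$ be $\mathbb R^4$ with $\langle v,w\rangle=-(v^1w^4+v^4w^1)+v^2w^2+v^3w^3$ and standard basis $\epsilon_1,\dots,\epsilon_4$. Put $g_{ij}=\langle\epsilon_i,\epsilon_j\rangle$ and $\mathcal L_+=\{v:\langle v,v\rangle=0,\ \langle v,\epsilon_1+\epsilon_4\rangle<0\}$. The Laguerre group $L$ consists of the pairs $(x,a)$, $x\in\mathbb R^4$, $a=(a_1,\dots,a_4)$ with $\langle a_i,a_j\rangle=g_{ij}$, $\det a=1$, $a_1,a_4\in\mathcal L_+$, acting by $y\mapsto x+ay$. The Laguerre space $\Lambda\cong\mathbb R^3\times S^2$ is the set of isotropic lines $[x,v]=x+\mathbb Rv$, $v\in\mathcal L_+$. Let $M$ be a simply connected smooth surface (Hausdorff, second countable). A smooth map $F=[x,v]=(f,n):M\to\Lambda$ is a Legendre immersion if $\langle dx,v\rangle=0$ (that is, $df\cdot n=0$) and $dn\cdot dn>0$; it is nondegenerate if $df\cdot dn$ and $dn\cdot dn$ are linearly independent at every point. Two maps $F,F'$ on $M$ are Laguerre equivalent if $F'\circ\phi=A F$ for some diffeomorphism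 $\phi$ of $M$ and some $A\in L$. $F$ is L-minimal if it is an extremal, under compactly supported variations through Legendre immersions, of the Weingarten functional $\int\tfrac14(\rho_1-\rho_2)^2\,dA_n$, where $\rho_1,\rho_2$ are the radii of principal curvature of $f$ and $dA_n$ is the area element of $dn\cdot dn$ (this is $\int(H^2/K-1)\,dA$, up to the sign of $K$, where $f$ is an immersion without parabolic points). A middle frame field along $F$ on an open set $U$ is a smooth map $A=(a_0,a):U\to L$ with $F=[a_0,a_1]$, $da_0=\alpha_0^2a_2+\alpha_0^3a_3$, where $\alpha_0^2,\alpha_0^3$ are pointwise independent, and $da_j=\sum_i\alpha^i_ja_i$ with $$(\alpha^i_j)=\begin{pmatrix}2q_2\alpha_0^2-2q_1\alpha_0^3&p_1\alpha_0^2+p_2\alpha_0^3&p_2\alpha_0^2+p_3\alpha_0^3&0\\ \alpha_0^2&0&-q_1\alpha_0^2-q_2\alpha_0^3&p_1\alpha_0^2+p_2\alpha_0^3\\-\alpha_0^3&q_1\alpha_0^2+q_2\alpha_0^3&0&p_2\alpha_0^2+p_3\alpha_0^3\\0&\alpha_0^2&-\alpha_0^3&-2q_2\alpha_0^2+2q_1\alpha_0^3\end{pmatrix}$$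 for smooth functions $p_1,p_2,p_3,q_1,q_2$. The functions $W=\tfrac12(p_1+p_3)$ and $J=\tfrac12(p_1-p_3)$ do not depend on the middle frame. A nondegenerate Legendre immersion $F$ is L-isothermic with isothermal curvature line coordinate $z=x+iy:M\to\mathbb C$ (a smooth map that is a local coordinate near every point) and Blaschke potential $e^u$, $u\in C^\infty(M)$, if near every point it has a middle frame field with $\alpha_0^2=e^udx$, $\alpha_0^3=e^udy$. It is special if moreover $\Delta u=u_{xx}+u_{yy}=ce^{-2u}$ for some $c\in\mathbb R$. A number $k\in\mathbb R$ is a deformation parameter of a special $F$ if $W=ke^{-2u}$ and $J=-\tfrac12e^{-2u}\Delta u$. Let $F_0$ be L-isothermic with coordinate $z$, Blaschke potential $e^u$ and invariant $W$. For $m\in\mathbb R$, $F$ is a $T_m$-transform of $F_0$ (spectral parameter $m$) if there is a smooth $A=(a_0,a):M\to L$ with $F=[a_0,a_1]$ that is a middle frame field along $F$ on $M$ with $\alpha_0^2=e^udx$, $\alpha_0^3=e^udy$, $p_1=W+me^{-2u}-\tfrac12e^{-2u}\Delta u$, $p_2=0$, $p_3=W+me^{-2u}+\tfrac12e^{-2u}\Delta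 u$, $q_1=-e^{-u}u_y$, $q_2=e^{-u}u_x$. Two L-isothermic immersions are T-transforms of each other if they have a common Blaschke potential (with a common coordinate $z$) and are not Laguerre equivalent. **Proposition 3.10.** Let $F:M\to\Lambda$ be a special L-isothermic immersion with coordinate $z$ and Blaschke potential $e^u$, on a simply connected surface $M$. Then $F$ has exactly one deformation parameter $k$, and there is an L-minimal L-isothermic immersion $F_0:M\to\Lambda$ with the same coordinate $z$ and the same Blaschke potential $e^u$ such that, for $m\in\mathbb R$, $F$ is a $T_m$-transform of $F_0$ if and only if $m=k$. If $k\ne0$, then $F_0$ and $F$ are not Laguerre equivalent, so they are T-transforms of each other. -/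

import Mathlib

open scoped Manifold ContDiff

noncomputable section

namespace Laguerre

/-! ### Minkowski 4-space and the Laguerre group -/

/-- Minkowski 4-space. The coordinates `v¹, v², v³, v⁴` are `v 0, v 1, v 2, v 3`. -/
abbrev V : Type := Fin 4 → ℝ

/-- The scalar product `⟨v, w⟩ = -(v¹w⁴ + v⁴w¹) + v²w² + v³w³`. -/
def mink (v w : V) : ℝ := -(v 0 * w 3 + v 3 * w 0) + v 1 * w 1 + v 2 * w 2

/-- The Gram matrix `g` of the standard basis. -/
def gram : Matrix (Fin 4) (Fin 4) ℝ :=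
  !![0, 0, 0, -1; 0, 1, 0, 0; 0, 0, 1, 0; -1, 0, 0, 0]

/-- The positive light cone `{v | ⟨v, v⟩ = 0, ⟨v, ε₁ + ε₄⟩ < 0}`. -/
def posCone : Set V := {v | mink v v = 0 ∧ mink v ![1, 0, 0, 1] < 0}

/-- `(a₁, …, a₄)` is the linear part of a Laguerre frame, that is, the columns of an element
of the restricted Lorentz group. An element of the Laguerre group `L` is a pair `(x, a)` with
`x : V` and `IsLaguerreFrame a`. -/
structure IsLaguerreFrame (a : Fin 4 → V) : Prop where
  gram_eq : ∀ i j, mink (a i) (a j) = gram i j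
  det_eq : Matrix.det (Matrix.of a) = 1
  fst_mem : a 0 ∈ posCone
  last_mem : a 3 ∈ posCone

/-- The affine isometry `y ↦ x + a y` of Minkowski space given by `(x, a)`. -/
def laguerreMap (x : V) (a : Fin 4 → V) (y : V) : V := x + ∑ i, y i • a i

/-! ### The Laguerre space of isotropic lines -/

/-- The line `[x, v] = {x + t v}`. -/
def line (x v : V) : Set V := {y | ∃ t : ℝ, y = x + t • v}

/-- The Laguerre space: all isotropic lines. Every isotropic line has a unique positive
direction `v ∈ posCone` up to positive multiples, so its time orientation is no extra datum.
In the cyclographic model a line is an oriented contact element `(p, n) ∈ ℝ³ × S²`. -/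
def LaguerreSpace : Type := {l : Set V // ∃ x v : V, v ∈ posCone ∧ l = line x v}

/-! ### Surfaces. A surface `M` is a smooth 2-manifold modelled on `ℂ = ℝ²`. -/

section Surface

variable {M : Type*} [TopologicalSpace M] [ChartedSpace ℂ M]
variable {E : Type*} [NormedAddCommGroup E] [NormedSpace ℝ E]

/-- The differential at `p` of a vector valued function on the surface. -/
def D (g : M → E) (p : M) : ℂ →L[ℝ] E := mfderiv 𝓘(ℝ, ℂ) 𝓘(ℝ, E) g p

/-- The contact condition `⟨dx, v⟩ = 0` for the lift `(x, v)` of a map `[x, v]` into Laguerre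
space, together with the standing assumption `dn · dn > 0`. In the lift with `v = v(n)` the
form `⟨dv, dv⟩` is `dn · dn / 2`, and replacing the lift by `(x + t v, r v)`, `r > 0`, multiplies
it by `r ^ 2`. This positivity makes `[x, v]` an immersion. -/
def IsLegendreLift (x v : M → V) : Prop :=
  (∀ p, v p ∈ posCone) ∧ (∀ p X, mink (D x p X) (v p) = 0) ∧
    ∀ p X, X ≠ 0 → 0 < mink (D v p X) (D v p X)

/-- `(x, v)` is a smooth lift of `F`, that is, `F = [x, v]`. Every smooth `F = (f, n)` has
such a global lift, namely `(x(f), v(n))`. -/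
structure IsSmoothLift (F : M → LaguerreSpace) (x v : M → V) : Prop where
  smooth_fst : ContMDiff 𝓘(ℝ, ℂ) 𝓘(ℝ, V) ∞ x
  smooth_snd : ContMDiff 𝓘(ℝ, ℂ) 𝓘(ℝ, V) ∞ v
  eq_line : ∀ p, (F p).1 = line (x p) (v p)

/-- Legendre immersions into Laguerre space (with `dn · dn > 0`). -/
def IsLegendreImmersion (F : M → LaguerreSpace) : Prop :=
  ∃ x v : M → V, IsSmoothLift F x v ∧ IsLegendreLift x v

/-- A nondegenerate Legendre immersion: at every point the quadratic forms `df · dn` and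
`dn · dn` are linearly independent. They are positive multiples of `⟨dx, dv⟩` and `⟨dv, dv⟩` for
the lift `(x(f), v(n))`, and the span of the latter two is the same for every lift. -/
def IsNondegenerateLegendreImmersion (F : M → LaguerreSpace) : Prop :=
  ∃ x v : M → V, IsSmoothLift F x v ∧ IsLegendreLift x v ∧
    ∀ p, LinearIndependent ℝ
      ![fun X : ℂ => mink (D x p X) (D v p X), fun X : ℂ => mink (D v p X) (D v p X)]

/-- Laguerre equivalence of two maps `F`, `F'` into Laguerre space: `F' ∘ φ = A F` for a
diffeomorphism `φ` and an element `A` of the Laguerre group. -/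
def LaguerreEquivalent {M' : Type*} [TopologicalSpace M'] [ChartedSpace ℂ M']
    (F : M → LaguerreSpace) (F' : M' → LaguerreSpace) : Prop :=
  ∃ (φ : Diffeomorph 𝓘(ℝ, ℂ) 𝓘(ℝ, ℂ) M M' ∞) (x : V) (a : Fin 4 → V), IsLaguerreFrame a ∧
    ∀ p, (F' (φ p)).1 = laguerreMap x a '' (F p).1

/-! ### The Weingarten functional and L-minimality -/

/-- The density, with respect to `ds dt`, of the Weingarten functional of the Legendre immersion
`[x, v]` given in local coordinates `s + i t`.
With `II = ⟨dx, dv⟩`, `III = ⟨dv, dv⟩` and `S = III⁻¹ II` it is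
`((tr S) ^ 2 / 4 - det S) * √(det III)`, and it does not depend on the lift `(x, v)`.
For `x = x(f)`, `v = v(n)` this is `((ρ₁ - ρ₂) ^ 2 / 4) dA_n`, where `ρ₁, ρ₂` are the radii of
principal curvature of `f` and `dA_n` is the area element of `dn · dn`. Where `f` is an immersion
without parabolic points, it is equal to `(H ^ 2 / K - 1) dA` up to the (locally constant)
sign of `K`. -/
def weingartenDensity (x v : ℂ → V) (w : ℂ) : ℝ :=
  let xs := fderiv ℝ x w 1
  let xt := fderiv ℝ x w Complex.I
  let vs := fderiv ℝ v w 1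
  let vt := fderiv ℝ v w Complex.I
  let III : Matrix (Fin 2) (Fin 2) ℝ := !![mink vs vs, mink vs vt; mink vt vs, mink vt vt]
  let II : Matrix (Fin 2) (Fin 2) ℝ := !![mink xs vs, mink xs vt; mink xt vs, mink xt vt]
  let S := III⁻¹ * II
  (S.trace ^ 2 / 4 - S.det) * Real.sqrt III.det

/-- `F_t = [x t, v t]` is a smooth variation of `F = F_0` through Legendre immersions, fixed
outside `K`. -/
structure IsLegendreVariation (F : M → LaguerreSpace) (K : Set M) (x v : ℝ → M → V) :
    Prop where
  smooth_fst : ContMDiff (𝓘(ℝ, ℝ).prod 𝓘(ℝ, ℂ)) 𝓘(ℝ, V) ∞ (fun q : ℝ × M => x q.1 q.2)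
  smooth_snd : ContMDiff (𝓘(ℝ, ℝ).prod 𝓘(ℝ, ℂ)) 𝓘(ℝ, V) ∞ (fun q : ℝ × M => v q.1 q.2)
  legendre : ∀ t, IsLegendreLift (x t) (v t)
  at_zero : ∀ p, (F p).1 = line (x 0 p) (v 0 p)
  fixed : ∀ t, ∀ p ∉ K, (F p).1 = line (x t p) (v t p)

/-- `F` is L-minimal: it is an extremal of the Weingarten functional with respect to compactly
supported variations. The Euler-Lagrange equation being local, it is enough (and equivalent) to
take variations supported in a compact part `K` of a coordinate patch; the functional, restricted
to `K`, is then an integral in the coordinates. -/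
def IsLMinimal [IsManifold 𝓘(ℝ, ℂ) ∞ M] (F : M → LaguerreSpace) : Prop :=
  ∀ e ∈ IsManifold.maximalAtlas 𝓘(ℝ, ℂ) ∞ M, ∀ K : Set M, IsCompact K → K ⊆ e.source →
    ∀ x v : ℝ → M → V, IsLegendreVariation F K x v →
      HasDerivAt
        (fun t : ℝ => ∫ w in e '' K, weingartenDensity (x t ∘ e.symm) (v t ∘ e.symm) w) 0 0

/-! ### Middle frame fields -/

/-- The Laguerre invariants `p₁, p₂, p₃, q₁, q₂`, as functions on the surface. -/
structure Invariants (M : Type*) where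
  p₁ : M → ℝ
  p₂ : M → ℝ
  p₃ : M → ℝ
  q₁ : M → ℝ
  q₂ : M → ℝ

/-- The matrix `(αʲᵢ)` of a middle frame field at a point, evaluated on a tangent vector on
which the middle coframe takes the values `b = α₀²(X)` and `c = α₀³(X)`. The row is the upper
index and the column is the lower index. -/
def middleForm (P : Invariants M) (p : M) (b c : ℝ) : Matrix (Fin 4) (Fin 4) ℝ :=
  !![2 * P.q₂ p * b - 2 * P.q₁ p * c, P.p₁ p * b + P.p₂ p * c, P.p₂ p * b + P.p₃ p * c, 0;
     b, 0, -P.q₁ p * b - P.q₂ p * c, P.p₁ p * b + P.p₂ p * c;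
     -c, P.q₁ p * b + P.q₂ p * c, 0, P.p₂ p * b + P.p₃ p * c;
     0, b, -c, -2 * P.q₂ p * b + 2 * P.q₁ p * c]

/-- `A = (a₀, a) : U → L` is a middle frame field along `F` on the open set `U`, with middle
coframe `(β, γ) = (α₀², α₀³)` and invariants `P`: it is smooth, `F = [a₀, a₁]` and `dA = A α`,
where `α` has the normal form above. The surface carries the orientation in which the
coframe is positive. -/
structure IsMiddleFrameField (F : M → LaguerreSpace) (U : Set M) (a₀ : M → V)
    (a : M → Fin 4 → V) (β γ : M → ℂ →L[ℝ] ℝ) (P : Invariants M) : Prop where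
  isOpen : IsOpen U
  smooth_a₀ : ContMDiffOn 𝓘(ℝ, ℂ) 𝓘(ℝ, V) ∞ a₀ U
  smooth_a : ContMDiffOn 𝓘(ℝ, ℂ) 𝓘(ℝ, Fin 4 → V) ∞ a U
  smooth_p₁ : ContMDiffOn 𝓘(ℝ, ℂ) 𝓘(ℝ, ℝ) ∞ P.p₁ U
  smooth_p₂ : ContMDiffOn 𝓘(ℝ, ℂ) 𝓘(ℝ, ℝ) ∞ P.p₂ U
  smooth_p₃ : ContMDiffOn 𝓘(ℝ, ℂ) 𝓘(ℝ, ℝ) ∞ P.p₃ U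
  smooth_q₁ : ContMDiffOn 𝓘(ℝ, ℂ) 𝓘(ℝ, ℝ) ∞ P.q₁ U
  smooth_q₂ : ContMDiffOn 𝓘(ℝ, ℂ) 𝓘(ℝ, ℝ) ∞ P.q₂ U
  frame : ∀ p ∈ U, IsLaguerreFrame (a p)
  along : ∀ p ∈ U, (F p).1 = line (a₀ p) (a p 0)
  coframe_indep : ∀ p ∈ U, LinearIndependent ℝ ![β p, γ p]
  d_a₀ : ∀ p ∈ U, ∀ X, D a₀ p X = β p X • a p 1 + γ p X • a p 2
  d_a : ∀ p ∈ U, ∀ X j,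
    D (fun q => a q j) p X = ∑ i, middleForm P p (β p X) (γ p X) i j • a p i

/-- `W` and `J` are the global invariants of `F`, given locally by `W = (p₁ + p₃) / 2` and
`J = (p₁ - p₃) / 2` for a middle frame field along `F`. -/
def HasInvariants (F : M → LaguerreSpace) (W J : M → ℝ) : Prop :=
  ∀ p, ∃ (U : Set M) (a₀ : M → V) (a : M → Fin 4 → V) (β γ : M → ℂ →L[ℝ] ℝ)
    (P : Invariants M), p ∈ U ∧ IsMiddleFrameField F U a₀ a β γ P ∧
      ∀ q ∈ U, W q = (P.p₁ q + P.p₃ q) / 2 ∧ J q = (P.p₁ q - P.p₃ q) / 2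

/-! ### L-isothermic immersions, their Blaschke potentials and T-transforms -/

/-- The form `e ^ u dx`, where `z = x + i y`. -/
def potentialDx (z : M → ℂ) (u : M → ℝ) (p : M) : ℂ →L[ℝ] ℝ :=
  Real.exp (u p) • (Complex.reCLM ∘L D z p)

/-- The form `e ^ u dy`, where `z = x + i y`. -/
def potentialDy (z : M → ℂ) (u : M → ℝ) (p : M) : ℂ →L[ℝ] ℝ :=
  Real.exp (u p) • (Complex.imCLM ∘L D z p)

/-- The partial derivative `∂g / ∂x` in the coordinate `z = x + i y`. -/
def partialX (z : M → ℂ) (g : M → ℝ) (p : M) : ℝ := D g p ((D z p).inverse 1)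

/-- The partial derivative `∂g / ∂y` in the coordinate `z = x + i y`. -/
def partialY (z : M → ℂ) (g : M → ℝ) (p : M) : ℝ := D g p ((D z p).inverse Complex.I)

/-- The Laplacian `Δg = g_xx + g_yy` in the coordinate `z = x + i y`. -/
def laplacian (z : M → ℂ) (g : M → ℝ) (p : M) : ℝ :=
  partialX z (partialX z g) p + partialY z (partialY z g) p

/-- `F` is a nondegenerate L-isothermic immersion, `z = x + i y` is an isothermal curvature
line coordinate (a smooth map `M → ℂ` that is a local coordinate near every point, as the
independence of the coframe shows) and `e ^ u` is the Blaschke potential: the middle coframe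
is `(e ^ u dx, e ^ u dy)`. -/
structure IsLIsothermic (F : M → LaguerreSpace) (z : M → ℂ) (u : M → ℝ) : Prop where
  nondegenerate : IsNondegenerateLegendreImmersion F
  smooth_z : ContMDiff 𝓘(ℝ, ℂ) 𝓘(ℝ, ℂ) ∞ z
  smooth_u : ContMDiff 𝓘(ℝ, ℂ) 𝓘(ℝ, ℝ) ∞ u
  middle : ∀ p, ∃ (U : Set M) (a₀ : M → V) (a : M → Fin 4 → V) (P : Invariants M),
    p ∈ U ∧ IsMiddleFrameField F U a₀ a (potentialDx z u) (potentialDy z u) P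

/-- A special L-isothermic immersion: `Δu = c e ^ (-2u)` for a real constant `c`. -/
def IsSpecialLIsothermic (F : M → LaguerreSpace) (z : M → ℂ) (u : M → ℝ) : Prop :=
  IsLIsothermic F z u ∧ ∃ c : ℝ, ∀ p, laplacian z u p = c * Real.exp (-2 * u p)

/-- The function `-(1/2) e ^ (-2u) Δu`. -/
def potentialJ (z : M → ℂ) (u : M → ℝ) (p : M) : ℝ :=
  -(1 / 2) * Real.exp (-2 * u p) * laplacian z u p

/-- `k` is the deformation parameter: `W = k e ^ (-2u)` and `J = -(1/2) e ^ (-2u) Δu`. -/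
def IsDeformationParameter (F : M → LaguerreSpace) (z : M → ℂ) (u : M → ℝ) (k : ℝ) : Prop :=
  HasInvariants F (fun p => k * Real.exp (-2 * u p)) (potentialJ z u)

/-- The coefficients of the form `α` that is built from `u` and a function `W`:
`p₁ = W + J`, `p₂ = 0`, `p₃ = W - J`, `q₁ = -e ^ (-u) u_y`, `q₂ = e ^ (-u) u_x`. -/
def spectralInvariants (z : M → ℂ) (u W : M → ℝ) : Invariants M where
  p₁ p := W p + potentialJ z u p
  p₂ _ := 0
  p₃ p := W p - potentialJ z u p
  q₁ p := -Real.exp (-u p) * partialY z u p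
  q₂ p := Real.exp (-u p) * partialX z u p

/-- `F` is the `T_m`-transform of the L-isothermic immersion `F₀` with coordinate `z` and
Blaschke potential `e ^ u`: if `W` is the invariant of `F₀` and `W_m = W + m e ^ (-2u)`, then
`F = [x, a₁]` for a smooth solution `A = (x, a) : M → L` of `dA = A α⁽ᵐ⁾`. -/
def IsTmTransform (z : M → ℂ) (u : M → ℝ) (m : ℝ) (F₀ F : M → LaguerreSpace) : Prop :=
  ∃ W : M → ℝ, HasInvariants F₀ W (potentialJ z u) ∧
    ∃ (x : M → V) (a : M → Fin 4 → V),
      IsMiddleFrameField F Set.univ x a (potentialDx z u) (potentialDy z u)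
        (spectralInvariants z u fun p => W p + m * Real.exp (-2 * u p))

/-- Two L-isothermic immersions are T-transforms of each other if they have the same Blaschke
potential and are not Laguerre equivalent. -/
def AreTTransforms (F F' : M → LaguerreSpace) : Prop :=
  (∃ (z : M → ℂ) (u : M → ℝ), IsLIsothermic F z u ∧ IsLIsothermic F' z u) ∧
    ¬ LaguerreEquivalent F F'

end Surface

end Laguerre

end

/-!
The proof rests on the fact that an L-isothermic immersion is determined by a global middle frame.

The lift `(a₀, a₁)` of a middle frame is unique, because `⟨da₀, da₀⟩` and `⟨da₁, da₁⟩` are both the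
sum of the squares of the coframe (`middle_eq`), and so are the invariants `W`, `J` and, once the
coframe is given, the whole frame (`middle_unique`). Hence the local middle frames with coframe
`(e^u dx, e^u dy)` fit together, and the structure equations express all their coefficients except
`W` through `u` (`IsLIsothermic.exists_global_frame`). If `Δu = c e^{-2u}`, the remaining structure
equations say that `e^{2u} W` is constant (`IsMiddleFrameField.D_deformation`). Its value is the
deformation parameter `k`.

Conversely, when `Δu = c e^{-2u}` the frame equation with `W = 0` is flat, and `M` is simply
connected. By the Frobenius theorem there is an immersion `F₀` with the same coordinate and
potential and with `W = 0` (`exists_frame_of_special`). The Frobenius theorem is proved here for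
equations `dΦ = Φ α` in a Banach algebra: local solutions are found along rays
(`exists_local_fundamental_solution`), and their constants of integration form a covering space
of `M`, which has a global section (`exists_global_section_of_locally_constant`). A solution of the
frame equation that is a frame at one point is one everywhere (`isLaguerreFrame_of_D`).

An immersion with `W = 0` is L-minimal (`IsMiddleFrameField.isLMinimal`). Indeed the Weingarten
density of a Legendre immersion `[x, v]` with shape operator `S` is bounded by the Dirichlet density
of its middle sphere map `x - (tr S / 2) v`, for any conformal structure (`densityForm_mul_le`). For
the conformal structure of the middle coframe of the given immersion equality holds along that
immersion, so that the two densities have the same first variation there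
(`IsPlanarVariation.fderiv_density`). The first variation of the Dirichlet energy involves only the
form `γ a₂ - β a₃`, the conjugate of `da₀ = β a₂ + γ a₃`, and this form is closed when `W = 0`
(`IsMiddleFrameField.conjugateForm_closed`): the middle sphere map is harmonic.

Finally, the uniqueness of the invariants shows that `F` is a `T_m`-transform of `F₀` only for
`m = k`. A Laguerre equivalence preserves `W` up to a diffeomorphism, and `W` vanishes identically
for `F₀` but nowhere for `F` if `k ≠ 0` (`transforms_of_frames`).
-/

namespace Laguerre

open Set Metric Filter Topology

/-! ### The Frobenius theorem in a Banach algebra -/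

/-- A function that vanishes to first order along the segment `[0, 1] × {0}` is `o(‖h‖)` there,
uniformly by compactness. -/
lemma exists_uniform_bound_of_fderiv_eq_zero {E F : Type*} [NormedAddCommGroup E]
    [NormedSpace ℝ E] [NormedAddCommGroup F] [NormedSpace ℝ F] {G : ℝ × E → F}
    (hG : ∀ t ∈ Icc (0 : ℝ) 1, ContDiffAt ℝ 1 G (t, 0))
    (h0 : ∀ t ∈ Icc (0 : ℝ) 1, G (t, 0) = 0)
    (h1 : ∀ t ∈ Icc (0 : ℝ) 1, ∀ k, fderiv ℝ G (t, 0) (0, k) = 0) {ε : ℝ} (hε : 0 < ε) :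
    ∃ δ > 0, ∀ h : E, ‖h‖ < δ → ∀ t ∈ Icc (0 : ℝ) 1, ‖G (t, h)‖ ≤ ε * ‖h‖ := by
  have key : ∀ᶠ h in 𝓝 (0 : E), ∀ t ∈ Icc (0 : ℝ) 1, DifferentiableAt ℝ G (t, h) ∧
      ‖(fderiv ℝ G (t, h)).comp (ContinuousLinearMap.inr ℝ ℝ E)‖ < ε := by
    apply isCompact_Icc.eventually_forall_of_forall_eventually
    intro t ht
    have hd : ∀ᶠ q in 𝓝 ((t, 0) : ℝ × E), ContDiffAt ℝ 1 G q := (hG t ht).eventually (by simp)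
    have hc : ContinuousAt (fun q : ℝ × E =>
        ‖(fderiv ℝ G q).comp (ContinuousLinearMap.inr ℝ ℝ E)‖) (t, 0) := by
      have : ContinuousAt (fderiv ℝ G) (t, 0) :=
        ((hG t ht).fderiv_right (m := 0) (by simp)).continuousAt
      fun_prop
    have hz : ‖(fderiv ℝ G (t, 0)).comp (ContinuousLinearMap.inr ℝ ℝ E)‖ < ε := by
      have : (fderiv ℝ G (t, 0)).comp (ContinuousLinearMap.inr ℝ ℝ E) = 0 := by
        ext k
        simpa using h1 t ht k
      rw [this]; simpa
    have he := hc.eventually (gt_mem_nhds hz)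
    have hsw : Tendsto (fun q : E × ℝ => (q.2, q.1)) (𝓝 (0, t)) (𝓝 (t, 0)) :=
      (continuous_swap.tendsto (0, t))
    filter_upwards [hsw.eventually hd, hsw.eventually he] with q hq1 hq2
    exact ⟨hq1.differentiableAt (by simp), hq2⟩
  obtain ⟨δ, hδ, hb⟩ := Metric.eventually_nhds_iff_ball.1 key
  refine ⟨δ, hδ, fun h hh t ht => ?_⟩
  have := (convex_ball (0 : E) δ).norm_image_sub_le_of_norm_hasFDerivWithin_le
    (f := fun k => G (t, k))
    (f' := fun k => (fderiv ℝ G (t, k)).comp (ContinuousLinearMap.inr ℝ ℝ E)) (C := ε)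
    (fun k hk => (((hb k hk t ht).1.hasFDerivAt).comp k
      (hasFDerivAt_prodMk_right t k)).hasFDerivWithinAt) (fun k hk => (hb k hk t ht).2.le)
    (mem_ball_self hδ) (by simpa using hh)
  simpa [h0 t ht] using this

/-- The equation `Y' = Y f` with small `f` has a solution on `[0, 1]` that stays within `1 / 2` of
the identity, so that it is invertible. -/
lemma exists_linear_ode_solution {A : Type*} [NormedRing A] [NormedAlgebra ℝ A] [CompleteSpace A]
    {f : ℝ → A} (hf : ContinuousOn f (Icc 0 1)) {K : ℝ} (hK : ∀ t ∈ Icc (0 : ℝ) 1, ‖f t‖ ≤ K)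
    (hK1 : K * (‖(1 : A)‖ + 1 / 2) ≤ 1 / 2) :
    ∃ Y : ℝ → A, Y 0 = 1 ∧ ∀ t ∈ Icc (0 : ℝ) 1, ‖Y t - 1‖ ≤ 1 / 2 ∧
      HasDerivWithinAt Y (Y t * f t) (Icc 0 1) t := by
  have hK0 : 0 ≤ K := (norm_nonneg _).trans (hK 0 (by simp))
  have hpl : IsPicardLindelof (fun t y => y * f t) (tmin := 0) (tmax := 1) ⟨0, by simp⟩ (1 : A)
      (1 / 2) 0 (1 / 2) K.toNNReal := by
    refine ⟨fun t ht => ?_, fun y _ => by fun_prop, fun t ht y hy => ?_, by simp⟩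
    · refine LipschitzOnWith.of_dist_le_mul fun y _ y' _ => ?_
      rw [Real.coe_toNNReal _ hK0]
      simp only [dist_eq_norm, ← sub_mul]
      refine (norm_mul_le _ _).trans ?_
      rw [mul_comm]
      exact mul_le_mul_of_nonneg_right (hK t ht) (norm_nonneg _)
    · have hy' : ‖y‖ ≤ ‖(1 : A)‖ + 1 / 2 := by
        have h1 : ‖y - 1‖ ≤ 1 / 2 := by simpa [dist_eq_norm] using hy
        linarith [norm_le_norm_add_norm_sub' y 1]
      refine (norm_mul_le _ _).trans ?_
      refine le_trans ?_ (hK1.trans (by simp))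
      rw [mul_comm]
      exact mul_le_mul (hK t ht) hy' (norm_nonneg _) hK0
  have hx : (1 : A) ∈ closedBall (1 : A) ((0 : NNReal) : ℝ) := by simp
  obtain ⟨α, hα⟩ := ODE.FunSpace.exists_isFixedPt_next hpl hx
  have heq : ∀ t ∈ Icc (0 : ℝ) 1, α.compProj t =
      ODE.picard (fun t y => y * f t) 0 1 α.compProj t := by
    intro t ht
    have := ODE.FunSpace.next_apply hpl hx α (t := ⟨t, ht⟩)
    rw [hα] at this
    exact (ODE.FunSpace.compProj_of_mem ht).trans this
  refine ⟨α.compProj, ?_, fun t ht => ⟨?_, ?_⟩⟩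
  · rw [heq 0 (by simp)]; simp
  · have := α.compProj_mem_closedBall hpl.mul_max_le (t := t)
    simpa [dist_eq_norm] using this
  · have := ODE.hasDerivWithinAt_picard_Icc (f := fun t y => y * f t) (t₀ := 0) (tmin := 0)
      (tmax := 1) (u := univ) (by simp)
      (continuousOn_snd.mul (hf.comp continuousOn_fst fun q hq => hq.1))
      α.continuous_compProj.continuousOn (by simp) (1 : A) ht
    exact this.congr (fun s hs => heq s hs) (heq t ht)

/-- Grönwall's inequality for an approximate and an exact solution of a linear equation. -/
lemma norm_sub_le_of_approx_linear_ode {A : Type*} [NormedRing A] [NormedAlgebra ℝ A]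
    {f y y' z : ℝ → A} {K ε : ℝ} (hK : 0 < K) (hε : 0 ≤ ε)
    (hf : ∀ t ∈ Icc (0 : ℝ) 1, ‖f t‖ ≤ K)
    (hy : ∀ t ∈ Icc (0 : ℝ) 1, HasDerivWithinAt y (y' t) (Icc 0 1) t)
    (hy' : ∀ t ∈ Icc (0 : ℝ) 1, ‖y' t - y t * f t‖ ≤ ε)
    (hz : ∀ t ∈ Icc (0 : ℝ) 1, HasDerivWithinAt z (z t * f t) (Icc 0 1) t)
    (h0 : y 0 = z 0) : ‖y 1 - z 1‖ ≤ ε * (Real.exp K / K) := by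
  have hIci : ∀ {g : ℝ → A} {g' : A} {t : ℝ}, t ∈ Ico (0 : ℝ) 1 →
      HasDerivWithinAt g g' (Icc 0 1) t → HasDerivWithinAt g g' (Ici t) t := by
    intro g g' t ht hg
    exact hg.mono_of_mem_nhdsWithin (mem_of_superset (Icc_mem_nhdsGE ht.2)
      (Icc_subset_Icc ht.1 le_rfl))
  have hI : Ico (0 : ℝ) 1 ⊆ Icc 0 1 := Ico_subset_Icc_self
  have h := norm_le_gronwallBound_of_norm_deriv_right_le (f := fun t => y t - z t)
    (f' := fun t => y' t - z t * f t) (δ := 0) (K := K) (ε := ε) (a := 0) (b := 1)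
    (fun t ht => ((hy t ht).continuousWithinAt.sub (hz t ht).continuousWithinAt))
    (fun t ht => (hIci ht (hy t (hI ht))).sub (hIci ht (hz t (hI ht))))
    (by simp [h0])
    (fun t ht => by
      have h1 : y' t - z t * f t = (y t - z t) * f t + (y' t - y t * f t) := by noncomm_ring
      rw [h1]
      refine (norm_add_le _ _).trans (add_le_add ?_ (hy' t (hI ht)))
      refine (norm_mul_le _ _).trans ?_
      rw [mul_comm]
      exact mul_le_mul_of_nonneg_right (hf t (hI ht)) (norm_nonneg _)) 1 (by simp)
  rw [gronwallBound_of_K_ne_0 hK.ne'] at h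
  simp only [sub_zero, mul_one, zero_mul, zero_add] at h
  refine h.trans ?_
  have h2 : ε * (Real.exp K / K) = ε / K * Real.exp K := by ring
  rw [h2]
  exact mul_le_mul_of_nonneg_left (by linarith) (by positivity)

/-- The `ε`-`δ` form of Fréchet differentiability, up to a constant. -/
lemma hasFDerivAt_of_forall_exists_norm_le {E F : Type*} [NormedAddCommGroup E] [NormedSpace ℝ E]
    [NormedAddCommGroup F] [NormedSpace ℝ F] {f : E → F} {f' : E →L[ℝ] F} {x : E} {C : ℝ}
    (hC : 0 < C)
    (H : ∀ ε > 0, ∃ δ > 0, ∀ h : E, ‖h‖ < δ → ‖f (x + h) - f x - f' h‖ ≤ C * (ε * ‖h‖)) :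
    HasFDerivAt f f' x := by
  rw [hasFDerivAt_iff_isLittleO_nhds_zero, Asymptotics.isLittleO_iff]
  intro c hc
  obtain ⟨δ, hδ, hh⟩ := H (c / C) (by positivity)
  filter_upwards [ball_mem_nhds (0 : E) hδ] with h hm
  refine (hh h (by simpa using hm)).trans (le_of_eq ?_)
  field_simp

noncomputable section Frobenius

variable {E A : Type*} [NormedAddCommGroup E] [NormedSpace ℝ E] [NormedRing A] [NormedAlgebra ℝ A]

/-- Up to the factor `Φ (x₀ + t w)`, the amount by which the first-order expansion
`Φ (x₀ + t w) * (1 + t α h)` of a solution of `dΦ = Φ α` along the segment to `x₀ + (w + h)`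
fails to satisfy the equation. -/
def frobeniusDefect (α : E → E →L[ℝ] A) (x₀ w : E) (q : ℝ × E) : A :=
  α (x₀ + q.1 • w) w * (1 + q.1 • α (x₀ + q.1 • w) q.2) +
    (α (x₀ + q.1 • w) q.2 + q.1 • fderiv ℝ α (x₀ + q.1 • w) w q.2) -
    (1 + q.1 • α (x₀ + q.1 • w) q.2) * α (x₀ + q.1 • (w + q.2)) (w + q.2)

lemma contDiffAt_frobeniusDefect {α : E → E →L[ℝ] A} {x₀ w : E} {t : ℝ}
    (hα : ContDiffAt ℝ 2 α (x₀ + t • w)) :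
    ContDiffAt ℝ 1 (frobeniusDefect α x₀ w) (t, 0) := by
  have h1 : ContDiffAt ℝ 1 (fun q : ℝ × E => α (x₀ + q.1 • w)) (t, 0) :=
    (hα.of_le (by norm_num)).comp (t, (0 : E)) (f := fun q : ℝ × E => x₀ + q.1 • w) (by fun_prop)
  have h2 : ContDiffAt ℝ 1 (fun q : ℝ × E => fderiv ℝ α (x₀ + q.1 • w)) (t, 0) :=
    (hα.fderiv_right (m := 1) (by norm_num)).comp (t, (0 : E))
      (f := fun q : ℝ × E => x₀ + q.1 • w) (by fun_prop)
  have h3 : ContDiffAt ℝ 1 (fun q : ℝ × E => α (x₀ + q.1 • (w + q.2))) (t, 0) :=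
    ContDiffAt.comp (t, (0 : E)) (f := fun q : ℝ × E => x₀ + q.1 • (w + q.2))
      (by simpa using hα.of_le (by norm_num)) (by fun_prop)
  have h4 : ContDiffAt ℝ 1 (fun q : ℝ × E => 1 + q.1 • α (x₀ + q.1 • w) q.2) (t, 0) :=
    contDiffAt_const.add (contDiffAt_fst.smul (h1.clm_apply contDiffAt_snd))
  exact (((h1.clm_apply contDiffAt_const).mul h4).add ((h1.clm_apply contDiffAt_snd).add
    (contDiffAt_fst.smul ((h2.clm_apply contDiffAt_const).clm_apply contDiffAt_snd)))).sub
    (h4.mul (h3.clm_apply (contDiffAt_const.add contDiffAt_snd)))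

/-- Flatness of `α` says that the defect vanishes to first order at `h = 0`. -/
lemma fderiv_frobeniusDefect {α : E → E →L[ℝ] A} {x₀ w : E} {t : ℝ}
    (hα : ContDiffAt ℝ 2 α (x₀ + t • w))
    (hflat : ∀ h k, α (x₀ + t • w) k * α (x₀ + t • w) h + fderiv ℝ α (x₀ + t • w) k h =
      α (x₀ + t • w) h * α (x₀ + t • w) k + fderiv ℝ α (x₀ + t • w) h k) (k : E) :
    fderiv ℝ (frobeniusDefect α x₀ w) (t, 0) (0, k) = 0 := by
  have hd : HasDerivAt (fun s : ℝ => frobeniusDefect α x₀ w (t, s • k))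
      (fderiv ℝ (frobeniusDefect α x₀ w) (t, 0) (0, k)) 0 := by
    have h1 : HasFDerivAt (frobeniusDefect α x₀ w) (fderiv ℝ (frobeniusDefect α x₀ w) (t, 0))
        ((fun s : ℝ => ((t, s • k) : ℝ × E)) 0) := by
      simpa using ((contDiffAt_frobeniusDefect hα).differentiableAt (by simp)).hasFDerivAt
    have h2 : HasDerivAt (fun s : ℝ => ((t, s • k) : ℝ × E)) (0, k) 0 :=
      (hasDerivAt_const 0 t).prodMk (by simpa using (hasDerivAt_id (0 : ℝ)).smul_const k)
    exact h1.comp_hasDerivAt 0 h2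
  refine hd.unique ?_
  set a := α (x₀ + t • w)
  set b := fderiv ℝ α (x₀ + t • w)
  have hs : HasDerivAt (fun s : ℝ => s • k) k 0 := by
    simpa using (hasDerivAt_id (0 : ℝ)).smul_const k
  have h1 : HasDerivAt (fun s : ℝ => a (s • k)) (a k) 0 := a.hasFDerivAt.comp_hasDerivAt 0 hs
  have h2 : HasDerivAt (fun s : ℝ => b w (s • k)) (b w k) 0 :=
    (b w).hasFDerivAt.comp_hasDerivAt 0 hs
  have h3 : HasDerivAt (fun s : ℝ => α (x₀ + t • (w + s • k))) (b (t • k)) 0 := by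
    have : HasFDerivAt α b ((fun s : ℝ => x₀ + t • (w + s • k)) 0) := by
      simpa using (hα.differentiableAt (by simp)).hasFDerivAt
    exact this.comp_hasDerivAt 0 (((hs.const_add w).const_smul t).const_add x₀)
  have h4 := h3.clm_apply (hs.const_add w)
  have h5 := ((h1.const_smul t).const_add 1)
  have h6 := ((h5.const_mul (a w)).add (h1.add (h2.const_smul t))).sub (h5.mul h4)
  have h7 : HasDerivAt (fun s : ℝ => frobeniusDefect α x₀ w (t, s • k)) _ 0 := h6
  refine h7.congr_deriv ?_
  have h8 : t • (a w * a k) + t • b w k = t • (a k * a w) + t • b k w := by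
    rw [← smul_add, ← smul_add, hflat w k]
  have h9 : (1 + (t • fun s : ℝ => a (s • k)) 0) = 1 := by simp
  rw [h9, one_mul]
  simp only [zero_smul, add_zero, map_smul, smul_apply, mul_smul_comm, smul_mul_assoc]
  rw [sub_eq_zero]
  calc _ = (t • (a w * a k) + t • b w k) + a k := by abel
    _ = _ := by rw [h8]; abel

lemma hasDerivAt_one_add_smul_ray {α : E → E →L[ℝ] A} {x₀ w : E} {t : ℝ}
    (hα : DifferentiableAt ℝ α (x₀ + t • w)) (h : E) :
    HasDerivAt (fun t : ℝ => 1 + t • α (x₀ + t • w) h)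
      (α (x₀ + t • w) h + t • fderiv ℝ α (x₀ + t • w) w h) t := by
  have h2 : HasDerivAt (fun t : ℝ => x₀ + t • w) w t := by
    simpa using ((hasDerivAt_id t).smul_const w).const_add x₀
  have h3 : HasDerivAt (fun t : ℝ => α (x₀ + t • w)) (fderiv ℝ α (x₀ + t • w) w) t :=
    hα.hasFDerivAt.comp_hasDerivAt t h2
  have h4 := ((hasDerivAt_id t).smul (h3.clm_apply (hasDerivAt_const t h))).const_add (1 : A)
  have h5 : HasDerivAt (fun t : ℝ => 1 + t • α (x₀ + t • w) h) _ t := h4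
  refine h5.congr_deriv ?_
  simp [add_comm]

/-- Local form of the Frobenius theorem: if `α` is a smooth flat connection form with values in a
Banach algebra, the equation `dΦ = Φ α` has an invertible solution near every point. It is found
by solving the equation along the rays from `x₀`. -/
theorem exists_local_fundamental_solution [CompleteSpace A] {α : E → E →L[ℝ] A} {U : Set E}
    (hU : IsOpen U) {x₀ : E} (hx₀ : x₀ ∈ U) (hα : ContDiffOn ℝ 2 α U)
    (hflat : ∀ x ∈ U, ∀ h k, α x k * α x h + fderiv ℝ α x k h =
      α x h * α x k + fderiv ℝ α x h k) :
    ∃ r > 0, ball x₀ r ⊆ U ∧ ∃ Φ : E → A, ∀ x ∈ ball x₀ r, IsUnit (Φ x) ∧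
      HasFDerivAt Φ ((ContinuousLinearMap.mul ℝ A (Φ x)).comp (α x)) x := by
  have hat : ∀ x ∈ U, ContDiffAt ℝ 2 α x := fun x hx => hα.contDiffAt (hU.mem_nhds hx)
  set N : ℝ := ‖(1 : A)‖ + 1 / 2
  have hN : 0 < N := by positivity
  set B : ℝ := ‖α x₀‖ + 1
  have hB : 0 < B := by positivity
  have hnear : ∀ᶠ x in 𝓝 x₀, x ∈ U ∧ ‖α x‖ < B :=
    Filter.Eventually.and (hU.mem_nhds hx₀)
      ((hat x₀ hx₀).continuousAt.norm.eventually (gt_mem_nhds (by simp [B])))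
  obtain ⟨r₀, hr₀, hball⟩ := Metric.eventually_nhds_iff_ball.1 hnear
  set K : ℝ := 1 / (2 * N)
  have hK : 0 < K := by positivity
  have hKN : K * N ≤ 1 / 2 := by simp only [K]; field_simp; norm_num
  set r : ℝ := min r₀ (K / B)
  have hr : 0 < r := lt_min hr₀ (by positivity)
  have hseg : ∀ w : E, ‖w‖ < r → ∀ t ∈ Icc (0 : ℝ) 1, x₀ + t • w ∈ ball x₀ r := by
    intro w hw t ht
    rw [mem_ball, dist_eq_norm, add_sub_cancel_left, norm_smul, Real.norm_of_nonneg ht.1]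
    exact (mul_le_of_le_one_left (norm_nonneg w) ht.2).trans_lt hw
  have hsub : ball x₀ r ⊆ ball x₀ r₀ := ball_subset_ball (min_le_left _ _)
  have hbound : ∀ w : E, ‖w‖ < r → ∀ t ∈ Icc (0 : ℝ) 1, ‖α (x₀ + t • w) w‖ ≤ K := by
    intro w hw t ht
    refine (ContinuousLinearMap.le_opNorm _ _).trans ?_
    calc _ ≤ B * (K / B) := mul_le_mul (hball _ (hsub (hseg w hw t ht))).2.le
          (hw.le.trans (min_le_right _ _)) (norm_nonneg _) hB.le
      _ = K := by field_simp
  have hray : ∀ w : E, ‖w‖ < r → ContinuousOn (fun t : ℝ => α (x₀ + t • w) w) (Icc 0 1) := by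
    intro w hw t ht
    have h1 : ContinuousAt α (x₀ + t • w) :=
      (hat _ (hball _ (hsub (hseg w hw t ht))).1).continuousAt
    have h2 : ContinuousAt (fun t : ℝ => α (x₀ + t • w)) t :=
      h1.comp (f := fun t : ℝ => x₀ + t • w) (by fun_prop)
    exact (h2.clm_apply continuousAt_const).continuousWithinAt
  have hsol : ∀ w : E, ∃ Y : ℝ → A, ‖w‖ < r → Y 0 = 1 ∧ ∀ t ∈ Icc (0 : ℝ) 1, ‖Y t - 1‖ ≤ 1 / 2 ∧
      HasDerivWithinAt Y (Y t * α (x₀ + t • w) w) (Icc 0 1) t := by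
    intro w
    by_cases hw : ‖w‖ < r
    · obtain ⟨Y, hY⟩ := exists_linear_ode_solution (hray w hw) (hbound w hw) hKN
      exact ⟨Y, fun _ => hY⟩
    · exact ⟨0, fun h => absurd h hw⟩
  choose Y hY using hsol
  refine ⟨r, hr, fun x hx => (hball x (hsub hx)).1, fun x => Y (x - x₀) 1, fun x hx => ?_⟩
  set w := x - x₀ with hwdef
  have hxw : x = x₀ + w := by simp [w]
  have hw : ‖w‖ < r := by simpa [w, dist_eq_norm] using hx
  obtain ⟨hY0, hYd⟩ := hY w hw
  constructor
  · have h1 := (hYd 1 (by simp)).1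
    have h2 : ‖1 - Y w 1‖ < 1 := by rw [norm_sub_rev]; linarith
    simpa using (Units.oneSub (1 - Y w 1) h2).isUnit
  have hYN : ∀ t ∈ Icc (0 : ℝ) 1, ‖Y w t‖ ≤ N := by
    intro t ht
    have := (hYd t ht).1
    have := norm_le_norm_add_norm_sub' (Y w t) 1
    simp only [N]; linarith
  -- Grönwall's inequality with Lipschitz constant `K` on `[0, 1]`
  refine hasFDerivAt_of_forall_exists_norm_le (C := N * (Real.exp K / K)) (by positivity)
    fun ε hε => ?_
  have hsegU : ∀ t ∈ Icc (0 : ℝ) 1, x₀ + t • w ∈ U := fun t ht =>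
    (hball _ (hsub (hseg w hw t ht))).1
  obtain ⟨δ, hδ, hdef⟩ := exists_uniform_bound_of_fderiv_eq_zero (G := frobeniusDefect α x₀ w)
    (fun t ht => contDiffAt_frobeniusDefect (hat _ (hsegU t ht)))
    (fun t _ => by simp [frobeniusDefect])
    (fun t ht k => fderiv_frobeniusDefect (hat _ (hsegU t ht)) (hflat _ (hsegU t ht)) k) hε
  refine ⟨min δ (r - ‖w‖), lt_min hδ (by linarith), fun h hh => ?_⟩
  have hwh : ‖w + h‖ < r := by
    have := hh.trans_le (min_le_right _ _)
    linarith [norm_add_le w h]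
  obtain ⟨hZ0, hZd⟩ := hY (w + h) hwh
  have hαd : ∀ t ∈ Icc (0 : ℝ) 1, HasDerivAt (fun t : ℝ => 1 + t • α (x₀ + t • w) h)
      (α (x₀ + t • w) h + t • fderiv ℝ α (x₀ + t • w) w h) t :=
    fun t ht => hasDerivAt_one_add_smul_ray ((hat _ (hsegU t ht)).differentiableAt (by simp)) h
  have hgron := norm_sub_le_of_approx_linear_ode (ε := N * (ε * ‖h‖)) hK (by positivity)
    (hbound _ hwh) (fun t ht => (hYd t ht).2.fun_mul (hαd t ht).hasDerivWithinAt)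
    (fun t ht => by
      have h1 := hdef h (hh.trans_le (min_le_left _ _)) t ht
      have h2 : Y w t * α (x₀ + t • w) w * (1 + t • α (x₀ + t • w) h) +
          Y w t * (α (x₀ + t • w) h + t • fderiv ℝ α (x₀ + t • w) w h) -
          Y w t * (1 + t • α (x₀ + t • w) h) * α (x₀ + t • (w + h)) (w + h) =
          Y w t * frobeniusDefect α x₀ w (t, h) := by
        simp only [frobeniusDefect]; noncomm_ring
      rw [h2]
      exact (norm_mul_le _ _).trans (mul_le_mul (hYN t ht) h1 (norm_nonneg _) hN.le))
    (fun t ht => (hZd t ht).2) (by simp [hY0, hZ0])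
  have hx1 : x + h - x₀ = w + h := by rw [hxw]; abel
  rw [hx1, norm_sub_rev, ContinuousLinearMap.comp_apply, ContinuousLinearMap.mul_apply']
  simp only [one_smul, ← hxw, mul_add, mul_one] at hgron
  have h1 : Y w 1 * α x h - (Y (w + h) 1 - Y w 1) = Y w 1 + Y w 1 * α x h - Y (w + h) 1 := by
    abel
  rw [h1]
  refine hgron.trans (le_of_eq (by ring))

end Frobenius

/-! ### Gluing over a simply connected space -/

/-- On a simply connected space, local sections of a principal bundle that agree up to locally
constant left factors can be multiplied by constants so as to fit together to a global section:
the bundle of all such constants is a covering, and coverings of a simply connected space have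
global sections. -/
theorem exists_global_section_of_locally_constant {X : Type*} [TopologicalSpace X]
    [SimplyConnectedSpace X] [LocallyPathConnectedSpace X] {G : Type*} [Group G]
    (U : X → Set X) (hU : ∀ i, IsOpen (U i)) (hmem : ∀ i, i ∈ U i) (Φ : X → X → G)
    (hΦ : ∀ i j, ∀ x ∈ U i ∩ U j, ∀ᶠ y in 𝓝 x, Φ i y * (Φ j y)⁻¹ = Φ i x * (Φ j x)⁻¹) (x₀ : X) :
    ∃ Ψ : X → G, Ψ x₀ = 1 ∧ ∀ x, ∃ C : G, ∀ᶠ y in 𝓝 x, Ψ y = C * Φ x y := by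
  let _ : TopologicalSpace G := ⊥
  have _ : DiscreteTopology G := ⟨rfl⟩
  have hpt : ∀ v : G, ∀ᶠ w in 𝓝 v, w = v := fun v => by
    rw [nhds_discrete]; exact eventually_pure.2 rfl
  let Z : FiberBundleCore X X G :=
    { baseSet := U
      isOpen_baseSet := hU
      indexAt := id
      mem_baseSet_at := hmem
      coordChange := fun i j x v => v * (Φ i x * (Φ j x)⁻¹)
      coordChange_self := fun i x _ v => by simp
      continuousOn_coordChange := fun i j => by
        rintro ⟨x, v⟩ ⟨hx, -⟩
        have h1 : ∀ᶠ q in 𝓝 (x, v), q.2 = v :=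
          (continuous_snd.tendsto (x, v)).eventually (hpt v)
        have h2 : ∀ᶠ q in 𝓝 (x, v), Φ i q.1 * (Φ j q.1)⁻¹ = Φ i x * (Φ j x)⁻¹ :=
          (continuous_fst.tendsto (x, v)).eventually (hΦ i j x hx)
        have h3 : (fun q : X × G => q.2 * (Φ i q.1 * (Φ j q.1)⁻¹)) =ᶠ[𝓝 (x, v)]
            fun _ => v * (Φ i x * (Φ j x)⁻¹) := by
          filter_upwards [h1, h2] with q hq1 hq2
          rw [hq1, hq2]
        exact (continuousAt_const.congr h3.symm).continuousWithinAt
      coordChange_comp := fun i j k x _ v => by group }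
  have hcov : IsCoveringMap Z.proj :=
    IsCoveringMap.mk Z.proj (fun _ : X => G) (fun x => Z.localTriv x) (fun x => hmem x)
  obtain ⟨S, ⟨hS0, hS⟩, -⟩ := hcov.existsUnique_continuousMap_lifts (ContinuousMap.id X) x₀
    (⟨x₀, ((Φ x₀ x₀)⁻¹ : G)⟩ : Z.TotalSpace) rfl
  have hproj : ∀ x, (S x).1 = x := fun x => congrFun hS x
  let c : Z.TotalSpace → G := fun q => q.2
  have hc0 : c (S x₀) = (Φ x₀ x₀)⁻¹ := by rw [hS0]
  refine ⟨fun x => c (S x) * Φ x x, by simp [hc0], fun x => ?_⟩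
  have hc : ContinuousAt (fun y => (Z.localTriv x (S y)).2) x := by
    refine continuous_snd.continuousAt.comp
      (ContinuousAt.comp (f := S) ?_ S.continuous.continuousAt)
    refine (Z.localTriv x).toOpenPartialHomeomorph.continuousAt ?_
    rw [Bundle.Trivialization.mem_source]
    change (S x).1 ∈ U x
    rw [hproj]; exact hmem x
  have hc' : ∀ᶠ y in 𝓝 x, (Z.localTriv x (S y)).2 = (Z.localTriv x (S x)).2 :=
    hc.eventually (hpt _)
  refine ⟨(Z.localTriv x (S x)).2, ?_⟩
  filter_upwards [hc'] with y hy
  rw [← hy]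
  change c (S y) * Φ y y = c (S y) * (Φ (S y).1 (S y).1 * (Φ x (S y).1)⁻¹) * Φ x y
  rw [hproj y]
  group

/-! ### Charts given by the coordinate `z` -/

section Charts

variable {M : Type*} [TopologicalSpace M] [ChartedSpace ℂ M]
variable {E : Type*} [NormedAddCommGroup E] [NormedSpace ℝ E]

lemma D_congr {g g' : M → E} {p : M} (h : g =ᶠ[𝓝 p] g') : D g p = D g' p := h.mfderiv_eq

/-- The differential of an inverse chart. -/
noncomputable def dSymm (e : OpenPartialHomeomorph M ℂ) (w : ℂ) : ℂ →L[ℝ] ℂ :=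
  mfderiv 𝓘(ℝ, ℂ) 𝓘(ℝ, ℂ) e.symm w

/-- In a chart, the differential `D` becomes the Fréchet derivative. -/
lemma hasFDerivAt_comp_chart_symm {e : OpenPartialHomeomorph M ℂ}
    (he : e ∈ IsManifold.maximalAtlas 𝓘(ℝ, ℂ) ∞ M) {w : ℂ} (hw : w ∈ e.target) {g : M → E}
    (hg : MDifferentiableAt 𝓘(ℝ, ℂ) 𝓘(ℝ, E) g (e.symm w)) :
    HasFDerivAt (g ∘ e.symm)
      ((D g (e.symm w)).comp (dSymm e w)) w := by
  have h1 : MDifferentiableAt 𝓘(ℝ, ℂ) 𝓘(ℝ, ℂ) e.symm w :=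
    (contMDiffAt_symm_of_mem_maximalAtlas he hw).mdifferentiableAt (by simp)
  exact (hasMFDerivAt_iff_hasFDerivAt).1 (hg.hasMFDerivAt.comp w h1.hasMFDerivAt)

lemma dSymm_bijective {e : OpenPartialHomeomorph M ℂ}
    (he : e ∈ IsManifold.maximalAtlas 𝓘(ℝ, ℂ) ∞ M) {w : ℂ} (hw : w ∈ e.target) :
    Function.Bijective (dSymm e w) := by
  have h : e.MDifferentiable 𝓘(ℝ, ℂ) 𝓘(ℝ, ℂ) :=
    ⟨(contMDiffOn_of_mem_maximalAtlas he).mdifferentiableOn (by simp),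
      (contMDiffOn_symm_of_mem_maximalAtlas he).mdifferentiableOn (by simp)⟩
  exact h.symm.mfderiv_bijective hw

lemma contDiffOn_comp_chart_symm {e : OpenPartialHomeomorph M ℂ}
    (he : e ∈ IsManifold.maximalAtlas 𝓘(ℝ, ℂ) ∞ M) {g : M → E} {U : Set M}
    (hg : ContMDiffOn 𝓘(ℝ, ℂ) 𝓘(ℝ, E) ∞ g U) :
    ContDiffOn ℝ ∞ (g ∘ e.symm) (e.target ∩ e.symm ⁻¹' U) :=
  (hg.comp ((contMDiffOn_symm_of_mem_maximalAtlas he).mono inter_subset_left)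
    fun _ hw => hw.2).contDiffOn

lemma contMDiffAt_of_comp_chart_symm {e : OpenPartialHomeomorph M ℂ}
    (he : e ∈ IsManifold.maximalAtlas 𝓘(ℝ, ℂ) ∞ M) {g : M → E} {p : M} (hp : p ∈ e.source)
    (hg : ContDiffAt ℝ ∞ (g ∘ e.symm) (e p)) : ContMDiffAt 𝓘(ℝ, ℂ) 𝓘(ℝ, E) ∞ g p := by
  have h1 : ContMDiffAt 𝓘(ℝ, ℂ) 𝓘(ℝ, E) ∞ ((g ∘ e.symm) ∘ e) p :=
    hg.contMDiffAt.comp p (contMDiffAt_of_mem_maximalAtlas he hp)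
  refine h1.congr_of_eventuallyEq ?_
  filter_upwards [e.open_source.mem_nhds hp] with q hq
  simp [e.left_inv hq]

/-- `e` is a chart of the surface given by the restriction of the map `z`. -/
structure IsZChart (z : M → ℂ) (e : OpenPartialHomeomorph M ℂ) : Prop where
  mem : e ∈ IsManifold.maximalAtlas 𝓘(ℝ, ℂ) ∞ M
  eq : EqOn e z e.source

/-- By the inverse function theorem, `z` restricts to a chart near every point where its
differential is injective. -/
lemma exists_isZChart [IsManifold 𝓘(ℝ, ℂ) ∞ M] {z : M → ℂ}
    (hz : ContMDiff 𝓘(ℝ, ℂ) 𝓘(ℝ, ℂ) ∞ z) {p : M}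
    (hD : Function.Injective (D z p)) : ∃ e, IsZChart z e ∧ p ∈ e.source := by
  set c := chartAt ℂ p
  have hc : c ∈ IsManifold.maximalAtlas 𝓘(ℝ, ℂ) ∞ M := IsManifold.chart_mem_maximalAtlas p
  have hpc : p ∈ c.source := mem_chart_source ℂ p
  have hf : ContDiffOn ℝ ∞ (z ∘ c.symm) c.target := by
    simpa using contDiffOn_comp_chart_symm hc hz.contMDiffOn (U := univ)
  have hfp : ContDiffAt ℝ ∞ (z ∘ c.symm) (c p) :=
    hf.contDiffAt (c.open_target.mem_nhds (c.map_source hpc))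
  have hd := hasFDerivAt_comp_chart_symm (g := z) hc (c.map_source hpc)
    (by rw [c.left_inv hpc]; exact (hz p).mdifferentiableAt (by simp))
  set T : ℂ →L[ℝ] ℂ := dSymm c (c p)
  set L : ℂ →L[ℝ] ℂ := (D z (c.symm (c p))).comp T
  have hinj : Function.Injective L := by
    have h1 : Function.Injective (D z (c.symm (c p))) := by rw [c.left_inv hpc]; exact hD
    exact h1.comp (dSymm_bijective hc (c.map_source hpc)).1
  let L' : ℂ ≃L[ℝ] ℂ := (LinearEquiv.ofInjectiveEndo (L : ℂ →ₗ[ℝ] ℂ) hinj).toContinuousLinearEquiv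
  have hL' : (L' : ℂ →L[ℝ] ℂ) = L := by ext1; rfl
  have hd' : HasFDerivAt (z ∘ c.symm) (L' : ℂ →L[ℝ] ℂ) (c p) := by rw [hL']; exact hd
  set f := hfp.toOpenPartialHomeomorph (z ∘ c.symm) hd' (by simp)
  have hcpf : c p ∈ f.source := hfp.mem_toOpenPartialHomeomorph_source hd' (by simp)
  have hnear : ∀ᶠ w in 𝓝 (c p), w ∈ c.target ∧ ∃ L : ℂ ≃L[ℝ] ℂ,
      fderiv ℝ (z ∘ c.symm) w = L := by
    refine Filter.Eventually.and (c.open_target.mem_nhds (c.map_source hpc)) ?_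
    have hcont : ContinuousAt (fderiv ℝ (z ∘ c.symm)) (c p) :=
      (hfp.fderiv_right (m := ∞) (by simp)).continuousAt
    have hev : ∀ᶠ A : ℂ →L[ℝ] ℂ in 𝓝 (fderiv ℝ (z ∘ c.symm) (c p)), ∃ L : ℂ ≃L[ℝ] ℂ, A = L := by
      rw [hd'.fderiv]
      filter_upwards [ContinuousLinearEquiv.nhds L'] with A hA
      obtain ⟨B, hB⟩ := hA
      exact ⟨B, hB.symm⟩
    exact hcont.eventually hev
  obtain ⟨N, hN, hNo, hpN⟩ := _root_.eventually_nhds_iff.1 hnear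
  set e := c.trans (f.restrOpen N hNo)
  have hez : ∀ q, e q = z (c.symm (c q)) := fun q => rfl
  have heq : EqOn e z e.source := by
    intro q hq
    rw [hez, c.left_inv hq.1]
  refine ⟨e, ⟨e.mem_maximalAtlas_of_contMDiffOn ?_ ?_, heq⟩, ?_⟩
  · exact hz.contMDiffOn.congr heq
  · intro y hy
    have hy1 := hy.1
    have hy2 : f.symm y ∈ c.target := hy.2
    have hyf : y ∈ f.target := by
      have := (f.restrOpen N hNo).map_target hy1
      simp at hy1
      exact hy1.1
    have hyN : f.symm y ∈ N := by
      have := (f.restrOpen N hNo).map_target hy1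
      simp at this
      exact this.2
    obtain ⟨L, hL⟩ := (hN _ hyN).2
    have hy3 : ContDiffAt ℝ ∞ (z ∘ c.symm) (f.symm y) := hf.contDiffAt (c.open_target.mem_nhds hy2)
    have hsm : ContDiffAt ℝ ∞ f.symm y := by
      refine f.contDiffAt_symm (f₀' := L) hyf ?_ hy3
      rw [← hL]; exact (hy3.differentiableAt (by simp)).hasFDerivAt
    have : ContMDiffAt 𝓘(ℝ, ℂ) 𝓘(ℝ, ℂ) ∞ (c.symm ∘ f.symm) y :=
      (contMDiffAt_symm_of_mem_maximalAtlas hc hy2).comp y hsm.contMDiffAt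
    exact this.contMDiffWithinAt
  · refine ⟨hpc, ?_⟩
    change c p ∈ (f.restrOpen N hNo).source
    simp [hcpf, hpN]

section ZChart

variable {z : M → ℂ} {e : OpenPartialHomeomorph M ℂ}

lemma IsZChart.z_symm (he : IsZChart z e) {w : ℂ} (hw : w ∈ e.target) : z (e.symm w) = w := by
  rw [← he.eq (e.map_target hw), e.right_inv hw]

lemma IsZChart.symm_z (he : IsZChart z e) {p : M} (hp : p ∈ e.source) : e.symm (z p) = p := by
  rw [← he.eq hp, e.left_inv hp]

lemma IsZChart.z_mem (he : IsZChart z e) {p : M} (hp : p ∈ e.source) : z p ∈ e.target := by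
  rw [← he.eq hp]; exact e.map_source hp

lemma IsZChart.z_eventuallyEq (he : IsZChart z e) {p : M} (hp : p ∈ e.source) : e =ᶠ[𝓝 p] z := by
  filter_upwards [e.open_source.mem_nhds hp] with q hq using he.eq hq

/-- The differential on the surface from the Fréchet derivative in the coordinate `z`. -/
lemma IsZChart.D_apply (he : IsZChart z e) {p : M} (hp : p ∈ e.source) {g : M → E}
    {L : ℂ →L[ℝ] E} (hg : HasFDerivAt (g ∘ e.symm) L (z p)) (X : ℂ) :
    D g p X = L (D z p X) := by
  have h1 : MDifferentiableAt 𝓘(ℝ, ℂ) 𝓘(ℝ, ℂ) e p :=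
    (contMDiffAt_of_mem_maximalAtlas he.mem hp).mdifferentiableAt (by simp)
  have h2 : HasMFDerivAt 𝓘(ℝ, ℂ) 𝓘(ℝ, ℂ) e p (D z p) := by
    have := h1.hasMFDerivAt
    rwa [(he.z_eventuallyEq hp).mfderiv_eq] at this
  have h3 : HasMFDerivAt 𝓘(ℝ, ℂ) 𝓘(ℝ, E) (g ∘ e.symm) (e p) L := by
    rw [he.eq hp]; exact hg.hasMFDerivAt
  have h4 : HasMFDerivAt 𝓘(ℝ, ℂ) 𝓘(ℝ, E) g p (L.comp (D z p)) := by
    refine (h3.comp p h2).congr_of_eventuallyEq ?_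
    filter_upwards [e.open_source.mem_nhds hp] with q hq
    simp [e.left_inv hq]
  exact DFunLike.congr_fun h4.mfderiv X

end ZChart

end Charts

/-! ### The Frobenius theorem on a simply connected surface -/

noncomputable section GlobalFrobenius

/-- A solution of `dΦ = Φ α` with smooth `α` is smooth. -/
lemma contDiffOn_of_hasFDerivAt_mul {E A : Type*} [NormedAddCommGroup E] [NormedSpace ℝ E]
    [NormedRing A] [NormedAlgebra ℝ A] {α : E → E →L[ℝ] A} {Φ : E → A} {U : Set E}
    (hU : IsOpen U) (hα : ContDiffOn ℝ ∞ α U)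
    (hΦ : ∀ x ∈ U, HasFDerivAt Φ ((ContinuousLinearMap.mul ℝ A (Φ x)).comp (α x)) x) :
    ContDiffOn ℝ ∞ Φ U := by
  rw [contDiffOn_infty]
  intro n
  induction n with
  | zero =>
    exact contDiffOn_zero.2 fun x hx => (hΦ x hx).continuousAt.continuousWithinAt
  | succ n ih =>
    have h1 : ContDiffOn ℝ n (fun x => (ContinuousLinearMap.mul ℝ A (Φ x)).comp (α x)) U :=
      ((ContinuousLinearMap.mul ℝ A).contDiff.comp_contDiffOn ih).clm_comp
        (hα.of_le (by exact_mod_cast le_top))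
    refine ((contDiffOn_succ_iff_fderiv_of_isOpen hU).2 ⟨fun x hx =>
      (hΦ x hx).differentiableAt.differentiableWithinAt, by simp, h1.congr fun x hx =>
      (hΦ x hx).fderiv⟩)

/-- Two solutions of `dΦ = Φ α` differ locally by a constant left factor. -/
lemma eventually_mul_inverse_eq {E A : Type*} [NormedAddCommGroup E] [NormedSpace ℝ E]
    [NormedRing A] [NormedAlgebra ℝ A] [CompleteSpace A] {α : E → E →L[ℝ] A} {Φ Ψ : E → A} {x : E}
    (hΦ : ∀ᶠ y in 𝓝 x, HasFDerivAt Φ ((ContinuousLinearMap.mul ℝ A (Φ y)).comp (α y)) y)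
    (hΨ : ∀ᶠ y in 𝓝 x, IsUnit (Ψ y) ∧
      HasFDerivAt Ψ ((ContinuousLinearMap.mul ℝ A (Ψ y)).comp (α y)) y) :
    ∀ᶠ y in 𝓝 x, Φ y * Ring.inverse (Ψ y) = Φ x * Ring.inverse (Ψ x) := by
  obtain ⟨r, hr, hb⟩ := Metric.eventually_nhds_iff_ball.1 (hΦ.and hΨ)
  have hd : ∀ y ∈ ball x r, HasFDerivAt (fun y => Φ y * Ring.inverse (Ψ y)) (0 : E →L[ℝ] A) y := by
    intro y hy
    obtain ⟨h1, ⟨v, hv⟩, h2⟩ := hb y hy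
    have h3 : HasFDerivAt Ring.inverse _ (Ψ y) := hv ▸ hasFDerivAt_ringInverse (𝕜 := ℝ) v
    refine (h1.mul' (h3.comp y h2)).congr_fderiv ?_
    ext h
    simp [← hv, mul_assoc]
  filter_upwards [ball_mem_nhds x hr] with y hy
  exact (convex_ball x r).is_const_of_fderivWithin_eq_zero
    (fun y hy => (hd y hy).differentiableAt.differentiableWithinAt)
    (fun y hy => by
      rw [fderivWithin_of_isOpen isOpen_ball hy, (hd y hy).fderiv]) hy (mem_ball_self hr)

lemma clm_apply_eq_re_im {E : Type*} [NormedAddCommGroup E] [NormedSpace ℝ E] (L : ℂ →L[ℝ] E)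
    (X : ℂ) : L X = X.re • L 1 + X.im • L Complex.I := by
  rw [← L.map_smul, ← L.map_smul, ← map_add]
  congr 1
  simp

/-- The form `P dx + Q dy`. -/
def connectionForm {A : Type*} [NormedRing A] [NormedAlgebra ℝ A] (P Q : ℂ → A) (w : ℂ) :
    ℂ →L[ℝ] A :=
  Complex.reCLM.smulRight (P w) + Complex.imCLM.smulRight (Q w)

/-- Flatness of `P dx + Q dy` is the single equation `P_y + Q P = Q_x + P Q`. -/
lemma connectionForm_flat {A : Type*} [NormedRing A] [NormedAlgebra ℝ A] {P Q : ℂ → A} {w : ℂ}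
    (hP : DifferentiableAt ℝ P w) (hQ : DifferentiableAt ℝ Q w)
    (h : fderiv ℝ P w Complex.I + Q w * P w = fderiv ℝ Q w 1 + P w * Q w) (X Y : ℂ) :
    connectionForm P Q w Y * connectionForm P Q w X + fderiv ℝ (connectionForm P Q) w Y X =
      connectionForm P Q w X * connectionForm P Q w Y + fderiv ℝ (connectionForm P Q) w X Y := by
  have hd : ∀ Y X, fderiv ℝ (connectionForm P Q) w Y X =
      X.re • fderiv ℝ P w Y + X.im • fderiv ℝ Q w Y := by
    intro Y X
    have h1 : HasFDerivAt (fun w => connectionForm P Q w X)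
        (X.re • fderiv ℝ P w + X.im • fderiv ℝ Q w) w := by
      simpa [connectionForm] using (hP.hasFDerivAt.const_smul X.re).fun_add
        (hQ.hasFDerivAt.const_smul X.im)
    have h2 : DifferentiableAt ℝ (connectionForm P Q) w := by
      unfold connectionForm
      exact ((ContinuousLinearMap.smulRightL ℝ ℂ A Complex.reCLM).differentiableAt.comp w hP).add
        ((ContinuousLinearMap.smulRightL ℝ ℂ A Complex.imCLM).differentiableAt.comp w hQ)
    have h3 := h1.unique (h2.hasFDerivAt.clm_apply (hasFDerivAt_const X w))
    have h4 := DFunLike.congr_fun h3 Y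
    simpa using h4.symm
  rw [hd, hd, clm_apply_eq_re_im (fderiv ℝ P w), clm_apply_eq_re_im (fderiv ℝ Q w),
    clm_apply_eq_re_im (fderiv ℝ P w) X, clm_apply_eq_re_im (fderiv ℝ Q w) X]
  have h5 : fderiv ℝ P w Complex.I = fderiv ℝ Q w 1 + P w * Q w - Q w * P w := by
    rw [← h]; abel
  rw [h5]
  simp only [connectionForm, add_apply, ContinuousLinearMap.smulRight_apply,
    Complex.reCLM_apply, Complex.imCLM_apply, mul_add, add_mul, smul_mul_smul_comm, smul_add,
    smul_sub, smul_smul]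
  module

variable {M : Type*} [TopologicalSpace M] [ChartedSpace ℂ M]
  [IsManifold 𝓘(ℝ, ℂ) ∞ M]

/-- Global form of the Frobenius theorem on a simply connected surface: the equation
`dΨ = Ψ (P dx + Q dy)` with a flat right-hand side has a solution. -/
theorem exists_global_fundamental_solution [SimplyConnectedSpace M]
    {A : Type*} [NormedRing A] [NormedAlgebra ℝ A]
    [CompleteSpace A] {z : M → ℂ} (hz : ContMDiff 𝓘(ℝ, ℂ) 𝓘(ℝ, ℂ) ∞ z)
    (hinj : ∀ p, Function.Injective (D z p)) {P Q : M → A}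
    (hP : ContMDiff 𝓘(ℝ, ℂ) 𝓘(ℝ, A) ∞ P) (hQ : ContMDiff 𝓘(ℝ, ℂ) 𝓘(ℝ, A) ∞ Q)
    (hflat : ∀ e, IsZChart z e → ∀ w ∈ e.target,
      fderiv ℝ (P ∘ e.symm) w Complex.I + Q (e.symm w) * P (e.symm w) =
        fderiv ℝ (Q ∘ e.symm) w 1 + P (e.symm w) * Q (e.symm w)) (p₀ : M) :
    ∃ Ψ : M → A, ContMDiff 𝓘(ℝ, ℂ) 𝓘(ℝ, A) ∞ Ψ ∧ Ψ p₀ = 1 ∧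
      ∀ p X, D Ψ p X = Ψ p * ((D z p X).re • P p + (D z p X).im • Q p) := by
  have : LocallyPathConnectedSpace M := ChartedSpace.locallyPathConnectedSpace ℂ M
  choose e he hpe using fun p => exists_isZChart hz (hinj p)
  set α : M → ℂ → ℂ →L[ℝ] A := fun p => connectionForm (P ∘ (e p).symm) (Q ∘ (e p).symm)
  have hPs : ∀ p, ContDiffOn ℝ ∞ (P ∘ (e p).symm) (e p).target := fun p => by
    simpa using contDiffOn_comp_chart_symm (he p).mem hP.contMDiffOn (U := univ)
  have hQs : ∀ p, ContDiffOn ℝ ∞ (Q ∘ (e p).symm) (e p).target := fun p => by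
    simpa using contDiffOn_comp_chart_symm (he p).mem hQ.contMDiffOn (U := univ)
  have hα : ∀ p, ContDiffOn ℝ ∞ (α p) (e p).target := fun p =>
    ((ContinuousLinearMap.smulRightL ℝ ℂ A Complex.reCLM).contDiff.comp_contDiffOn (hPs p)).add
      ((ContinuousLinearMap.smulRightL ℝ ℂ A Complex.imCLM).contDiff.comp_contDiffOn (hQs p))
  have hloc : ∀ p, ∃ r > 0, ball (z p) r ⊆ (e p).target ∧ ∃ Φ : ℂ → A, ∀ w ∈ ball (z p) r,
      IsUnit (Φ w) ∧ HasFDerivAt Φ ((ContinuousLinearMap.mul ℝ A (Φ w)).comp (α p w)) w := by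
    intro p
    refine exists_local_fundamental_solution (e p).open_target ((he p).z_mem (hpe p))
      ((hα p).of_le (WithTop.coe_le_coe.2 le_top)) fun w hw X Y => ?_
    have hnhds := (e p).open_target.mem_nhds hw
    exact connectionForm_flat (((hPs p).contDiffAt hnhds).differentiableAt (by simp))
      (((hQs p).contDiffAt hnhds).differentiableAt (by simp)) (hflat (e p) (he p) w hw) X Y
  choose r hr hball φ hφ using hloc
  set U : M → Set M := fun p => (e p).source ∩ z ⁻¹' ball (z p) (r p)
  have hU : ∀ p, IsOpen (U p) := fun p =>
    (e p).open_source.inter (isOpen_ball.preimage hz.continuous)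
  have hmem : ∀ p, p ∈ U p := fun p => ⟨hpe p, mem_ball_self (hr p)⟩
  classical
  set Φ : M → M → Aˣ := fun p q => if h : q ∈ U p then ((hφ p (z q) h.2).1).unit else 1
  have hΦ : ∀ p q, q ∈ U p → (Φ p q : A) = φ p (z q) := by
    intro p q hq
    simp [Φ, hq]
  have hΦi : ∀ p q, q ∈ U p → ((Φ p q)⁻¹ : Aˣ) = Ring.inverse (φ p (z q)) := by
    intro p q hq
    rw [← hΦ p q hq, Ring.inverse_unit]
  have hcomp : ∀ i j, ∀ x ∈ U i ∩ U j, ∀ᶠ y in 𝓝 x, Φ i y * (Φ j y)⁻¹ = Φ i x * (Φ j x)⁻¹ := by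
    intro i j x hx
    have hopen : IsOpen ((e i) '' (U i ∩ U j)) :=
      (e i).isOpen_image_of_subset_source ((hU i).inter (hU j)) fun q hq => hq.1.1
    have hnear : ∀ᶠ w in 𝓝 (z x), ∃ q ∈ U i ∩ U j, z q = w := by
      have : z x ∈ (e i) '' (U i ∩ U j) := ⟨x, hx, (he i).eq hx.1.1⟩
      filter_upwards [hopen.mem_nhds this] with w hw
      obtain ⟨q, hq, rfl⟩ := hw
      exact ⟨q, hq, ((he i).eq hq.1.1).symm⟩
    have h1 := eventually_mul_inverse_eq (α := α i) (Φ := φ i) (Ψ := φ j) (x := z x)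
      (by
        filter_upwards [hnear] with w hw
        obtain ⟨q, hq, rfl⟩ := hw
        exact (hφ i _ hq.1.2).2)
      (by
        filter_upwards [hnear] with w hw
        obtain ⟨q, hq, rfl⟩ := hw
        have h2 : α i (z q) = α j (z q) := by
          simp only [α, connectionForm, Function.comp_apply, (he i).symm_z hq.1.1,
            (he j).symm_z hq.2.1]
        rw [h2]
        exact hφ j _ hq.2.2)
    filter_upwards [hz.continuous.continuousAt.eventually h1,
      ((hU i).inter (hU j)).mem_nhds hx] with y hy hyU
    ext1
    rw [Units.val_mul, Units.val_mul, hΦ i y hyU.1, hΦ i x hx.1, hΦi j y hyU.2, hΦi j x hx.2]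
    exact hy
  obtain ⟨Ψ, hΨ0, hΨ⟩ := exists_global_section_of_locally_constant U hU hmem Φ hcomp p₀
  have hloc' : ∀ p, ∃ C : A, (fun q => (Ψ q : A)) =ᶠ[𝓝 p] fun q => C * φ p (z q) := by
    intro p
    obtain ⟨C, hC⟩ := hΨ p
    refine ⟨C, ?_⟩
    filter_upwards [hC, (hU p).mem_nhds (hmem p)] with q hq hqU
    rw [hq, Units.val_mul, hΦ p q hqU]
  have hφz : ∀ p (C : A), (fun q => C * φ p (z q)) ∘ (e p).symm =ᶠ[𝓝 (z p)] fun w => C * φ p w := by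
    intro p C
    filter_upwards [(e p).open_target.mem_nhds ((he p).z_mem (hpe p))] with w hw
    simp [(he p).z_symm hw]
  refine ⟨fun p => Ψ p, fun p => ?_, by simp [hΨ0], fun p X => ?_⟩
  · obtain ⟨C, hC⟩ := hloc' p
    refine ContMDiffAt.congr_of_eventuallyEq ?_ hC
    refine contMDiffAt_of_comp_chart_symm (he p).mem (hpe p) ?_
    rw [(he p).eq (hpe p)]
    refine ContDiffAt.congr_of_eventuallyEq ?_ (hφz p C)
    exact contDiffAt_const.mul ((contDiffOn_of_hasFDerivAt_mul isOpen_ball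
      ((hα p).mono (hball p)) fun w hw => (hφ p w hw).2).contDiffAt (ball_mem_nhds _ (hr p)))
  · obtain ⟨C, hC⟩ := hloc' p
    rw [D_congr hC]
    have h1 := ((hφ p (z p) (mem_ball_self (hr p))).2.const_mul C).congr_of_eventuallyEq (hφz p C)
    rw [(he p).D_apply (hpe p) h1]
    have h2 : (Ψ p : A) = C * φ p (z p) := hC.self_of_nhds
    change _ = (Ψ p : A) * _
    rw [h2]
    simp [α, connectionForm, (he p).symm_z (hpe p), mul_assoc, mul_add]

section MatrixForm

/-- The system `da_j = ∑ i, (P i j dx + Q i j dy) a_i` with a flat coefficient matrix has a global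
solution with prescribed initial values. -/
theorem exists_global_solution [SimplyConnectedSpace M] {n : Type*} [Fintype n] [DecidableEq n]
    {E : Type*} [NormedAddCommGroup E] [NormedSpace ℝ E] {z : M → ℂ}
    (hz : ContMDiff 𝓘(ℝ, ℂ) 𝓘(ℝ, ℂ) ∞ z)
    (hinj : ∀ p, Function.Injective (D z p)) {P Q : M → Matrix n n ℝ}
    (hP : ∀ i j, ContMDiff 𝓘(ℝ, ℂ) 𝓘(ℝ, ℝ) ∞ fun p => P p i j)
    (hQ : ∀ i j, ContMDiff 𝓘(ℝ, ℂ) 𝓘(ℝ, ℝ) ∞ fun p => Q p i j)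
    (hflat : ∀ e, IsZChart z e → ∀ w ∈ e.target, ∀ i j,
      fderiv ℝ (fun w => P (e.symm w) i j) w Complex.I + (Q (e.symm w) * P (e.symm w)) i j =
        fderiv ℝ (fun w => Q (e.symm w) i j) w 1 + (P (e.symm w) * Q (e.symm w)) i j)
    (p₀ : M) (C : n → E) :
    ∃ a : n → M → E, (∀ j, ContMDiff 𝓘(ℝ, ℂ) 𝓘(ℝ, E) ∞ (a j)) ∧ (∀ j, a j p₀ = C j) ∧
      ∀ p X j, D (a j) p X = ∑ i, ((D z p X).re * P p i j + (D z p X).im * Q p i j) • a i p := by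
  -- matrices as operators, an algebra that carries a canonical norm
  let A := (n → ℝ) →L[ℝ] (n → ℝ)
  let ι : Matrix n n ℝ → A := fun R => LinearMap.toContinuousLinearMap (Matrix.toLin' R)
  let entry : n → n → A →L[ℝ] ℝ := fun i j =>
    (ContinuousLinearMap.proj (R := ℝ) (φ := fun _ : n => ℝ) i).comp
      (ContinuousLinearMap.apply ℝ (n → ℝ) (Pi.single j 1))
  have hent : ∀ i j (S : A), entry i j S = S (Pi.single j 1) i := fun i j S => rfl
  have hentry : ∀ i j (R : Matrix n n ℝ), entry i j (ι R) = R i j := fun i j R => by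
    rw [hent]
    change R.toLin' (Pi.single j 1) i = R i j
    simp
  have hext : ∀ S T : A, (∀ i j, entry i j S = entry i j T) → S = T := by
    intro S T h
    refine ContinuousLinearMap.coe_injective ((Pi.basisFun ℝ n).ext fun j => ?_)
    funext i
    simpa [hent] using h i j
  have hι : ∀ R, ι R = ∑ i, ∑ j, R i j • ι (Matrix.single i j (1 : ℝ)) := by
    intro R
    refine hext _ _ fun k l => ?_
    simp only [map_sum, map_smul, hentry, Matrix.single_apply, smul_eq_mul]
    rw [Finset.sum_eq_single k (fun i _ hi => by simp [hi]) (by simp),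
      Finset.sum_eq_single l (fun i _ hi => by simp [hi]) (by simp)]
    simp
  have hmul : ∀ R S, ι R * ι S = ι (R * S) := by
    intro R S
    refine ContinuousLinearMap.ext fun x => ?_
    change R.toLin' (S.toLin' x) = (R * S).toLin' x
    simp
  have hemul : ∀ i j (S T : A), entry i j (S * T) = ∑ k, entry i k S * entry k j T := by
    intro i j S T
    have h1 : ∀ T : A, ι (Matrix.of fun i j => entry i j T) = T := fun T =>
      hext _ _ fun i j => by rw [hentry]; rfl
    rw [← h1 S, ← h1 T, hmul, hentry]
    simp [Matrix.mul_apply, hentry]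
  have hsm : ∀ {R : M → Matrix n n ℝ}, (∀ i j, ContMDiff 𝓘(ℝ, ℂ) 𝓘(ℝ, ℝ) ∞ fun p => R p i j) →
      ContMDiff 𝓘(ℝ, ℂ) 𝓘(ℝ, A) ∞ fun p => ι (R p) := by
    intro R hR
    have h1 : (fun p => ι (R p)) =
        fun p => ∑ i, ∑ j, R p i j • ι (Matrix.single i j (1 : ℝ)) := funext fun p => hι _
    rw [h1]
    exact contMDiff_finsetSum fun i _ => contMDiff_finsetSum fun j _ =>
      (hR i j).smul contMDiff_const
  have hder : ∀ {R : M → Matrix n n ℝ}, ContMDiff 𝓘(ℝ, ℂ) 𝓘(ℝ, A) ∞ (fun p => ι (R p)) →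
      ∀ e, IsZChart z e → ∀ w ∈ e.target, ∀ X i j,
        entry i j (fderiv ℝ ((fun p => ι (R p)) ∘ e.symm) w X) =
          fderiv ℝ (fun w => R (e.symm w) i j) w X := by
    intro R hR e he w hw X i j
    have h1 : ContDiffOn ℝ ∞ ((fun p => ι (R p)) ∘ e.symm) e.target := by
      simpa using contDiffOn_comp_chart_symm he.mem hR.contMDiffOn (U := univ)
    have h2 := ((h1.contDiffAt (e.open_target.mem_nhds hw)).differentiableAt
      (by simp)).hasFDerivAt
    have h3 := (entry i j).hasFDerivAt.comp w h2
    have h4 : (fun w => R (e.symm w) i j) = entry i j ∘ (fun p => ι (R p)) ∘ e.symm := by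
      funext w
      simp [hentry]
    rw [h4, h3.fderiv]; rfl
  obtain ⟨Ψ, hΨ, hΨ0, hΨd⟩ := exists_global_fundamental_solution hz hinj (hsm hP) (hsm hQ)
    (fun e he w hw => by
      refine hext _ _ fun i j => ?_
      rw [map_add, map_add, hder (hsm hP) e he w hw, hder (hsm hQ) e he w hw, hmul, hmul,
        hentry, hentry]
      exact hflat e he w hw i j) p₀
  let lin : n → A →L[ℝ] E := fun j => ∑ i, (entry i j).smulRight (C i)
  have hlin : ∀ j (R : A), lin j R = ∑ i, entry i j R • C i := fun j R => by
    simp [lin]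
  refine ⟨fun j p => lin j (Ψ p), fun j => (lin j).contMDiff.comp hΨ, fun j => ?_,
    fun p X j => ?_⟩
  · simp only [hΨ0, hlin]
    rw [Finset.sum_eq_single j]
    · rw [hent]
      change (Pi.single j (1 : ℝ) : n → ℝ) j • C j = C j
      simp
    · intro i _ hi
      rw [hent]
      change (Pi.single j (1 : ℝ) : n → ℝ) i • C i = 0
      simp [hi]
    · simp
  · have h1 : MDifferentiableAt 𝓘(ℝ, ℂ) 𝓘(ℝ, A) Ψ p := (hΨ p).mdifferentiableAt (by simp)
    have h2 : HasMFDerivAt 𝓘(ℝ, ℂ) 𝓘(ℝ, E) (fun p => lin j (Ψ p)) p ((lin j).comp (D Ψ p)) :=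
      (lin j).hasFDerivAt.hasMFDerivAt.comp p h1.hasMFDerivAt
    have h3 : D (fun p => lin j (Ψ p)) p X = lin j (D Ψ p X) :=
      DFunLike.congr_fun h2.mfderiv X
    rw [h3, hΨd p X, hlin]
    simp only [hlin, hemul, map_add, map_smul, hentry, Finset.smul_sum, Finset.sum_smul, smul_smul]
    rw [Finset.sum_comm]
    refine Finset.sum_congr rfl fun i _ => Finset.sum_congr rfl fun k _ => ?_
    congr 1
    simp only [smul_eq_mul]
    ring

end MatrixForm

end GlobalFrobenius

/-! ### The scalar product and frames -/

noncomputable section Minkowski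

lemma mink_comm (v w : V) : mink v w = mink w v := by simp only [mink]; ring

/-- The scalar product as a continuous bilinear map. -/
def minkL : V →L[ℝ] V →L[ℝ] ℝ :=
  LinearMap.toContinuousLinearMap
    { toFun := fun v => LinearMap.toContinuousLinearMap
        { toFun := fun w => mink v w
          map_add' := fun w w' => by simp only [mink, Pi.add_apply]; ring
          map_smul' := fun c w => by
            simp only [mink, Pi.smul_apply, smul_eq_mul, RingHom.id_apply]; ring }
      map_add' := fun v v' => by ext w; simp [mink]; ring
      map_smul' := fun c v => by ext w; simp [mink]; ring }

@[simp] lemma minkL_apply (v w : V) : minkL v w = mink v w := rfl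

lemma mink_add_left (v v' w : V) : mink (v + v') w = mink v w + mink v' w := by
  simp only [← minkL_apply, map_add, add_apply]
lemma mink_add_right (v w w' : V) : mink v (w + w') = mink v w + mink v w' := by
  simp only [← minkL_apply, map_add]
lemma mink_sub_right (v w w' : V) : mink v (w - w') = mink v w - mink v w' := by
  simp only [← minkL_apply, map_sub]
lemma mink_neg_left (v w : V) : mink (-v) w = -mink v w := by
  simp only [← minkL_apply, map_neg, neg_apply]
lemma mink_neg_right (v w : V) : mink v (-w) = -mink v w := by
  simp only [← minkL_apply, map_neg]
lemma mink_smul_left (c : ℝ) (v w : V) : mink (c • v) w = c * mink v w := by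
  simp only [← minkL_apply, map_smul, smul_apply, smul_eq_mul]
lemma mink_smul_right (c : ℝ) (v w : V) : mink v (c • w) = c * mink v w := by
  simp only [← minkL_apply, map_smul, smul_eq_mul]
lemma mink_zero_left (w : V) : mink 0 w = 0 := by simp [mink]

lemma gram_mul_gram : gram * gram = 1 := by
  ext i j
  fin_cases i <;> fin_cases j <;> simp [gram, Matrix.mul_apply, Fin.sum_univ_four]

lemma of_mul_gram_apply (a : Fin 4 → V) (i j : Fin 4) :
    (Matrix.of a * gram * (Matrix.of a).transpose) i j = mink (a i) (a j) := by
  simp [mink, gram, Matrix.mul_apply, Fin.sum_univ_four]; ring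

lemma transpose_mul_gram_apply (a : Fin 4 → V) (i j : Fin 4) :
    ((Matrix.of a).transpose * gram * Matrix.of a) i j =
      -(a 0 i * a 3 j + a 3 i * a 0 j) + a 1 i * a 1 j + a 2 i * a 2 j := by
  simp [gram, Matrix.mul_apply, Fin.sum_univ_four]; ring

lemma mul_gram_mul_transpose_comm {A : Matrix (Fin 4) (Fin 4) ℝ}
    (h : A * gram * A.transpose = gram) : A.transpose * gram * A = gram := by
  have h1 : (A * gram) * (A.transpose * gram) = 1 := by
    rw [← mul_assoc, h, gram_mul_gram]
  have h2 := mul_eq_one_comm.1 h1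
  calc A.transpose * gram * A = (A.transpose * gram) * (A * gram) * gram := by
        rw [mul_assoc _ (A * gram), mul_assoc A, gram_mul_gram, mul_one]
    _ = gram := by rw [h2, one_mul]

/-- A tuple of vectors has Gram matrix `g` if and only if it satisfies the dual relations. -/
lemma gram_eq_iff_dual (a : Fin 4 → V) :
    (∀ i j, mink (a i) (a j) = gram i j) ↔
      ∀ i j, -(a 0 i * a 3 j + a 3 i * a 0 j) + a 1 i * a 1 j + a 2 i * a 2 j = gram i j := by
  simp only [← of_mul_gram_apply, ← transpose_mul_gram_apply]
  constructor
  · intro h i j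
    exact congrFun (congrFun (mul_gram_mul_transpose_comm (Matrix.ext h)) i) j
  · intro h i j
    have h1 : (Matrix.of a).transpose * gram * (Matrix.of a).transpose.transpose = gram := by
      rw [Matrix.transpose_transpose]; exact Matrix.ext h
    have h2 := mul_gram_mul_transpose_comm h1
    rw [Matrix.transpose_transpose] at h2
    exact congrFun (congrFun h2 i) j

/-- Every vector is expanded in a frame by means of the dual frame `(-a₄, a₂, a₃, -a₁)`. -/
lemma expand_of_gram {a : Fin 4 → V} (h : ∀ i j, mink (a i) (a j) = gram i j) (v : V) :
    v = (-mink v (a 3)) • a 0 + mink v (a 1) • a 1 + mink v (a 2) • a 2 +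
      (-mink v (a 0)) • a 3 := by
  have hd := (gram_eq_iff_dual a).1 h
  funext i
  have h0 := hd i 0
  have h1 := hd i 1
  have h2 := hd i 2
  have h3 := hd i 3
  simp only [Pi.add_apply, Pi.smul_apply, smul_eq_mul, mink]
  fin_cases i <;> simp [gram] at h0 h1 h2 h3 ⊢ <;>
    linear_combination v 0 * h3 + v 3 * h0 - v 1 * h1 - v 2 * h2

namespace IsLaguerreFrame

variable {a : Fin 4 → V} (h : IsLaguerreFrame a)
include h

lemma mink00 : mink (a 0) (a 0) = 0 := by simp [h.gram_eq, gram]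
lemma mink01 : mink (a 0) (a 1) = 0 := by simp [h.gram_eq, gram]
lemma mink02 : mink (a 0) (a 2) = 0 := by simp [h.gram_eq, gram]
lemma mink03 : mink (a 0) (a 3) = -1 := by simp [h.gram_eq, gram]
lemma mink10 : mink (a 1) (a 0) = 0 := by simp [h.gram_eq, gram]
lemma mink11 : mink (a 1) (a 1) = 1 := by simp [h.gram_eq, gram]
lemma mink12 : mink (a 1) (a 2) = 0 := by simp [h.gram_eq, gram]
lemma mink13 : mink (a 1) (a 3) = 0 := by simp [h.gram_eq, gram]
lemma mink20 : mink (a 2) (a 0) = 0 := by simp [h.gram_eq, gram]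
lemma mink21 : mink (a 2) (a 1) = 0 := by simp [h.gram_eq, gram]
lemma mink22 : mink (a 2) (a 2) = 1 := by simp [h.gram_eq, gram]
lemma mink23 : mink (a 2) (a 3) = 0 := by simp [h.gram_eq, gram]
lemma mink30 : mink (a 3) (a 0) = -1 := by simp [h.gram_eq, gram]
lemma mink31 : mink (a 3) (a 1) = 0 := by simp [h.gram_eq, gram]
lemma mink32 : mink (a 3) (a 2) = 0 := by simp [h.gram_eq, gram]
lemma mink33 : mink (a 3) (a 3) = 0 := by simp [h.gram_eq, gram]

lemma expand (v : V) :
    v = (-mink v (a 3)) • a 0 + mink v (a 1) • a 1 + mink v (a 2) • a 2 + (-mink v (a 0)) • a 3 :=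
  expand_of_gram h.gram_eq v

end IsLaguerreFrame

/-! ### The positive light cone -/

lemma mem_posCone {v : V} : v ∈ posCone ↔ mink v v = 0 ∧ 0 < v 0 + v 3 := by
  have : mink v ![1, 0, 0, 1] = -(v 0 + v 3) := by
    simp only [mink]; simp
  change mink v v = 0 ∧ mink v ![1, 0, 0, 1] < 0 ↔ _
  rw [this, neg_lt_zero]

lemma nonneg_of_mem_posCone {v : V} (hv : v ∈ posCone) : 0 ≤ v 0 ∧ 0 ≤ v 3 := by
  obtain ⟨h1, h2⟩ := mem_posCone.1 hv
  simp only [mink] at h1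
  have h3 : 0 ≤ v 0 * v 3 := by nlinarith [sq_nonneg (v 1), sq_nonneg (v 2)]
  constructor <;> by_contra! h <;> nlinarith

/-- The reversed Cauchy-Schwarz inequality on the positive cone. -/
lemma mink_nonpos_of_mem_posCone {v w : V} (hv : v ∈ posCone) (hw : w ∈ posCone) :
    mink v w ≤ 0 := by
  obtain ⟨h1, h2⟩ := nonneg_of_mem_posCone hv
  obtain ⟨h3, h4⟩ := nonneg_of_mem_posCone hw
  have h5 := (mem_posCone.1 hv).1
  have h6 := (mem_posCone.1 hw).1
  simp only [mink] at h5 h6 ⊢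
  have h7 : (v 1 * w 1 + v 2 * w 2) ^ 2 ≤ (v 0 * w 3 + v 3 * w 0) ^ 2 := by
    have h8 : v 1 * v 1 + v 2 * v 2 = 2 * (v 0 * v 3) := by linarith
    have h9 : w 1 * w 1 + w 2 * w 2 = 2 * (w 0 * w 3) := by linarith
    calc (v 1 * w 1 + v 2 * w 2) ^ 2 ≤ (v 1 * v 1 + v 2 * v 2) * (w 1 * w 1 + w 2 * w 2) := by
          nlinarith [sq_nonneg (v 1 * w 2 - v 2 * w 1)]
      _ = 4 * ((v 0 * w 3) * (v 3 * w 0)) := by rw [h8, h9]; ring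
      _ ≤ _ := by nlinarith [sq_nonneg (v 0 * w 3 - v 3 * w 0)]
  have := abs_le_of_sq_le_sq h7 (by positivity)
  linarith [neg_le_of_abs_le this, le_of_abs_le this]

lemma mem_posCone_or_neg {v : V} (hv : mink v v = 0) (h0 : v ≠ 0) :
    v ∈ posCone ∨ -v ∈ posCone := by
  have h : v 0 + v 3 ≠ 0 := by
    intro h
    apply h0
    have h3 : v 3 = -v 0 := by linarith
    simp only [mink, h3] at hv
    have e0 : v 0 = 0 := by nlinarith [sq_nonneg (v 0), sq_nonneg (v 1), sq_nonneg (v 2)]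
    have e1 : v 1 = 0 := by nlinarith [sq_nonneg (v 0), sq_nonneg (v 1), sq_nonneg (v 2)]
    have e2 : v 2 = 0 := by nlinarith [sq_nonneg (v 0), sq_nonneg (v 1), sq_nonneg (v 2)]
    funext i
    fin_cases i <;> simp [e0, e1, e2, h3]
  rcases lt_or_gt_of_ne h with h | h
  · right
    refine mem_posCone.2 ⟨by rw [mink_neg_left, mink_neg_right, hv]; simp, ?_⟩
    simp only [Pi.neg_apply]; linarith
  · exact Or.inl (mem_posCone.2 ⟨hv, h⟩)

/-- The restricted Lorentz transformation with columns `a`. -/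
def frameMap (a : Fin 4 → V) (v : V) : V := ∑ i, v i • a i

lemma frameMap_eq (a : Fin 4 → V) (v : V) :
    frameMap a v = v 0 • a 0 + v 1 • a 1 + v 2 • a 2 + v 3 • a 3 := by
  simp [frameMap, Fin.sum_univ_four]

lemma frameMap_add (a : Fin 4 → V) (v w : V) :
    frameMap a (v + w) = frameMap a v + frameMap a w := by
  simp [frameMap, add_smul, Finset.sum_add_distrib]

lemma frameMap_smul (a : Fin 4 → V) (c : ℝ) (v : V) :
    frameMap a (c • v) = c • frameMap a v := by
  simp [frameMap, Finset.smul_sum, smul_smul]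

lemma laguerreMap_eq (x : V) (a : Fin 4 → V) (y : V) : laguerreMap x a y = x + frameMap a y := rfl

lemma IsLaguerreFrame.mink_frameMap {a : Fin 4 → V} (h : IsLaguerreFrame a) (v w : V) :
    mink (frameMap a v) (frameMap a w) = mink v w := by
  simp only [frameMap_eq, mink_add_left, mink_add_right, mink_smul_left, mink_smul_right,
    h.gram_eq]
  simp [gram, mink]; ring

lemma IsLaguerreFrame.frameMap_mem_posCone {a : Fin 4 → V} (h : IsLaguerreFrame a) {v : V}
    (hv : v ∈ posCone) : frameMap a v ∈ posCone := by
  have hnull : mink (frameMap a v) (frameMap a v) = 0 := by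
    rw [h.mink_frameMap, (mem_posCone.1 hv).1]
  have h3 : mink (frameMap a v) (a 0) = -v 3 := by
    simp [frameMap_eq, mink_add_left, mink_smul_left, h.mink00, h.mink10, h.mink20, h.mink30]
  have h0 : mink (frameMap a v) (a 3) = -v 0 := by
    simp [frameMap_eq, mink_add_left, mink_smul_left, h.mink03, h.mink13, h.mink23, h.mink33]
  have hpos := (mem_posCone.1 hv).2
  have hne : frameMap a v ≠ 0 := by
    intro h'
    rw [h', mink_zero_left] at h3 h0
    linarith
  rcases mem_posCone_or_neg hnull hne with h' | h'
  · exact h'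
  · exfalso
    have e1 := mink_nonpos_of_mem_posCone h' h.fst_mem
    have e2 := mink_nonpos_of_mem_posCone h' h.last_mem
    rw [mink_neg_left] at e1 e2
    linarith

lemma IsLaguerreFrame.frameMap {a b : Fin 4 → V} (h : IsLaguerreFrame a) (hb : IsLaguerreFrame b) :
    IsLaguerreFrame fun j => frameMap a (b j) where
  gram_eq i j := by rw [h.mink_frameMap, hb.gram_eq]
  det_eq := by
    have : Matrix.of (fun j => Laguerre.frameMap a (b j)) = Matrix.of b * Matrix.of a := by
      ext i j
      simp [Laguerre.frameMap, Matrix.mul_apply]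
    rw [this, Matrix.det_mul, hb.det_eq, h.det_eq, mul_one]
  fst_mem := h.frameMap_mem_posCone hb.fst_mem
  last_mem := h.frameMap_mem_posCone hb.last_mem

/-! ### Lines -/

lemma mem_line_self (x v : V) : x ∈ line x v := ⟨0, by simp⟩

/-- Two descriptions of an isotropic line differ by a shift along the line and a positive factor
of the direction. -/
lemma exists_of_line_eq {x v x' v' : V} (hv : v ∈ posCone) (hv' : v' ∈ posCone)
    (h : line x v = line x' v') : ∃ t r : ℝ, 0 < r ∧ x' = x + t • v ∧ v' = r • v := by
  obtain ⟨t, ht⟩ : x' ∈ line x v := h ▸ mem_line_self x' v'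
  obtain ⟨s, hs⟩ : x' + v' ∈ line x v := h ▸ (⟨1, by simp⟩ : x' + v' ∈ line x' v')
  have hv'' : v' = (s - t) • v := by
    rw [sub_smul, ← add_right_inj x', hs, ht]; abel
  refine ⟨t, s - t, ?_, ht, hv''⟩
  have h1 := (mem_posCone.1 hv').2
  rw [hv''] at h1
  have h2 : 0 < (s - t) * (v 0 + v 3) := by simpa [mul_add] using h1
  exact (pos_iff_pos_of_mul_pos h2).2 (mem_posCone.1 hv).2

lemma image_line (x : V) (a : Fin 4 → V) (y v : V) :
    laguerreMap x a '' line y v = line (laguerreMap x a y) (frameMap a v) := by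
  ext q
  simp only [laguerreMap_eq, line, mem_image, mem_ofPred_eq]
  constructor
  · rintro ⟨_, ⟨t, rfl⟩, rfl⟩
    exact ⟨t, by rw [frameMap_add, frameMap_smul]; abel⟩
  · rintro ⟨t, rfl⟩
    exact ⟨_, ⟨t, rfl⟩, by rw [frameMap_add, frameMap_smul]; abel⟩

end Minkowski

/-! ### Calculus of the differential `D` -/

noncomputable section MiddleFrames

variable {M : Type*} [TopologicalSpace M] [ChartedSpace ℂ M]

section Calculus

variable {E E' G : Type*} [NormedAddCommGroup E] [NormedSpace ℝ E] [NormedAddCommGroup E']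
  [NormedSpace ℝ E'] [NormedAddCommGroup G] [NormedSpace ℝ G]

lemma hasMFDerivAt_pair {f : M → E} {g : M → E'} {p : M}
    (hf : MDifferentiableAt 𝓘(ℝ, ℂ) 𝓘(ℝ, E) f p) (hg : MDifferentiableAt 𝓘(ℝ, ℂ) 𝓘(ℝ, E') g p) :
    HasMFDerivAt 𝓘(ℝ, ℂ) 𝓘(ℝ, E × E') (fun q => (f q, g q)) p ((D f p).prod (D g p)) :=
  ⟨hf.hasMFDerivAt.1.prodMk hg.hasMFDerivAt.1, hf.hasMFDerivAt.2.prodMk hg.hasMFDerivAt.2⟩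

lemma D_bilinear (B : E →L[ℝ] E' →L[ℝ] G) {f : M → E} {g : M → E'} {p : M}
    (hf : MDifferentiableAt 𝓘(ℝ, ℂ) 𝓘(ℝ, E) f p) (hg : MDifferentiableAt 𝓘(ℝ, ℂ) 𝓘(ℝ, E') g p)
    (X : ℂ) : D (fun q => B (f q) (g q)) p X = B (D f p X) (g p) + B (f p) (D g p X) := by
  have h1 := hasMFDerivAt_pair hf hg
  have h2 := (B.isBoundedBilinearMap.hasFDerivAt (f p, g p)).hasMFDerivAt.comp p h1
  have h3 := DFunLike.congr_fun h2.mfderiv X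
  change D (fun q => B (f q) (g q)) p X = B (f p) (D g p X) + B (D f p X) (g p) at h3
  rw [h3, add_comm]

lemma D_mink {f g : M → V} {p : M} (hf : MDifferentiableAt 𝓘(ℝ, ℂ) 𝓘(ℝ, V) f p)
    (hg : MDifferentiableAt 𝓘(ℝ, ℂ) 𝓘(ℝ, V) g p) (X : ℂ) :
    D (fun q => mink (f q) (g q)) p X = mink (D f p X) (g p) + mink (f p) (D g p X) :=
  D_bilinear minkL hf hg X

lemma D_smul {f : M → ℝ} {g : M → E} {p : M} (hf : MDifferentiableAt 𝓘(ℝ, ℂ) 𝓘(ℝ, ℝ) f p)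
    (hg : MDifferentiableAt 𝓘(ℝ, ℂ) 𝓘(ℝ, E) g p) (X : ℂ) :
    D (fun q => f q • g q) p X = D f p X • g p + f p • D g p X :=
  D_bilinear (ContinuousLinearMap.lsmul ℝ ℝ) hf hg X

lemma D_add {f g : M → E} {p : M} (hf : MDifferentiableAt 𝓘(ℝ, ℂ) 𝓘(ℝ, E) f p)
    (hg : MDifferentiableAt 𝓘(ℝ, ℂ) 𝓘(ℝ, E) g p) (X : ℂ) :
    D (fun q => f q + g q) p X = D f p X + D g p X :=
  DFunLike.congr_fun (hf.hasMFDerivAt.add hg.hasMFDerivAt).mfderiv X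

lemma mdifferentiableAt_bilinear (B : E →L[ℝ] E' →L[ℝ] G) {f : M → E} {g : M → E'} {p : M}
    (hf : MDifferentiableAt 𝓘(ℝ, ℂ) 𝓘(ℝ, E) f p)
    (hg : MDifferentiableAt 𝓘(ℝ, ℂ) 𝓘(ℝ, E') g p) :
    MDifferentiableAt 𝓘(ℝ, ℂ) 𝓘(ℝ, G) (fun q => B (f q) (g q)) p :=
  ((B.isBoundedBilinearMap.hasFDerivAt (f p, g p)).hasMFDerivAt.comp p
    (hasMFDerivAt_pair hf hg)).mdifferentiableAt

lemma mdifferentiableAt_mink {f g : M → V} {p : M}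
    (hf : MDifferentiableAt 𝓘(ℝ, ℂ) 𝓘(ℝ, V) f p) (hg : MDifferentiableAt 𝓘(ℝ, ℂ) 𝓘(ℝ, V) g p) :
    MDifferentiableAt 𝓘(ℝ, ℂ) 𝓘(ℝ, ℝ) (fun q => mink (f q) (g q)) p :=
  mdifferentiableAt_bilinear minkL hf hg

end Calculus

/-! ### Coframes -/

lemma coframe_det_ne_zero {β γ : ℂ →L[ℝ] ℝ} (h : LinearIndependent ℝ ![β, γ]) :
    β 1 * γ Complex.I - β Complex.I * γ 1 ≠ 0 := by
  intro h0
  rw [LinearIndependent.pair_iff] at h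
  have h1 := h (γ Complex.I) (-β Complex.I) (by
    ext X
    rw [clm_apply_eq_re_im _ X]
    simp only [add_apply, smul_apply, smul_eq_mul, zero_apply]
    linear_combination X.re * h0)
  have h2 := h (γ 1) (-β 1) (by
    ext X
    rw [clm_apply_eq_re_im _ X]
    simp only [add_apply, smul_apply, smul_eq_mul, zero_apply]
    linear_combination -X.im * h0)
  have h3 := h 1 0 (by
    ext X
    rw [clm_apply_eq_re_im _ X]
    simp only [add_apply, smul_apply, smul_eq_mul, zero_apply]
    linear_combination -X.re * h2.2 - X.im * h1.2)
  exact one_ne_zero h3.1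

lemma exists_dual_basis {β γ : ℂ →L[ℝ] ℝ} (h : LinearIndependent ℝ ![β, γ]) :
    ∃ X Y : ℂ, β X = 1 ∧ γ X = 0 ∧ β Y = 0 ∧ γ Y = 1 := by
  have hd := coframe_det_ne_zero h
  set d := β 1 * γ Complex.I - β Complex.I * γ 1 with hdef
  refine ⟨⟨γ Complex.I / d, -γ 1 / d⟩, ⟨-β Complex.I / d, β 1 / d⟩, ?_, ?_, ?_, ?_⟩ <;>
  · rw [clm_apply_eq_re_im]
    simp only [smul_eq_mul]
    field_simp
    rw [hdef]; try ring

lemma eq_zero_of_coframe_eq_zero {β γ : ℂ →L[ℝ] ℝ} (h : LinearIndependent ℝ ![β, γ]) {X : ℂ}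
    (hβ : β X = 0) (hγ : γ X = 0) : X = 0 := by
  have hd := coframe_det_ne_zero h
  rw [clm_apply_eq_re_im, smul_eq_mul, smul_eq_mul] at hβ hγ
  have h1 : X.re * (β 1 * γ Complex.I - β Complex.I * γ 1) = 0 := by
    linear_combination γ Complex.I * hβ - β Complex.I * hγ
  have h2 : X.im * (β 1 * γ Complex.I - β Complex.I * γ 1) = 0 := by
    linear_combination β 1 * hγ - γ 1 * hβ
  exact Complex.ext (by simpa [hd] using h1) (by simpa [hd] using h2)

/-! ### Middle frames -/

namespace IsMiddleFrameField

variable {F : M → LaguerreSpace} {U : Set M} {x : M → V} {a : M → Fin 4 → V}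
  {β γ : M → ℂ →L[ℝ] ℝ} {P : Invariants M} (h : IsMiddleFrameField F U x a β γ P)
include h

lemma contMDiffOn_a (j : Fin 4) : ContMDiffOn 𝓘(ℝ, ℂ) 𝓘(ℝ, V) ∞ (fun q => a q j) U :=
  (ContinuousLinearMap.proj (R := ℝ) (φ := fun _ : Fin 4 => V) j).contMDiff.comp_contMDiffOn
    h.smooth_a

variable {p : M} (hp : p ∈ U)
include hp

lemma mdifferentiableAt_x : MDifferentiableAt 𝓘(ℝ, ℂ) 𝓘(ℝ, V) x p :=
  (h.smooth_a₀.contMDiffAt (h.isOpen.mem_nhds hp)).mdifferentiableAt (by simp)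

lemma mdifferentiableAt_a (j : Fin 4) : MDifferentiableAt 𝓘(ℝ, ℂ) 𝓘(ℝ, V) (fun q => a q j) p :=
  ((h.contMDiffOn_a j).contMDiffAt (h.isOpen.mem_nhds hp)).mdifferentiableAt (by simp)

lemma D_a0 (X : ℂ) : D (fun q => a q 0) p X =
    (2 * P.q₂ p * β p X - 2 * P.q₁ p * γ p X) • a p 0 + β p X • a p 1 + (-γ p X) • a p 2 := by
  rw [h.d_a p hp]; simp [Fin.sum_univ_four, middleForm]

lemma D_a1 (X : ℂ) : D (fun q => a q 1) p X =
    (P.p₁ p * β p X + P.p₂ p * γ p X) • a p 0 + (P.q₁ p * β p X + P.q₂ p * γ p X) • a p 2 +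
      β p X • a p 3 := by
  rw [h.d_a p hp]; simp [Fin.sum_univ_four, middleForm]

lemma D_a2 (X : ℂ) : D (fun q => a q 2) p X =
    (P.p₂ p * β p X + P.p₃ p * γ p X) • a p 0 + (-P.q₁ p * β p X - P.q₂ p * γ p X) • a p 1 +
      (-γ p X) • a p 3 := by
  rw [h.d_a p hp]; simp [Fin.sum_univ_four, middleForm]

lemma D_a3 (X : ℂ) : D (fun q => a q 3) p X =
    (P.p₁ p * β p X + P.p₂ p * γ p X) • a p 1 + (P.p₂ p * β p X + P.p₃ p * γ p X) • a p 2 +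
      (-2 * P.q₂ p * β p X + 2 * P.q₁ p * γ p X) • a p 3 := by
  rw [h.d_a p hp]; simp [Fin.sum_univ_four, middleForm]

end IsMiddleFrameField

section Uniqueness

variable {F : M → LaguerreSpace} {U U' : Set M} {x x' : M → V} {a a' : M → Fin 4 → V}
  {β γ β' γ' : M → ℂ →L[ℝ] ℝ} {P P' : Invariants M}

/-- The middle sphere `a₀` and the normalized direction `a₁` of a middle frame are determined by
the immersion. Writing `a₀' = a₀ + t a₁` and `a₁' = r a₁`, both `⟨da₀', da₀'⟩` and `⟨da₁', da₁'⟩`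
are the sum of the squares of the coframe; comparing the two on the dual basis gives
`(1 + t)² = r² = (1 - t)²`. -/
theorem middle_eq (h : IsMiddleFrameField F U x a β γ P)
    (h' : IsMiddleFrameField F U' x' a' β' γ' P') {p : M} (hp : p ∈ U ∩ U') :
    x' p = x p ∧ a' p 0 = a p 0 := by
  have hex : ∀ q ∈ U ∩ U', ∃ t r : ℝ, 0 < r ∧ x' q = x q + t • a q 0 ∧ a' q 0 = r • a q 0 :=
    fun q hq => exists_of_line_eq (h.frame q hq.1).fst_mem (h'.frame q hq.2).fst_mem
      ((h.along q hq.1).symm.trans (h'.along q hq.2))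
  set t : M → ℝ := fun q => -mink (x' q - x q) (a q 3)
  set r : M → ℝ := fun q => -mink (a' q 0) (a q 3)
  have htr : ∀ q ∈ U ∩ U', 0 < r q ∧ x' q = x q + t q • a q 0 ∧ a' q 0 = r q • a q 0 := by
    intro q hq
    obtain ⟨s, ρ, hρ, h1, h2⟩ := hex q hq
    have h3 : t q = s := by
      simp only [t]
      rw [h1, add_sub_cancel_left, mink_smul_left, (h.frame q hq.1).mink03]; ring
    have h4 : r q = ρ := by
      simp only [r]
      rw [h2, mink_smul_left, (h.frame q hq.1).mink03]; ring
    rw [h3, h4]; exact ⟨hρ, h1, h2⟩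
  have hnhds : U ∩ U' ∈ 𝓝 p := (h.isOpen.inter h'.isOpen).mem_nhds hp
  have hx := h.mdifferentiableAt_x hp.1
  have hx' := h'.mdifferentiableAt_x hp.2
  have ha := h.mdifferentiableAt_a hp.1
  have ha' := h'.mdifferentiableAt_a hp.2
  have ht : MDifferentiableAt 𝓘(ℝ, ℂ) 𝓘(ℝ, ℝ) t p :=
    (mdifferentiableAt_mink (hx'.sub hx) (ha 3)).neg
  have hr : MDifferentiableAt 𝓘(ℝ, ℂ) 𝓘(ℝ, ℝ) r p := (mdifferentiableAt_mink (ha' 0) (ha 3)).neg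
  have hta : MDifferentiableAt 𝓘(ℝ, ℂ) 𝓘(ℝ, V) (fun q => t q • a q 0) p :=
    mdifferentiableAt_bilinear (ContinuousLinearMap.lsmul ℝ ℝ) ht (ha 0)
  have hDx : ∀ X, D x' p X = D x p X + (D t p X • a p 0 + t p • D (fun q => a q 0) p X) := by
    intro X
    rw [D_congr (g := x') (g' := fun q => x q + t q • a q 0)
      (by filter_upwards [hnhds] with q hq using (htr q hq).2.1), D_add hx hta, D_smul ht (ha 0)]
  have hDa : ∀ X, D (fun q => a' q 0) p X = D r p X • a p 0 + r p • D (fun q => a q 0) p X := by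
    intro X
    rw [D_congr (g := fun q => a' q 0) (g' := fun q => r q • a q 0)
      (by filter_upwards [hnhds] with q hq using (htr q hq).2.2), D_smul hr (ha 0)]
  have hf := h.frame p hp.1
  have hf' := h'.frame p hp.2
  have e1 : ∀ X, (β' p X) ^ 2 + (γ' p X) ^ 2 =
      (1 + t p) ^ 2 * (β p X) ^ 2 + (1 - t p) ^ 2 * (γ p X) ^ 2 := by
    intro X
    have h1 : mink (D x' p X) (D x' p X) = (β' p X) ^ 2 + (γ' p X) ^ 2 := by
      rw [h'.d_a₀ p hp.2]
      simp only [mink_add_left, mink_add_right, mink_smul_left, mink_smul_right, hf'.mink11,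
        hf'.mink12, hf'.mink21, hf'.mink22]; ring
    rw [← h1, hDx, h.d_a₀ p hp.1, h.D_a0 hp.1]
    simp only [mink_add_left, mink_add_right, mink_smul_left, mink_smul_right, hf.mink00, hf.mink01,
      hf.mink02, hf.mink10, hf.mink20, hf.mink11, hf.mink12, hf.mink21, hf.mink22]; ring
  have e2 : ∀ X, (β' p X) ^ 2 + (γ' p X) ^ 2 = (r p) ^ 2 * ((β p X) ^ 2 + (γ p X) ^ 2) := by
    intro X
    have h1 : mink (D (fun q => a' q 0) p X) (D (fun q => a' q 0) p X) =
        (β' p X) ^ 2 + (γ' p X) ^ 2 := by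
      rw [h'.D_a0 hp.2]
      simp only [mink_add_left, mink_add_right, mink_smul_left, mink_smul_right, hf'.mink00,
        hf'.mink01, hf'.mink02, hf'.mink10, hf'.mink20, hf'.mink11,
        hf'.mink12, hf'.mink21, hf'.mink22]; ring
    rw [← h1, hDa, h.D_a0 hp.1]
    simp only [mink_add_left, mink_add_right, mink_smul_left, mink_smul_right, hf.mink00, hf.mink01,
      hf.mink02, hf.mink10, hf.mink20, hf.mink11, hf.mink12, hf.mink21, hf.mink22]; ring
  obtain ⟨X, Y, hX1, hX2, hY1, hY2⟩ := exists_dual_basis (h.coframe_indep p hp.1)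
  have e3 := (e1 X).symm.trans (e2 X)
  have e4 := (e1 Y).symm.trans (e2 Y)
  rw [hX1, hX2] at e3
  rw [hY1, hY2] at e4
  obtain ⟨hr0, h1, h2⟩ := htr p hp
  have ht0 : t p = 0 := by linarith
  have hr1 : r p = 1 := by
    rw [ht0] at e3
    nlinarith
  rw [h1, h2, ht0, hr1]
  simp

/-- The last vector and the invariants `p₁`, `p₃` of a middle frame are determined by the
immersion, and the whole frame is once the coframe is given. The vectors `a₂`, `a₃` are unique up
to sign, since `⟨da₀, da₁⟩` and `⟨da₀, da₀⟩` fix the squares of the two forms of the coframe; `a₄`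
is then the null vector dual to `a₁`, and `p₁`, `p₃` are read off from `da₄`. -/
theorem middle_unique (h : IsMiddleFrameField F U x a β γ P)
    (h' : IsMiddleFrameField F U' x' a' β' γ' P') {p : M} (hp : p ∈ U ∩ U') :
    a' p 3 = a p 3 ∧ (β p = β' p → γ p = γ' p → a' p = a p) ∧
      P'.p₁ p = P.p₁ p ∧ P'.p₃ p = P.p₃ p := by
  have hnhds : U ∩ U' ∈ 𝓝 p := (h.isOpen.inter h'.isOpen).mem_nhds hp
  -- the part of the frame that does not involve the derivative of `a₄`
  have key : ∀ p ∈ U ∩ U', ∃ X Y : ℂ, β p X = 1 ∧ γ p X = 0 ∧ β p Y = 0 ∧ γ p Y = 1 ∧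
      γ' p X = 0 ∧ β' p Y = 0 ∧ a p 1 = β' p X • a' p 1 ∧ a p 2 = γ' p Y • a' p 2 ∧
      a' p 3 = a p 3 := by
    intro p hp
    have hnhds : U ∩ U' ∈ 𝓝 p := (h.isOpen.inter h'.isOpen).mem_nhds hp
    have hf := h.frame p hp.1
    have hf' := h'.frame p hp.2
    have hx : ∀ X, D x' p X = D x p X := fun X => by
      rw [D_congr (by filter_upwards [hnhds] with q hq using (middle_eq h h' hq).1)]
    have ha : ∀ X, D (fun q => a' q 0) p X = D (fun q => a q 0) p X := fun X => by
      rw [D_congr (by filter_upwards [hnhds] with q hq using (middle_eq h h' hq).2)]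
    have h0 : a' p 0 = a p 0 := (middle_eq h h' hp).2
    have e1 : ∀ X, β' p X • a' p 1 + γ' p X • a' p 2 = β p X • a p 1 + γ p X • a p 2 := fun X => by
      rw [← h.d_a₀ p hp.1, ← h'.d_a₀ p hp.2, hx]
    have e2 : ∀ X, (β' p X) ^ 2 - (γ' p X) ^ 2 = (β p X) ^ 2 - (γ p X) ^ 2 := fun X => by
      have h1 : mink (D x' p X) (D (fun q => a' q 0) p X) = (β' p X) ^ 2 - (γ' p X) ^ 2 := by
        rw [h'.d_a₀ p hp.2, h'.D_a0 hp.2]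
        simp only [mink_add_left, mink_add_right, mink_smul_left, mink_smul_right,
          hf'.mink10, hf'.mink20, hf'.mink11, hf'.mink12, hf'.mink21, hf'.mink22]; ring
      rw [← h1, hx, ha, h.d_a₀ p hp.1, h.D_a0 hp.1]
      simp only [mink_add_left, mink_add_right, mink_smul_left, mink_smul_right,
          hf.mink10, hf.mink20, hf.mink11, hf.mink12, hf.mink21, hf.mink22]; ring
    have e3 : ∀ X, (β' p X) ^ 2 + (γ' p X) ^ 2 = (β p X) ^ 2 + (γ p X) ^ 2 := fun X => by
      have h1 := congrArg (fun v => mink v v) (e1 X)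
      simp only [mink_add_left, mink_add_right, mink_smul_left, mink_smul_right,
        hf.mink11, hf.mink12, hf.mink21, hf.mink22, hf'.mink11, hf'.mink12, hf'.mink21,
        hf'.mink22] at h1
      linarith
    obtain ⟨X, Y, hX1, hX2, hY1, hY2⟩ := exists_dual_basis (h.coframe_indep p hp.1)
    have f1 : γ' p X = 0 := by
      have := e2 X; have := e3 X
      rw [hX1, hX2] at *
      nlinarith
    have f2 : β' p Y = 0 := by
      have := e2 Y; have := e3 Y
      rw [hY1, hY2] at *
      nlinarith
    have g1 : a p 1 = β' p X • a' p 1 := by simpa [hX1, hX2, f1] using (e1 X).symm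
    have g2 : a p 2 = γ' p Y • a' p 2 := by simpa [hY1, hY2, f2] using (e1 Y).symm
    refine ⟨X, Y, hX1, hX2, hY1, hY2, f1, f2, g1, g2, ?_⟩
    have k1 : mink (a' p 3) (a p 1) = 0 := by rw [g1, mink_smul_right, hf'.mink31, mul_zero]
    have k2 : mink (a' p 3) (a p 2) = 0 := by rw [g2, mink_smul_right, hf'.mink32, mul_zero]
    have k0 : mink (a' p 3) (a p 0) = -1 := by rw [← h0, hf'.mink30]
    have k : a' p 3 = (-mink (a' p 3) (a p 3)) • a p 0 + a p 3 := by
      conv_lhs => rw [hf.expand (a' p 3), k0, k1, k2]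
      simp
    have k3 := hf'.mink33
    rw [k] at k3
    simp only [mink_add_left, mink_add_right, mink_smul_left, mink_smul_right, hf.mink00,
      hf.mink03, hf.mink30, hf.mink33] at k3
    have k4 : mink (a' p 3) (a p 3) = 0 := by linarith
    rw [k, k4]; simp
  obtain ⟨X, Y, hX1, hX2, hY1, hY2, f1, f2, g1, g2, g3⟩ := key p hp
  have hf := h.frame p hp.1
  have hf' := h'.frame p hp.2
  have hd : ∀ X, D (fun q => a' q 3) p X = D (fun q => a q 3) p X := fun X => by
    rw [D_congr (by
      filter_upwards [hnhds] with q hq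
      obtain ⟨-, -, -, -, -, -, -, -, -, -, hq3⟩ := key q hq
      exact hq3)]
  refine ⟨g3, fun hβ hγ => ?_, ?_, ?_⟩
  · rw [← hβ, hX1, one_smul] at g1
    rw [← hγ, hY2, one_smul] at g2
    funext j
    fin_cases j
    exacts [(middle_eq h h' hp).2, g1.symm, g2.symm, g3]
  · have k1 : mink (D (fun q => a' q 3) p X) (a' p 1) = P'.p₁ p * β' p X := by
      rw [h'.D_a3 hp.2, f1]
      simp [mink_add_left, mink_smul_left, mink_neg_left, hf'.mink11, hf'.mink21, hf'.mink31]
    have k2 : mink (D (fun q => a q 3) p X) (a p 1) = P.p₁ p := by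
      rw [h.D_a3 hp.1, hX1, hX2]
      simp [mink_add_left, mink_smul_left, mink_neg_left, hf.mink11, hf.mink21, hf.mink31]
    have k3 := hf.mink11
    rw [g1, mink_smul_left, mink_smul_right, hf'.mink11] at k3
    rw [g1, mink_smul_right, ← hd, k1] at k2
    linear_combination k2 - P'.p₁ p * k3
  · have k1 : mink (D (fun q => a' q 3) p Y) (a' p 2) = P'.p₃ p * γ' p Y := by
      rw [h'.D_a3 hp.2, f2]
      simp [mink_add_left, mink_smul_left, hf'.mink12, hf'.mink22, hf'.mink32]
    have k2 : mink (D (fun q => a q 3) p Y) (a p 2) = P.p₃ p := by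
      rw [h.D_a3 hp.1, hY1, hY2]
      simp [mink_add_left, mink_smul_left, hf.mink12, hf.mink22, hf.mink32]
    have k3 := hf.mink22
    rw [g2, mink_smul_left, mink_smul_right, hf'.mink22] at k3
    rw [g2, mink_smul_right, ← hd, k1] at k2
    linear_combination k2 - P'.p₃ p * k3

/-- The invariants `W` and `J` do not depend on the middle frame. -/
theorem HasInvariants.unique {W J W' J' : M → ℝ} (h : HasInvariants F W J)
    (h' : HasInvariants F W' J') (p : M) : W' p = W p ∧ J' p = J p := by
  obtain ⟨U, x, a, β, γ, P, hp, hm, hWJ⟩ := h p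
  obtain ⟨U', x', a', β', γ', P', hp', hm', hWJ'⟩ := h' p
  obtain ⟨-, -, h1, h3⟩ := middle_unique hm hm' ⟨hp, hp'⟩
  rw [(hWJ p hp).1, (hWJ p hp).2, (hWJ' p hp').1, (hWJ' p hp').2, h1, h3]
  exact ⟨rfl, rfl⟩

end Uniqueness

end MiddleFrames

noncomputable section StructureEquations

variable {M N : Type*} [TopologicalSpace M] [ChartedSpace ℂ M] [TopologicalSpace N]
  [ChartedSpace ℂ N]

/-! ### Change of parameters and gluing -/

/-- The differential of a map between surfaces. -/
def dMap (ψ : N → M) (q : N) : ℂ →L[ℝ] ℂ := mfderiv 𝓘(ℝ, ℂ) 𝓘(ℝ, ℂ) ψ q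

lemma D_comp {E : Type*} [NormedAddCommGroup E] [NormedSpace ℝ E] {ψ : N → M} {g : M → E} {q : N}
    (hg : MDifferentiableAt 𝓘(ℝ, ℂ) 𝓘(ℝ, E) g (ψ q))
    (hψ : MDifferentiableAt 𝓘(ℝ, ℂ) 𝓘(ℝ, ℂ) ψ q) (X : ℂ) :
    D (g ∘ ψ) q X = D g (ψ q) (dMap ψ q X) :=
  DFunLike.congr_fun (hg.hasMFDerivAt.comp q hψ.hasMFDerivAt).mfderiv X

lemma linearIndependent_comp {β γ : ℂ →L[ℝ] ℝ} (h : LinearIndependent ℝ ![β, γ]) {T : ℂ →L[ℝ] ℂ}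
    (hT : Function.Bijective T) : LinearIndependent ℝ ![β.comp T, γ.comp T] := by
  rw [LinearIndependent.pair_iff] at h ⊢
  intro s t hst
  refine h s t ?_
  ext X
  obtain ⟨Y, rfl⟩ := hT.2 X
  exact DFunLike.congr_fun hst Y

/-- The invariants after a change of parameters. -/
def Invariants.comp (P : Invariants M) (ψ : N → M) : Invariants N where
  p₁ := P.p₁ ∘ ψ
  p₂ := P.p₂ ∘ ψ
  p₃ := P.p₃ ∘ ψ
  q₁ := P.q₁ ∘ ψ
  q₂ := P.q₂ ∘ ψ

variable {F : M → LaguerreSpace} {U : Set M} {x : M → V} {a : M → Fin 4 → V}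
  {β γ : M → ℂ →L[ℝ] ℝ} {P : Invariants M}

/-- A middle frame field may be pulled back by a local diffeomorphism. -/
lemma IsMiddleFrameField.comp (h : IsMiddleFrameField F U x a β γ P) {ψ : N → M} {O : Set N}
    (hO : IsOpen O) (hψ : ContMDiffOn 𝓘(ℝ, ℂ) 𝓘(ℝ, ℂ) ∞ ψ O) (hmaps : MapsTo ψ O U)
    (hbij : ∀ q ∈ O, Function.Bijective (dMap ψ q)) :
    IsMiddleFrameField (F ∘ ψ) O (x ∘ ψ) (a ∘ ψ) (fun q => (β (ψ q)).comp (dMap ψ q))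
      (fun q => (γ (ψ q)).comp (dMap ψ q)) (P.comp ψ) := by
  have hd : ∀ q ∈ O, MDifferentiableAt 𝓘(ℝ, ℂ) 𝓘(ℝ, ℂ) ψ q := fun q hq =>
    (hψ.contMDiffAt (hO.mem_nhds hq)).mdifferentiableAt (by simp)
  refine ⟨hO, h.smooth_a₀.comp hψ hmaps, h.smooth_a.comp hψ hmaps, h.smooth_p₁.comp hψ hmaps,
    h.smooth_p₂.comp hψ hmaps, h.smooth_p₃.comp hψ hmaps, h.smooth_q₁.comp hψ hmaps,
    h.smooth_q₂.comp hψ hmaps, fun q hq => h.frame _ (hmaps hq), fun q hq => h.along _ (hmaps hq),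
    fun q hq => linearIndependent_comp (h.coframe_indep _ (hmaps hq)) (hbij q hq),
    fun q hq X => ?_, fun q hq X j => ?_⟩
  · rw [D_comp (h.mdifferentiableAt_x (hmaps hq)) (hd q hq), h.d_a₀ _ (hmaps hq)]; rfl
  · have := D_comp (h.mdifferentiableAt_a (hmaps hq) j) (hd q hq) X
    change D (fun q => (a ∘ ψ) q j) q X = _ at this
    rw [this, h.d_a _ (hmaps hq)]; rfl

lemma IsMiddleFrameField.congr (h : IsMiddleFrameField F U x a β γ P) {x' : M → V}
    {a' : M → Fin 4 → V} {β' γ' : M → ℂ →L[ℝ] ℝ} {P' : Invariants M} (hx : EqOn x' x U)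
    (ha : EqOn a' a U) (hβ : EqOn β' β U) (hγ : EqOn γ' γ U) (hp₁ : EqOn P'.p₁ P.p₁ U)
    (hp₂ : EqOn P'.p₂ P.p₂ U) (hp₃ : EqOn P'.p₃ P.p₃ U) (hq₁ : EqOn P'.q₁ P.q₁ U)
    (hq₂ : EqOn P'.q₂ P.q₂ U) : IsMiddleFrameField F U x' a' β' γ' P' := by
  refine ⟨h.isOpen, h.smooth_a₀.congr hx, h.smooth_a.congr ha, h.smooth_p₁.congr hp₁,
    h.smooth_p₂.congr hp₂, h.smooth_p₃.congr hp₃, h.smooth_q₁.congr hq₁, h.smooth_q₂.congr hq₂,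
    fun q hq => by rw [ha hq]; exact h.frame q hq,
    fun q hq => by rw [hx hq, ha hq]; exact h.along q hq,
    fun q hq => by rw [hβ hq, hγ hq]; exact h.coframe_indep q hq,
    fun q hq X => ?_, fun q hq X j => ?_⟩
  · rw [D_congr (hx.eventuallyEq_of_mem (h.isOpen.mem_nhds hq)), ha hq, hβ hq, hγ hq,
      h.d_a₀ q hq]
  · rw [D_congr (g' := fun q => a q j) (by
      filter_upwards [h.isOpen.mem_nhds hq] with q hq using by rw [ha hq]), ha hq, hβ hq, hγ hq,
      h.d_a q hq]
    simp only [middleForm, hp₁ hq, hp₂ hq, hp₃ hq, hq₁ hq, hq₂ hq]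

lemma isMiddleFrameField_univ (h : ∀ p, ∃ U, p ∈ U ∧ IsMiddleFrameField F U x a β γ P) :
    IsMiddleFrameField F univ x a β γ P := by
  choose U hU h using h
  have hn : ∀ p, U p ∈ 𝓝 p := fun p => (h p).isOpen.mem_nhds (hU p)
  exact ⟨isOpen_univ, fun p _ => ((h p).smooth_a₀.contMDiffAt (hn p)).contMDiffWithinAt,
    fun p _ => ((h p).smooth_a.contMDiffAt (hn p)).contMDiffWithinAt,
    fun p _ => ((h p).smooth_p₁.contMDiffAt (hn p)).contMDiffWithinAt,
    fun p _ => ((h p).smooth_p₂.contMDiffAt (hn p)).contMDiffWithinAt,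
    fun p _ => ((h p).smooth_p₃.contMDiffAt (hn p)).contMDiffWithinAt,
    fun p _ => ((h p).smooth_q₁.contMDiffAt (hn p)).contMDiffWithinAt,
    fun p _ => ((h p).smooth_q₂.contMDiffAt (hn p)).contMDiffWithinAt,
    fun p _ => (h p).frame p (hU p), fun p _ => (h p).along p (hU p),
    fun p _ => (h p).coframe_indep p (hU p), fun p _ => (h p).d_a₀ p (hU p),
    fun p _ => (h p).d_a p (hU p)⟩

/-! ### Flatness -/

/-- Symmetry of second derivatives for two given directional derivatives of `f`. -/
lemma fderiv_symm_of_partials {E E' : Type*} [NormedAddCommGroup E] [NormedSpace ℝ E]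
    [NormedAddCommGroup E'] [NormedSpace ℝ E'] {f A B : E' → E}
    {O : Set E'} (hO : IsOpen O) (hf : ContDiffOn ℝ ∞ f O) {X Y : E'}
    (hA : ∀ w ∈ O, fderiv ℝ f w X = A w)
    (hB : ∀ w ∈ O, fderiv ℝ f w Y = B w) {w : E'} (hw : w ∈ O) :
    fderiv ℝ A w Y = fderiv ℝ B w X := by
  have hfw : ContDiffAt ℝ ∞ f w := hf.contDiffAt (hO.mem_nhds hw)
  have hd : DifferentiableAt ℝ (fderiv ℝ f) w :=
    (hfw.fderiv_right (m := ∞) (by simp)).differentiableAt (by simp)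
  have h1 : ∀ {X : E'} {A : E' → E}, (∀ w ∈ O, fderiv ℝ f w X = A w) → ∀ Y,
      fderiv ℝ A w Y = fderiv ℝ (fderiv ℝ f) w Y X := by
    intro X A hA Y
    have h2 : A =ᶠ[𝓝 w] fun w => fderiv ℝ f w X := by
      filter_upwards [hO.mem_nhds hw] with y hy using (hA y hy).symm
    rw [h2.fderiv_eq, (hd.hasFDerivAt.clm_apply (hasFDerivAt_const X w)).fderiv]
    simp
  rw [h1 hA, h1 hB]
  exact (hfw.isSymmSndFDerivAt (by simp; exact WithTop.coe_le_coe.2 le_top)) Y X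

/-- The integrability conditions of a smooth system `∂ₓa_j = ∑ P i j a_i`, `∂_y a_j = ∑ Q i j a_i`
for linearly independent `a_i`. -/
lemma flat_of_frame {n : Type*} [Fintype n] {E : Type*} [NormedAddCommGroup E] [NormedSpace ℝ E]
    {O : Set ℂ} (hO : IsOpen O) {a : n → ℂ → E} {P Q : ℂ → Matrix n n ℝ} {X Y : ℂ}
    (ha : ∀ j, ContDiffOn ℝ ∞ (a j) O)
    (hX : ∀ w ∈ O, ∀ j, fderiv ℝ (a j) w X = ∑ i, P w i j • a i w)
    (hY : ∀ w ∈ O, ∀ j, fderiv ℝ (a j) w Y = ∑ i, Q w i j • a i w) {w : ℂ} (hw : w ∈ O)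
    (hli : LinearIndependent ℝ fun i => a i w)
    (hP : ∀ i j, DifferentiableAt ℝ (fun w => P w i j) w)
    (hQ : ∀ i j, DifferentiableAt ℝ (fun w => Q w i j) w) (i j : n) :
    fderiv ℝ (fun w => P w i j) w Y + (Q w * P w) i j =
      fderiv ℝ (fun w => Q w i j) w X + (P w * Q w) i j := by
  have hsymm := fderiv_symm_of_partials hO (ha j) (fun w hw => hX w hw j)
    (fun w hw => hY w hw j) hw
  have had : ∀ i, DifferentiableAt ℝ (a i) w := fun i =>
    ((ha i).contDiffAt (hO.mem_nhds hw)).differentiableAt (by simp)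
  have hcomb : ∀ {R S : ℂ → Matrix n n ℝ} {Y : ℂ},
      (∀ i j, DifferentiableAt ℝ (fun w => R w i j) w) →
      (∀ j, fderiv ℝ (a j) w Y = ∑ i, S w i j • a i w) →
      fderiv ℝ (fun w => ∑ i, R w i j • a i w) w Y =
        ∑ i, (fderiv ℝ (fun w => R w i j) w Y + (S w * R w) i j) • a i w := by
    intro R S Y hR hS
    have h1 : HasFDerivAt (fun w => ∑ i, R w i j • a i w) _ w :=
      HasFDerivAt.fun_sum fun i _ => (hR i j).hasFDerivAt.smul (had i).hasFDerivAt
    rw [h1.fderiv]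
    simp only [sum_apply, add_apply, smul_apply, ContinuousLinearMap.smulRight_apply, hS,
      add_smul, Finset.sum_add_distrib, Matrix.mul_apply, Finset.sum_smul, Finset.smul_sum,
      smul_smul]
    rw [add_comm]
    congr 1
    rw [Finset.sum_comm]
    refine Finset.sum_congr rfl fun i _ => Finset.sum_congr rfl fun k _ => ?_
    rw [mul_comm]
  rw [hcomb hP (hY w hw), hcomb hQ (hX w hw), ← sub_eq_zero, ← Finset.sum_sub_distrib] at hsymm
  simp only [← sub_smul] at hsymm
  have := Fintype.linearIndependent_iff.1 hli _ hsymm i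
  linarith

lemma IsLaguerreFrame.linearIndependent {a : Fin 4 → V} (h : IsLaguerreFrame a) :
    LinearIndependent ℝ a := by
  have h1 : IsUnit (Matrix.of a).det := by rw [h.det_eq]; exact isUnit_one
  exact (Matrix.linearIndependent_rows_iff_isUnit (A := Matrix.of a)).2
    ((Matrix.isUnit_iff_isUnit_det _).2 h1)

lemma D_eq_fderiv {E : Type*} [NormedAddCommGroup E] [NormedSpace ℝ E] (g : ℂ → E) (w : ℂ) :
    D g w = fderiv ℝ g w := mfderiv_eq_fderiv

end StructureEquations

section Planar

variable {G : ℂ → LaguerreSpace} {O : Set ℂ} {x : ℂ → V} {a : ℂ → Fin 4 → V} {u : ℂ → ℝ}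
  {P : Invariants ℂ}

/-- The Maurer-Cartan equation of a middle frame with coframe `(e^u dx, e^u dy)`, entry by entry.
-/
lemma planar_flat (h : IsMiddleFrameField G O x a (fun w => Real.exp (u w) • Complex.reCLM)
    (fun w => Real.exp (u w) • Complex.imCLM) P) (hu : ContDiffOn ℝ ∞ u O) {w : ℂ} (hw : w ∈ O)
    (i j : Fin 4) :
    fderiv ℝ (fun w => middleForm P w (Real.exp (u w)) 0 i j) w Complex.I +
      (middleForm P w 0 (Real.exp (u w)) * middleForm P w (Real.exp (u w)) 0) i j =
    fderiv ℝ (fun w => middleForm P w 0 (Real.exp (u w)) i j) w 1 +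
      (middleForm P w (Real.exp (u w)) 0 * middleForm P w 0 (Real.exp (u w))) i j := by
  have hn := h.isOpen.mem_nhds hw
  have h1 : DifferentiableAt ℝ P.p₁ w :=
    (h.smooth_p₁.contDiffOn.contDiffAt hn).differentiableAt (by simp)
  have h2 : DifferentiableAt ℝ P.p₂ w :=
    (h.smooth_p₂.contDiffOn.contDiffAt hn).differentiableAt (by simp)
  have h3 : DifferentiableAt ℝ P.p₃ w :=
    (h.smooth_p₃.contDiffOn.contDiffAt hn).differentiableAt (by simp)
  have h4 : DifferentiableAt ℝ P.q₁ w :=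
    (h.smooth_q₁.contDiffOn.contDiffAt hn).differentiableAt (by simp)
  have h5 : DifferentiableAt ℝ P.q₂ w :=
    (h.smooth_q₂.contDiffOn.contDiffAt hn).differentiableAt (by simp)
  have h6 : DifferentiableAt ℝ u w := (hu.contDiffAt hn).differentiableAt (by simp)
  refine flat_of_frame h.isOpen (a := fun j w => a w j)
    (P := fun w => middleForm P w (Real.exp (u w)) 0)
    (Q := fun w => middleForm P w 0 (Real.exp (u w)))
    (fun j => (h.contMDiffOn_a j).contDiffOn) (fun w hw j => ?_) (fun w hw j => ?_) hw
    (h.frame w hw).linearIndependent (fun i j => ?_) (fun i j => ?_) i j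
  · rw [← D_eq_fderiv, h.d_a w hw]; simp
  · rw [← D_eq_fderiv, h.d_a w hw]; simp
  · fin_cases i <;> fin_cases j <;> simp [middleForm] <;> fun_prop
  · fin_cases i <;> fin_cases j <;> simp [middleForm] <;> fun_prop

end Planar

/-! ### Structure equations in the plane -/

section PlanarStructure

variable {G : ℂ → LaguerreSpace} {O : Set ℂ} {x : ℂ → V} {a : ℂ → Fin 4 → V} {u : ℂ → ℝ}
  {P : Invariants ℂ}

lemma fderiv_exp_smul {E : Type*} [NormedAddCommGroup E] [NormedSpace ℝ E] {u : ℂ → ℝ}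
    {f : ℂ → E} {w : ℂ} (hu : DifferentiableAt ℝ u w) (hf : DifferentiableAt ℝ f w) (X : ℂ) :
    fderiv ℝ (fun w => Real.exp (u w) • f w) w X =
      Real.exp (u w) • (fderiv ℝ u w X • f w + fderiv ℝ f w X) := by
  have h : HasFDerivAt (fun w => Real.exp (u w) • f w) _ w := hu.hasFDerivAt.exp.smul hf.hasFDerivAt
  rw [h.fderiv]
  simp [smul_smul, smul_add, add_comm]

/-- The first structure equation, from the symmetry of the second derivatives of `a₀`: the
functions `q₁`, `q₂` are determined by the potential. -/
lemma planar_connection (h : IsMiddleFrameField G O x a (fun w => Real.exp (u w) • Complex.reCLM)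
    (fun w => Real.exp (u w) • Complex.imCLM) P) (hu : ContDiffOn ℝ ∞ u O) {w : ℂ} (hw : w ∈ O) :
    P.q₁ w * Real.exp (u w) = -fderiv ℝ u w Complex.I ∧
      P.q₂ w * Real.exp (u w) = fderiv ℝ u w 1 := by
  have hn := h.isOpen.mem_nhds hw
  have h6 : DifferentiableAt ℝ u w := (hu.contDiffAt hn).differentiableAt (by simp)
  have had : ∀ i, DifferentiableAt ℝ (fun w => a w i) w := fun i =>
    ((h.contMDiffOn_a i).contDiffOn.contDiffAt hn).differentiableAt (by simp)
  have hs := fderiv_symm_of_partials h.isOpen h.smooth_a₀.contDiffOn (X := 1) (Y := Complex.I)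
    (A := fun w => Real.exp (u w) • a w 1) (B := fun w => Real.exp (u w) • a w 2)
    (fun w hw => by rw [← D_eq_fderiv, h.d_a₀ w hw]; simp)
    (fun w hw => by rw [← D_eq_fderiv, h.d_a₀ w hw]; simp) hw
  rw [fderiv_exp_smul h6 (had 1), fderiv_exp_smul h6 (had 2), ← D_eq_fderiv (fun w => a w 1),
    ← D_eq_fderiv (fun w => a w 2), h.D_a1 hw, h.D_a2 hw] at hs
  have hs := smul_right_injective V (Real.exp_pos (u w)).ne' hs
  have hf := h.frame w hw
  have h1 := congrArg (fun v => mink v (a w 1)) hs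
  have h2 := congrArg (fun v => mink v (a w 2)) hs
  simp [mink_add_left, mink_smul_left, mink_neg_left, hf.mink01, hf.mink02, hf.mink11, hf.mink12,
    hf.mink21, hf.mink22] at h1 h2
  exact ⟨by linarith, by linarith⟩

/-- The consequences of `dα = -α ∧ α` for a middle frame with coframe `(e^u dx, e^u dy)`: `p₂`
vanishes, `p₁ - p₃` is determined by `Δu`, and `p₁`, `p₃` satisfy the Codazzi equations. They come from
the entries `(1, 1)`, `(2, 3)`, `(1, 2)` and `(1, 3)`. -/
theorem planar_structure (h : IsMiddleFrameField G O x a (fun w => Real.exp (u w) • Complex.reCLM)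
    (fun w => Real.exp (u w) • Complex.imCLM) P) (hu : ContDiffOn ℝ ∞ u O) {w : ℂ} (hw : w ∈ O) :
    P.p₂ w = 0 ∧
    Real.exp (u w) ^ 2 * (P.p₃ w - P.p₁ w) = fderiv ℝ (fun w => fderiv ℝ u w 1) w 1 +
      fderiv ℝ (fun w => fderiv ℝ u w Complex.I) w Complex.I ∧
    fderiv ℝ P.p₁ w Complex.I = fderiv ℝ u w Complex.I * (P.p₃ w - 3 * P.p₁ w) ∧
    fderiv ℝ P.p₃ w 1 = fderiv ℝ u w 1 * (P.p₁ w - 3 * P.p₃ w) := by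
  have hE := (Real.exp_pos (u w)).ne'
  have hn := h.isOpen.mem_nhds hw
  have h1 : DifferentiableAt ℝ P.p₁ w :=
    (h.smooth_p₁.contDiffOn.contDiffAt hn).differentiableAt (by simp)
  have h3 : DifferentiableAt ℝ P.p₃ w :=
    (h.smooth_p₃.contDiffOn.contDiffAt hn).differentiableAt (by simp)
  have h6 : DifferentiableAt ℝ u w := (hu.contDiffAt hn).differentiableAt (by simp)
  have hp₂ : ∀ w ∈ O, P.p₂ w = 0 := by
    intro w hw
    have hE := (Real.exp_pos (u w)).ne'
    have hsy := fderiv_symm_of_partials h.isOpen hu (X := 1) (Y := Complex.I)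
      (A := fun w => fderiv ℝ u w 1) (B := fun w => fderiv ℝ u w Complex.I)
      (fun _ _ => rfl) (fun _ _ => rfl) hw
    have e1 : (fun w => middleForm P w (Real.exp (u w)) 0 0 0) =ᶠ[𝓝 w]
        (2 : ℝ) • fun w => fderiv ℝ u w 1 := by
      filter_upwards [h.isOpen.mem_nhds hw] with w hw
      have := (planar_connection h hu hw).2
      simp [middleForm]; linear_combination 2 * this
    have e2 : (fun w => middleForm P w 0 (Real.exp (u w)) 0 0) =ᶠ[𝓝 w]
        (2 : ℝ) • fun w => fderiv ℝ u w Complex.I := by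
      filter_upwards [h.isOpen.mem_nhds hw] with w hw
      have := (planar_connection h hu hw).1
      simp [middleForm]; linear_combination -2 * this
    have hfl := planar_flat h hu hw 0 0
    rw [e1.fderiv_eq, e2.fderiv_eq, fderiv_const_smul_field, fderiv_const_smul_field] at hfl
    simp only [Matrix.mul_apply, Fin.sum_univ_four] at hfl
    simp [middleForm] at hfl
    have : P.p₂ w * (Real.exp (u w) * Real.exp (u w)) = 0 := by linarith
    simpa [hE] using this
  refine ⟨hp₂ w hw, ?_, ?_, ?_⟩
  · have e1 : (fun w => middleForm P w (Real.exp (u w)) 0 1 2) =ᶠ[𝓝 w]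
        fun w => fderiv ℝ u w Complex.I := by
      filter_upwards [h.isOpen.mem_nhds hw] with w hw
      have := (planar_connection h hu hw).1
      simp [middleForm]; linarith
    have e2 : (fun w => middleForm P w 0 (Real.exp (u w)) 1 2) =ᶠ[𝓝 w]
        fun w => -fderiv ℝ u w 1 := by
      filter_upwards [h.isOpen.mem_nhds hw] with w hw
      have := (planar_connection h hu hw).2
      simp [middleForm]; linarith
    have hfl := planar_flat h hu hw 1 2
    rw [e1.fderiv_eq, e2.fderiv_eq, fderiv_fun_neg] at hfl
    simp only [neg_apply, Matrix.mul_apply, Fin.sum_univ_four] at hfl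
    simp [middleForm, hp₂ w hw] at hfl
    linear_combination -hfl
  · have e1 : (fun w => middleForm P w (Real.exp (u w)) 0 0 1) =ᶠ[𝓝 w]
        fun w => Real.exp (u w) • P.p₁ w := by
      filter_upwards [h.isOpen.mem_nhds hw] with w hw
      simp [middleForm]; ring
    have e2 : (fun w => middleForm P w 0 (Real.exp (u w)) 0 1) =ᶠ[𝓝 w]
        fun w => (0 : ℝ) := by
      filter_upwards [h.isOpen.mem_nhds hw] with w hw
      simp [middleForm, hp₂ w hw]
    have hfl := planar_flat h hu hw 0 1
    rw [e1.fderiv_eq, e2.fderiv_eq, fderiv_exp_smul h6 h1] at hfl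
    obtain ⟨c1, c2⟩ := planar_connection h hu hw
    simp only [Matrix.mul_apply, Fin.sum_univ_four] at hfl
    simp [middleForm, hp₂ w hw] at hfl
    have : Real.exp (u w) * (fderiv ℝ P.p₁ w Complex.I -
        fderiv ℝ u w Complex.I * (P.p₃ w - 3 * P.p₁ w)) = 0 := by
      rw [← neg_eq_iff_eq_neg.2 c1]
      rw [← neg_eq_iff_eq_neg.2 c1] at hfl
      linear_combination hfl
    simpa [hE, sub_eq_zero] using this
  · have e1 : (fun w => middleForm P w (Real.exp (u w)) 0 0 2) =ᶠ[𝓝 w]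
        fun w => (0 : ℝ) := by
      filter_upwards [h.isOpen.mem_nhds hw] with w hw
      simp [middleForm, hp₂ w hw]
    have e2 : (fun w => middleForm P w 0 (Real.exp (u w)) 0 2) =ᶠ[𝓝 w]
        fun w => Real.exp (u w) • P.p₃ w := by
      filter_upwards [h.isOpen.mem_nhds hw] with w hw
      simp [middleForm]; ring
    have hfl := planar_flat h hu hw 0 2
    rw [e1.fderiv_eq, e2.fderiv_eq, fderiv_exp_smul h6 h3] at hfl
    obtain ⟨c1, c2⟩ := planar_connection h hu hw
    simp only [Matrix.mul_apply, Fin.sum_univ_four] at hfl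
    simp [middleForm, hp₂ w hw] at hfl
    have : Real.exp (u w) * (fderiv ℝ P.p₃ w 1 - fderiv ℝ u w 1 * (P.p₁ w - 3 * P.p₃ w)) = 0 := by
      rw [← c2]
      rw [← c2] at hfl
      linear_combination -hfl
    simpa [hE, sub_eq_zero] using this

end PlanarStructure

section Isothermic

variable {M : Type*} [TopologicalSpace M] [ChartedSpace ℂ M]
  {E : Type*} [NormedAddCommGroup E] [NormedSpace ℝ E]
  {z : M → ℂ} {u : M → ℝ} {e : OpenPartialHomeomorph M ℂ}

/-! ### Partial derivatives in the coordinate `z` -/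

lemma IsZChart.D_dSymm (he : IsZChart z e) {w : ℂ} (hw : w ∈ e.target) (X : ℂ) :
    D z (e.symm w) (dSymm e w X) = X := by
  have hz : MDifferentiableAt 𝓘(ℝ, ℂ) 𝓘(ℝ, ℂ) z (e.symm w) :=
    ((contMDiffAt_of_mem_maximalAtlas he.mem (e.map_target hw)).mdifferentiableAt
      (by simp)).congr_of_eventuallyEq (he.z_eventuallyEq (e.map_target hw)).symm
  have h1 := hasFDerivAt_comp_chart_symm he.mem hw hz
  have h2 : z ∘ e.symm =ᶠ[𝓝 w] id := by
    filter_upwards [e.open_target.mem_nhds hw] with y hy using he.z_symm hy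
  have h3 := h1.unique ((hasFDerivAt_id w).congr_of_eventuallyEq h2)
  exact DFunLike.congr_fun h3 X

/-- The inverse of `D z` in the definition of the partial derivatives is the differential of the
inverse of a chart given by `z`. -/
lemma IsZChart.inverse_eq (he : IsZChart z e) {w : ℂ} (hw : w ∈ e.target) :
    (D z (e.symm w)).inverse = dSymm e w := by
  refine ContinuousLinearMap.inverse_eq ?_ ?_
  · ext1 X; exact he.D_dSymm hw X
  · ext1 X
    obtain ⟨Y, rfl⟩ := (dSymm_bijective he.mem hw).2 X
    exact congrArg (dSymm e w) (he.D_dSymm hw Y)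

lemma IsZChart.fderiv_eq (he : IsZChart z e) {w : ℂ} (hw : w ∈ e.target) {g : M → ℝ}
    (hg : MDifferentiableAt 𝓘(ℝ, ℂ) 𝓘(ℝ, ℝ) g (e.symm w)) :
    fderiv ℝ (g ∘ e.symm) w 1 = partialX z g (e.symm w) ∧
      fderiv ℝ (g ∘ e.symm) w Complex.I = partialY z g (e.symm w) := by
  rw [(hasFDerivAt_comp_chart_symm he.mem hw hg).fderiv, partialX, partialY, he.inverse_eq hw]
  exact ⟨rfl, rfl⟩

variable [IsManifold 𝓘(ℝ, ℂ) ∞ M]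

section
variable (hz : ContMDiff 𝓘(ℝ, ℂ) 𝓘(ℝ, ℂ) ∞ z) (hinj : ∀ p, Function.Injective (D z p))
include hz hinj

lemma contMDiff_partial {g : M → ℝ} (hg : ContMDiff 𝓘(ℝ, ℂ) 𝓘(ℝ, ℝ) ∞ g) :
    ContMDiff 𝓘(ℝ, ℂ) 𝓘(ℝ, ℝ) ∞ (partialX z g) ∧ ContMDiff 𝓘(ℝ, ℂ) 𝓘(ℝ, ℝ) ∞ (partialY z g) := by
  have key : ∀ p, ContMDiffAt 𝓘(ℝ, ℂ) 𝓘(ℝ, ℝ) ∞ (partialX z g) p ∧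
      ContMDiffAt 𝓘(ℝ, ℂ) 𝓘(ℝ, ℝ) ∞ (partialY z g) p := by
    intro p
    obtain ⟨e, he, hp⟩ := exists_isZChart hz (hinj p)
    have h1 : ContDiffOn ℝ ∞ (g ∘ e.symm) e.target := by
      simpa using contDiffOn_comp_chart_symm he.mem (U := univ) hg.contMDiffOn
    have hep : e p ∈ e.target := e.map_source hp
    have h2 := h1.contDiffAt (e.open_target.mem_nhds hep)
    have h3 : ∀ X, ContDiffAt ℝ ∞ (fun w => fderiv ℝ (g ∘ e.symm) w X) (e p) := fun X =>
      (h2.fderiv_right (m := ∞) (by simp)).clm_apply contDiffAt_const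
    constructor
    · refine contMDiffAt_of_comp_chart_symm he.mem hp ((h3 1).congr_of_eventuallyEq ?_)
      filter_upwards [e.open_target.mem_nhds hep] with w hw
      exact (he.fderiv_eq hw (hg.mdifferentiableAt (by simp))).1.symm
    · refine contMDiffAt_of_comp_chart_symm he.mem hp ((h3 Complex.I).congr_of_eventuallyEq ?_)
      filter_upwards [e.open_target.mem_nhds hep] with w hw
      exact (he.fderiv_eq hw (hg.mdifferentiableAt (by simp))).2.symm
  exact ⟨fun p => (key p).1, fun p => (key p).2⟩

omit hz hinj in
lemma IsZChart.laplacian_eq (he : IsZChart z e) (hz : ContMDiff 𝓘(ℝ, ℂ) 𝓘(ℝ, ℂ) ∞ z)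
    (hinj : ∀ p, Function.Injective (D z p)) {g : M → ℝ}
    (hg : ContMDiff 𝓘(ℝ, ℂ) 𝓘(ℝ, ℝ) ∞ g) {w : ℂ} (hw : w ∈ e.target) :
    laplacian z g (e.symm w) = fderiv ℝ (fun w => fderiv ℝ (g ∘ e.symm) w 1) w 1 +
      fderiv ℝ (fun w => fderiv ℝ (g ∘ e.symm) w Complex.I) w Complex.I := by
  obtain ⟨h1, h2⟩ := contMDiff_partial hz hinj hg
  have e1 : (fun w => fderiv ℝ (g ∘ e.symm) w 1) =ᶠ[𝓝 w] partialX z g ∘ e.symm := by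
    filter_upwards [e.open_target.mem_nhds hw] with w hw
    exact (he.fderiv_eq hw (hg.mdifferentiableAt (by simp))).1
  have e2 : (fun w => fderiv ℝ (g ∘ e.symm) w Complex.I) =ᶠ[𝓝 w] partialY z g ∘ e.symm := by
    filter_upwards [e.open_target.mem_nhds hw] with w hw
    exact (he.fderiv_eq hw (hg.mdifferentiableAt (by simp))).2
  rw [e1.fderiv_eq, e2.fderiv_eq, (he.fderiv_eq hw (h1.mdifferentiableAt (by simp))).1,
    (he.fderiv_eq hw (h2.mdifferentiableAt (by simp))).2]
  rfl

lemma contMDiff_laplacian {g : M → ℝ} (hg : ContMDiff 𝓘(ℝ, ℂ) 𝓘(ℝ, ℝ) ∞ g) :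
    ContMDiff 𝓘(ℝ, ℂ) 𝓘(ℝ, ℝ) ∞ (laplacian z g) :=
  (contMDiff_partial hz hinj (contMDiff_partial hz hinj hg).1).1.add
    (contMDiff_partial hz hinj (contMDiff_partial hz hinj hg).2).2

end

/-- A function on a connected surface with vanishing differential is constant. -/
lemma eq_of_D_eq_zero [PreconnectedSpace M] {g : M → E}
    (hg : ∀ p, MDifferentiableAt 𝓘(ℝ, ℂ) 𝓘(ℝ, E) g p) (hD : ∀ p X, D g p X = 0) (p q : M) :
    g p = g q := by
  have hloc : IsLocallyConstant g := by
    rw [IsLocallyConstant.iff_eventually_eq]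
    intro p
    set c := chartAt ℂ p
    have hc : c ∈ IsManifold.maximalAtlas 𝓘(ℝ, ℂ) ∞ M := IsManifold.chart_mem_maximalAtlas p
    have hp : p ∈ c.source := mem_chart_source ℂ p
    obtain ⟨r, hr, hball⟩ := Metric.isOpen_iff.1 c.open_target (c p) (c.map_source hp)
    have hd : ∀ w ∈ ball (c p) r, HasFDerivAt (g ∘ c.symm) (0 : ℂ →L[ℝ] E) w := by
      intro w hw
      have h1 := hasFDerivAt_comp_chart_symm hc (hball hw) (hg _)
      have h2 : (D g (c.symm w)).comp (dSymm c w) = 0 := by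
        ext1 X; exact hD _ _
      rwa [h2] at h1
    have hconst : ∀ w ∈ ball (c p) r, (g ∘ c.symm) w = (g ∘ c.symm) (c p) := fun w hw =>
      (convex_ball (c p) r).is_const_of_fderivWithin_eq_zero (𝕜 := ℝ)
        (fun w hw => (hd w hw).differentiableAt.differentiableWithinAt)
        (fun w hw => by
          rw [fderivWithin_of_isOpen isOpen_ball hw, (hd w hw).fderiv]) hw (mem_ball_self hr)
    filter_upwards [c.continuousAt hp (isOpen_ball.mem_nhds (mem_ball_self hr)),
      c.open_source.mem_nhds hp] with q hq hqs
    have := hconst (c q) hq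
    simpa [c.left_inv hqs, c.left_inv hp] using this
  exact hloc.apply_eq_of_isPreconnected isPreconnected_univ (mem_univ p) (mem_univ q)

/-! ### Structure equations on the surface -/

variable {F : M → LaguerreSpace} {U : Set M} {x : M → V} {a : M → Fin 4 → V} {P : Invariants M}

omit [IsManifold 𝓘(ℝ, ℂ) ∞ M] in
lemma D_injective_of_indep {p : M}
    (h : LinearIndependent ℝ ![potentialDx z u p, potentialDy z u p]) :
    Function.Injective (D z p) := by
  refine (injective_iff_map_eq_zero (D z p)).2 fun X hX => eq_zero_of_coframe_eq_zero h ?_ ?_ <;>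
    simp [potentialDx, potentialDy, hX]

omit [IsManifold 𝓘(ℝ, ℂ) ∞ M] in
lemma indep_of_D_injective {p : M} (h : Function.Injective (D z p)) :
    LinearIndependent ℝ ![potentialDx z u p, potentialDy z u p] := by
  have hs : Function.Surjective (D z p) :=
    (D z p).toLinearMap.injective_iff_surjective.1 h
  obtain ⟨X, hX⟩ := hs 1
  obtain ⟨Y, hY⟩ := hs Complex.I
  rw [LinearIndependent.pair_iff]
  intro s t hst
  have h1 := DFunLike.congr_fun hst X
  have h2 := DFunLike.congr_fun hst Y
  simp [potentialDx, potentialDy, hX, hY, Real.exp_ne_zero] at h1 h2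
  exact ⟨h1, h2⟩

omit [IsManifold 𝓘(ℝ, ℂ) ∞ M] in
lemma IsLIsothermic.D_injective (h : IsLIsothermic F z u) (p : M) : Function.Injective (D z p) := by
  obtain ⟨U, x, a, P, hp, hm⟩ := h.middle p
  exact D_injective_of_indep (hm.coframe_indep p hp)

omit [IsManifold 𝓘(ℝ, ℂ) ∞ M] in
/-- The frame in the isothermal coordinate. -/
lemma IsMiddleFrameField.planar
    (h : IsMiddleFrameField F U x a (potentialDx z u) (potentialDy z u) P) (he : IsZChart z e) :
    IsMiddleFrameField (F ∘ e.symm) (e.target ∩ e.symm ⁻¹' U) (x ∘ e.symm) (a ∘ e.symm)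
      (fun w => Real.exp ((u ∘ e.symm) w) • Complex.reCLM)
      (fun w => Real.exp ((u ∘ e.symm) w) • Complex.imCLM) (P.comp e.symm) := by
  have h1 := h.comp (ψ := e.symm) (O := e.target ∩ e.symm ⁻¹' U)
    (e.isOpen_inter_preimage_symm h.isOpen)
    ((contMDiffOn_symm_of_mem_maximalAtlas he.mem).mono inter_subset_left)
    (fun w hw => hw.2) (fun w hw => dSymm_bijective he.mem hw.1)
  refine h1.congr (fun _ _ => rfl) (fun _ _ => rfl) (fun w hw => ?_) (fun w hw => ?_)
    (fun _ _ => rfl) (fun _ _ => rfl) (fun _ _ => rfl) (fun _ _ => rfl) (fun _ _ => rfl)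
  · ext1 X
    exact congrArg (fun Y : ℂ => Real.exp (u (e.symm w)) * Y.re) (he.D_dSymm hw.1 X).symm
  · ext1 X
    exact congrArg (fun Y : ℂ => Real.exp (u (e.symm w)) * Y.im) (he.D_dSymm hw.1 X).symm

/-- All invariants except `W` are determined by the coordinate and the Blaschke potential. -/
lemma IsMiddleFrameField.invariants_eq
    (h : IsMiddleFrameField F U x a (potentialDx z u) (potentialDy z u) P)
    (hz : ContMDiff 𝓘(ℝ, ℂ) 𝓘(ℝ, ℂ) ∞ z) (hinj : ∀ p, Function.Injective (D z p))
    (hu : ContMDiff 𝓘(ℝ, ℂ) 𝓘(ℝ, ℝ) ∞ u) {p : M} (hp : p ∈ U) :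
    P.p₂ p = 0 ∧ (P.p₁ p - P.p₃ p) / 2 = potentialJ z u p ∧
      P.q₁ p = -Real.exp (-u p) * partialY z u p ∧ P.q₂ p = Real.exp (-u p) * partialX z u p := by
  obtain ⟨e, he, hpe⟩ := exists_isZChart hz (hinj p)
  have hpl := h.planar he
  have hw := e.map_source hpe
  have hwO : e p ∈ e.target ∩ e.symm ⁻¹' U := ⟨hw, by simpa [e.left_inv hpe] using hp⟩
  have hu' : ContDiffOn ℝ ∞ (u ∘ e.symm) (e.target ∩ e.symm ⁻¹' U) :=
    contDiffOn_comp_chart_symm he.mem hu.contMDiffOn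
  obtain ⟨h1, h2⟩ := planar_connection hpl hu' hwO
  obtain ⟨h3, h4, -, -⟩ := planar_structure hpl hu' hwO
  obtain ⟨h5, h6⟩ := he.fderiv_eq hw (hu.mdifferentiableAt (by simp))
  rw [h6] at h1
  rw [h5] at h2
  rw [← he.laplacian_eq hz hinj hu hw] at h4
  simp only [Invariants.comp, Function.comp_apply, e.left_inv hpe] at h1 h2 h3 h4
  have hE := Real.exp_ne_zero (u p)
  refine ⟨h3, ?_, ?_, ?_⟩
  · rw [potentialJ, ← h4, show -2 * u p = -u p + -u p by ring, Real.exp_add, Real.exp_neg]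
    field_simp; ring
  · rw [Real.exp_neg]; field_simp; linarith
  · rw [Real.exp_neg]; field_simp; linarith

/-- For a special immersion, `e^{2u} W` has vanishing differential: with `Δu = c e^{-2u}` one has
`p₃ - p₁ = c e^{-4u}`, and the Codazzi equations give the derivatives of `p₁ + p₃`. -/
lemma IsMiddleFrameField.D_deformation
    (h : IsMiddleFrameField F U x a (potentialDx z u) (potentialDy z u) P)
    (hz : ContMDiff 𝓘(ℝ, ℂ) 𝓘(ℝ, ℂ) ∞ z) (hinj : ∀ p, Function.Injective (D z p))
    (hu : ContMDiff 𝓘(ℝ, ℂ) 𝓘(ℝ, ℝ) ∞ u) {c : ℝ}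
    (hc : ∀ p, laplacian z u p = c * Real.exp (-2 * u p)) {p : M} (hp : p ∈ U) (X : ℂ) :
    D (fun q => Real.exp (2 * u q) * ((P.p₁ q + P.p₃ q) * 2⁻¹)) p X = 0 := by
  obtain ⟨e, he, hpe⟩ := exists_isZChart hz (hinj p)
  have hpl := h.planar he
  have hw := e.map_source hpe
  have hwO : e p ∈ e.target ∩ e.symm ⁻¹' U := ⟨hw, by simpa [e.left_inv hpe] using hp⟩
  have hu' : ContDiffOn ℝ ∞ (u ∘ e.symm) (e.target ∩ e.symm ⁻¹' U) :=
    contDiffOn_comp_chart_symm he.mem hu.contMDiffOn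
  obtain ⟨-, -, h1, h3⟩ := planar_structure hpl hu' hwO
  have hn := hpl.isOpen.mem_nhds hwO
  set P' := P.comp e.symm
  set u' := u ∘ e.symm
  set w := e p
  have d1 : DifferentiableAt ℝ P'.p₁ w :=
    (hpl.smooth_p₁.contDiffOn.contDiffAt hn).differentiableAt (by simp)
  have d3 : DifferentiableAt ℝ P'.p₃ w :=
    (hpl.smooth_p₃.contDiffOn.contDiffAt hn).differentiableAt (by simp)
  have du : DifferentiableAt ℝ u' w := (hu'.contDiffAt hn).differentiableAt (by simp)
  have hdiff : ∀ w ∈ e.target ∩ e.symm ⁻¹' U,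
      P'.p₃ w - P'.p₁ w = c * Real.exp (-4 * u' w) := by
    intro w hw
    obtain ⟨-, h4, -, -⟩ := planar_structure hpl hu' hw
    rw [← he.laplacian_eq hz hinj hu hw.1, hc] at h4
    change Real.exp (u' w) ^ 2 * _ = c * Real.exp (-2 * u' w) at h4
    have hE := Real.exp_ne_zero (u' w)
    rw [show -2 * u' w = -u' w + -u' w by ring, Real.exp_add, Real.exp_neg] at h4
    rw [show -4 * u' w = -u' w + -u' w + (-u' w + -u' w) by ring, Real.exp_add, Real.exp_add,
      Real.exp_neg]
    field_simp at h4 ⊢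
    linarith
  have hex : HasFDerivAt (fun w => c * Real.exp (-4 * u' w))
      (c • Real.exp (-4 * u' w) • (-4 : ℝ) • fderiv ℝ u' w) w :=
    ((du.hasFDerivAt.const_mul (-4)).exp).const_mul c
  have hd := (d3.hasFDerivAt.sub d1.hasFDerivAt).unique (hex.congr_of_eventuallyEq (by
    filter_upwards [hn] with y hy using hdiff y hy))
  have hd1 := DFunLike.congr_fun hd 1
  have hd2 := DFunLike.congr_fun hd Complex.I
  have hdw := hdiff w hwO
  simp only [sub_apply, smul_apply, smul_eq_mul] at hd1 hd2
  have hK : HasFDerivAt (fun w => Real.exp (2 * u' w) * ((P'.p₁ w + P'.p₃ w) * 2⁻¹)) _ w :=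
    ((du.hasFDerivAt.const_mul 2).exp).mul ((d1.hasFDerivAt.add d3.hasFDerivAt).mul_const 2⁻¹)
  have hL : fderiv ℝ (fun w => Real.exp (2 * u' w) * ((P'.p₁ w + P'.p₃ w) * 2⁻¹)) w = 0 := by
    ext X
    rw [hK.fderiv, clm_apply_eq_re_im]
    simp only [add_apply, smul_apply, smul_eq_mul, zero_apply]
    linear_combination Real.exp (2 * u' w) *
      (X.re * (-(1 / 2) * hd1 - 2 * fderiv ℝ u' w 1 * hdw + h3) +
        X.im * (1 / 2 * hd2 + 2 * fderiv ℝ u' w Complex.I * hdw + h1))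
  have h5 := he.D_apply hpe (g := fun q => Real.exp (2 * u q) * ((P.p₁ q + P.p₃ q) * 2⁻¹))
    (L := 0) (by rw [← he.eq hpe, ← hL]; exact hK.differentiableAt.hasFDerivAt) X
  rw [h5]; rfl

/-- An L-isothermic immersion has a global middle frame field: the local ones with the given
coframe agree on overlaps. -/
theorem IsLIsothermic.exists_global_frame (h : IsLIsothermic F z u) :
    ∃ (x : M → V) (a : M → Fin 4 → V) (W : M → ℝ), IsMiddleFrameField F univ x a
      (potentialDx z u) (potentialDy z u) (spectralInvariants z u W) := by
  choose U x a P hU hm using h.middle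
  refine ⟨fun p => x p p, fun p => a p p, fun p => ((P p).p₁ p + (P p).p₃ p) / 2,
    isMiddleFrameField_univ fun p => ⟨U p, hU p, (hm p).congr ?_ ?_ (fun _ _ => rfl)
      (fun _ _ => rfl) ?_ ?_ ?_ ?_ ?_⟩⟩ <;> intro q hq
  · exact (middle_eq (hm p) (hm q) ⟨hq, hU q⟩).1
  · exact (middle_unique (hm p) (hm q) ⟨hq, hU q⟩).2.1 rfl rfl
  all_goals
    obtain ⟨-, -, h1, h3⟩ := middle_unique (hm p) (hm q) ⟨hq, hU q⟩
    obtain ⟨k2, kJ, kq1, kq2⟩ := (hm p).invariants_eq h.smooth_z h.D_injective h.smooth_u hq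
    simp only [spectralInvariants, h1, h3, ← kJ, ← kq1, ← kq2, k2]
  · ring
  · ring

omit [IsManifold 𝓘(ℝ, ℂ) ∞ M] in
lemma IsMiddleFrameField.hasInvariants {W : M → ℝ}
    (h : IsMiddleFrameField F univ x a (potentialDx z u) (potentialDy z u)
      (spectralInvariants z u W)) : HasInvariants F W (potentialJ z u) := fun p =>
  ⟨univ, x, a, _, _, _, mem_univ p, h, fun q _ => by simp [spectralInvariants]⟩

/-- A special L-isothermic immersion has a global middle frame field with `W = k e^{-2u}`. -/
theorem IsSpecialLIsothermic.exists_global_frame [PreconnectedSpace M]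
    (h : IsSpecialLIsothermic F z u) :
    ∃ (x : M → V) (a : M → Fin 4 → V) (k : ℝ), IsMiddleFrameField F univ x a
      (potentialDx z u) (potentialDy z u)
      (spectralInvariants z u fun p => k * Real.exp (-2 * u p)) := by
  obtain ⟨h, c, hc⟩ := h
  obtain ⟨x, a, W, hm⟩ := h.exists_global_frame
  have h1 : ContMDiff 𝓘(ℝ, ℂ) 𝓘(ℝ, ℝ) ∞ (spectralInvariants z u W).p₁ :=
    contMDiffOn_univ.1 hm.smooth_p₁
  have h3 : ContMDiff 𝓘(ℝ, ℂ) 𝓘(ℝ, ℝ) ∞ (spectralInvariants z u W).p₃ :=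
    contMDiffOn_univ.1 hm.smooth_p₃
  have hK : ContMDiff 𝓘(ℝ, ℂ) 𝓘(ℝ, ℝ) ∞ fun q => Real.exp (2 * u q) *
      (((spectralInvariants z u W).p₁ q + (spectralInvariants z u W).p₃ q) * 2⁻¹) := by
    have h2 : ContMDiff 𝓘(ℝ, ℝ × ℝ) 𝓘(ℝ, ℝ) ∞ (fun y : ℝ × ℝ => Real.exp (2 * y.1) * (y.2 * 2⁻¹)) :=
      ContDiff.contMDiff (by fun_prop)
    exact h2.comp (h.smooth_u.prodMk_space (h1.add h3))
  have hconst := eq_of_D_eq_zero (fun p => hK.mdifferentiableAt (by simp))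
    (fun p X => hm.D_deformation h.smooth_z h.D_injective h.smooth_u hc (mem_univ p) X)
  rcases isEmpty_or_nonempty M with hM | ⟨⟨p₀⟩⟩
  · exact ⟨x, a, 0, hm.congr (fun q => isEmptyElim q) (fun q => isEmptyElim q)
      (fun q => isEmptyElim q) (fun q => isEmptyElim q) (fun q => isEmptyElim q)
      (fun q => isEmptyElim q) (fun q => isEmptyElim q) (fun q => isEmptyElim q)
      (fun q => isEmptyElim q)⟩
  refine ⟨x, a, Real.exp (2 * u p₀) * W p₀, ?_⟩
  have hW : (fun p => Real.exp (2 * u p₀) * W p₀ * Real.exp (-2 * u p)) = W := by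
    funext p
    have := hconst p₀ p
    simp only [spectralInvariants] at this
    have h4 : Real.exp (2 * u p) * Real.exp (-2 * u p) = 1 := by
      rw [← Real.exp_add]; simp
    linear_combination Real.exp (-2 * u p) * this + W p * h4
  rw [hW]; exact hm

end Isothermic

section Frames

variable {M : Type*} [TopologicalSpace M] [ChartedSpace ℂ M] [IsManifold 𝓘(ℝ, ℂ) ∞ M]
  {z : M → ℂ} {u : M → ℝ}

/-! ### Solutions of the frame equation are frames -/

omit [IsManifold 𝓘(ℝ, ℂ) ∞ M] in
lemma D_mul_apply {f g : M → V} {p : M} (hf : MDifferentiableAt 𝓘(ℝ, ℂ) 𝓘(ℝ, V) f p)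
    (hg : MDifferentiableAt 𝓘(ℝ, ℂ) 𝓘(ℝ, V) g p) (i j : Fin 4) :
    MDifferentiableAt 𝓘(ℝ, ℂ) 𝓘(ℝ, ℝ) (fun q => f q i * g q j) p ∧ ∀ X,
    D (fun q => f q i * g q j) p X = D f p X i * g p j + f p i * D g p X j := by
  set B := (ContinuousLinearMap.mul ℝ ℝ).bilinearComp
    (ContinuousLinearMap.proj (R := ℝ) (φ := fun _ : Fin 4 => ℝ) i)
    (ContinuousLinearMap.proj (R := ℝ) (φ := fun _ : Fin 4 => ℝ) j)
  exact ⟨mdifferentiableAt_bilinear B hf hg, D_bilinear B hf hg⟩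

/-- If the tuple `a` solves `da = a α` with `α` in the Lie algebra of the Lorentz group, here of
the middle form, and is a frame at one point, then it is a frame everywhere. The symmetric tensor
`-(a₁ ⊗ a₄ + a₄ ⊗ a₁) + a₂ ⊗ a₂ + a₃ ⊗ a₃` is constant along `a`. -/
theorem isLaguerreFrame_of_D [ConnectedSpace M] {a : M → Fin 4 → V} {β γ : M → ℂ →L[ℝ] ℝ}
    {P : Invariants M} (ha : ∀ j, ContMDiff 𝓘(ℝ, ℂ) 𝓘(ℝ, V) ∞ fun q => a q j)
    (hd : ∀ p X j, D (fun q => a q j) p X = ∑ i, middleForm P p (β p X) (γ p X) i j • a p i)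
    {p₀ : M} (h₀ : IsLaguerreFrame (a p₀)) (p : M) : IsLaguerreFrame (a p) := by
  have hm : ∀ p j, MDifferentiableAt 𝓘(ℝ, ℂ) 𝓘(ℝ, V) (fun q => a q j) p := fun p j =>
    (ha j).mdifferentiableAt (by simp)
  have hc : ∀ j i, Continuous fun q => a q j i := fun j i =>
    (continuous_apply i).comp (ha j).continuous
  have hgram : ∀ p i j, mink (a p i) (a p j) = gram i j := by
    intro p
    rw [gram_eq_iff_dual]
    intro i j
    rw [← (gram_eq_iff_dual (a p₀)).1 h₀.gram_eq i j]
    have key : ∀ p, MDifferentiableAt 𝓘(ℝ, ℂ) 𝓘(ℝ, ℝ) (fun q => -(a q 0 i * a q 3 j +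
        a q 3 i * a q 0 j) + a q 1 i * a q 1 j + a q 2 i * a q 2 j) p ∧
        ∀ X, D (fun q => -(a q 0 i * a q 3 j +
        a q 3 i * a q 0 j) + a q 1 i * a q 1 j + a q 2 i * a q 2 j) p X = 0 := by
      intro p
      obtain ⟨m1, d1⟩ := D_mul_apply (hm p 0) (hm p 3) i j
      obtain ⟨m2, d2⟩ := D_mul_apply (hm p 3) (hm p 0) i j
      obtain ⟨m3, d3⟩ := D_mul_apply (hm p 1) (hm p 1) i j
      obtain ⟨m4, d4⟩ := D_mul_apply (hm p 2) (hm p 2) i j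
      have hh := (((m1.hasMFDerivAt.add m2.hasMFDerivAt).neg.add m3.hasMFDerivAt).add
        m4.hasMFDerivAt)
      refine ⟨hh.mdifferentiableAt, fun X => ?_⟩
      have h1 : D (fun q => -(a q 0 i * a q 3 j + a q 3 i * a q 0 j) + a q 1 i * a q 1 j +
          a q 2 i * a q 2 j) p X = -(D (fun q => a q 0 i * a q 3 j) p X +
          D (fun q => a q 3 i * a q 0 j) p X) + D (fun q => a q 1 i * a q 1 j) p X +
          D (fun q => a q 2 i * a q 2 j) p X := DFunLike.congr_fun hh.mfderiv X
      rw [h1, d1, d2, d3, d4]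
      simp only [hd p X, Fin.sum_univ_four, middleForm]
      simp
      ring
    exact eq_of_D_eq_zero (fun p => (key p).1) (fun p X => (key p).2 X) p p₀
  have hdet : (Matrix.of (a p)).det = 1 := by
    have hcont : Continuous fun p => (Matrix.of (a p)).det :=
      Continuous.matrix_det (continuous_matrix fun i j => hc i j)
    refine (isPreconnected_univ (α := M)).eq_of_sq_eq hcont.continuousOn
      (continuousOn_const (c := (1 : ℝ))) (fun p _ => ?_) (fun _ => one_ne_zero) (mem_univ p₀)
      h₀.det_eq (mem_univ p)
    have h1 : Matrix.of (a p) * gram * (Matrix.of (a p)).transpose = gram :=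
      Matrix.ext fun i j => by rw [of_mul_gram_apply, hgram]
    have h2 := congrArg Matrix.det h1
    have h3 : gram.det * gram.det = 1 := by rw [← Matrix.det_mul, gram_mul_gram, Matrix.det_one]
    rw [Matrix.det_mul, Matrix.det_mul, Matrix.det_transpose] at h2
    change (Matrix.of (a p)).det ^ 2 = 1 ^ 2
    linear_combination gram.det * h2 + (1 - (Matrix.of (a p)).det ^ 2) * h3
  have hcone : ∀ j, gram j j = 0 → a p₀ j ∈ posCone → a p j ∈ posCone := by
    intro j hj hp₀
    refine mem_posCone.2 ⟨by rw [hgram, hj], ?_⟩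
    by_contra hneg
    obtain ⟨q, hq⟩ := mem_range_of_exists_le_of_exists_ge
      (f := fun p => a p j 0 + a p j 3) (c := 0) ((hc j 0).add (hc j 3))
      ⟨p, not_lt.1 hneg⟩ ⟨p₀, (mem_posCone.1 hp₀).2.le⟩
    have hne : a q j ≠ 0 := by
      intro h0
      have h1 : ∀ i, gram j i = 0 := fun i => by rw [← hgram q, h0, mink_zero_left]
      have h2 := congrFun (congrFun gram_mul_gram j) j
      rw [Matrix.mul_apply, Finset.sum_eq_zero fun i _ => by rw [h1, zero_mul],
        Matrix.one_apply_eq] at h2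
      exact zero_ne_one h2
    rcases mem_posCone_or_neg (by rw [hgram, hj]) hne with h | h
    · exact (mem_posCone.1 h).2.ne' hq
    · have := (mem_posCone.1 h).2
      simp only [Pi.neg_apply] at this
      simp only at hq
      linarith
  exact ⟨hgram p, hdet, hcone 0 (by simp [gram]) h₀.fst_mem, hcone 3 (by simp [gram]) h₀.last_mem⟩

/-! ### Integration of the frame equation -/

/-- The coefficient of `dx` in the frame equation `d(a₀, a) = (a₀, a) α` with `W = 0`, where
`E = e^u`, `A = u_x`, `B = u_y` and `g = e^u J`. -/
def isothermicX (E A B g : ℝ) : Matrix (Fin 5) (Fin 5) ℝ :=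
  !![0, 0, 0, 0, 0;
     0, 2 * A, g, 0, 0;
     E, E, 0, B, g;
     0, 0, -B, 0, 0;
     0, 0, E, 0, -2 * A]

/-- The coefficient of `dy` in the frame equation, see `isothermicX`. -/
def isothermicY (E A B g : ℝ) : Matrix (Fin 5) (Fin 5) ℝ :=
  !![0, 0, 0, 0, 0;
     0, 2 * B, 0, -g, 0;
     0, 0, 0, -A, 0;
     E, -E, A, 0, -g;
     0, 0, 0, -E, -2 * B]

/-- The frame equation with `W = 0` is integrable if `Δu` is proportional to `e^{-2u}`. -/
lemma isothermic_flat {E A B g : ℂ → ℝ} {w : ℂ} (hA : DifferentiableAt ℝ A w)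
    (hB : DifferentiableAt ℝ B w)
    (hE1 : fderiv ℝ E w 1 = E w * A w) (hE2 : fderiv ℝ E w Complex.I = E w * B w)
    (hAB : fderiv ℝ A w Complex.I = fderiv ℝ B w 1)
    (hL : fderiv ℝ A w 1 + fderiv ℝ B w Complex.I = -2 * g w * E w)
    (hg1 : fderiv ℝ g w 1 = -3 * g w * A w) (hg2 : fderiv ℝ g w Complex.I = -3 * g w * B w)
    (i j : Fin 5) :
    fderiv ℝ (fun w => isothermicX (E w) (A w) (B w) (g w) i j) w Complex.I +
        (isothermicY (E w) (A w) (B w) (g w) * isothermicX (E w) (A w) (B w) (g w)) i j =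
      fderiv ℝ (fun w => isothermicY (E w) (A w) (B w) (g w) i j) w 1 +
        (isothermicX (E w) (A w) (B w) (g w) * isothermicY (E w) (A w) (B w) (g w)) i j := by
  have h2A : fderiv ℝ (fun w => 2 * A w) w = (2 : ℝ) • fderiv ℝ A w := fderiv_const_mul hA 2
  have h2B : fderiv ℝ (fun w => 2 * B w) w = (2 : ℝ) • fderiv ℝ B w := fderiv_const_mul hB 2
  fin_cases i <;> fin_cases j <;>
    simp [isothermicX, isothermicY, Matrix.mul_apply, Fin.sum_univ_five, h2A, h2B] <;>
    linarith

/-- The Bonnet theorem for the invariants of an L-minimal special L-isothermic immersion: a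
potential with `Δu = c e^{-2u}` on a simply connected surface belongs to an immersion with
`W = 0`. -/
theorem exists_frame_of_special [SimplyConnectedSpace M] (hz : ContMDiff 𝓘(ℝ, ℂ) 𝓘(ℝ, ℂ) ∞ z)
    (hu : ContMDiff 𝓘(ℝ, ℂ) 𝓘(ℝ, ℝ) ∞ u) (hinj : ∀ p, Function.Injective (D z p)) {c : ℝ}
    (hc : ∀ p, laplacian z u p = c * Real.exp (-2 * u p)) {p₀ : M} {b : Fin 4 → V}
    (hb : IsLaguerreFrame b) :
    ∃ (F : M → LaguerreSpace) (x : M → V) (a : M → Fin 4 → V),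
      IsMiddleFrameField F univ x a (potentialDx z u) (potentialDy z u)
        (spectralInvariants z u fun _ => 0) := by
  obtain ⟨hA, hB⟩ := contMDiff_partial hz hinj hu
  set A := partialX z u
  set B := partialY z u
  set E : M → ℝ := fun p => Real.exp (u p)
  set g : M → ℝ := fun p => -(c / 2) * Real.exp (-3 * u p)
  have hE : ContMDiff 𝓘(ℝ, ℂ) 𝓘(ℝ, ℝ) ∞ E := Real.contDiff_exp.contMDiff.comp hu
  have hexp : ∀ r : ℝ, ContMDiff 𝓘(ℝ, ℂ) 𝓘(ℝ, ℝ) ∞ fun p => Real.exp (r * u p) := fun r => by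
    have h2 : ContMDiff 𝓘(ℝ, ℝ) 𝓘(ℝ, ℝ) ∞ (fun y : ℝ => Real.exp (r * y)) :=
      ContDiff.contMDiff (by fun_prop)
    exact h2.comp hu
  have hg : ContMDiff 𝓘(ℝ, ℂ) 𝓘(ℝ, ℝ) ∞ g := contMDiff_const.mul (hexp (-3))
  have hgJ : ∀ p, g p = E p * potentialJ z u p := fun p => by
    simp only [g, E, potentialJ, hc]
    rw [show -3 * u p = u p + -2 * u p + -2 * u p by ring, Real.exp_add, Real.exp_add]; ring
  obtain ⟨s, hs, hs0, hsD⟩ := exists_global_solution hz hinj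
    (P := fun p => isothermicX (E p) (A p) (B p) (g p))
    (Q := fun p => isothermicY (E p) (A p) (B p) (g p))
    (fun i j => by
      fin_cases i <;> fin_cases j <;> simp [isothermicX] <;>
        first
        | exact contMDiff_const
        | exact hE
        | exact hg
        | exact hB
        | exact hB.neg
        | exact contMDiff_const.mul hA
        | exact (contMDiff_const.mul hA).neg)
    (fun i j => by
      fin_cases i <;> fin_cases j <;> simp [isothermicY] <;>
        first
        | exact contMDiff_const
        | exact hE
        | exact hE.neg
        | exact hg
        | exact hg.neg
        | exact hA
        | exact hA.neg
        | exact contMDiff_const.mul hB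
        | exact (contMDiff_const.mul hB).neg)
    (fun e he w hw i j => by
      have hd : ∀ {g : M → ℝ}, ContMDiff 𝓘(ℝ, ℂ) 𝓘(ℝ, ℝ) ∞ g → DifferentiableAt ℝ (g ∘ e.symm) w :=
        fun hg => (hasFDerivAt_comp_chart_symm he.mem hw
          (hg.mdifferentiableAt (by simp))).differentiableAt
      obtain ⟨hu1, hu2⟩ := he.fderiv_eq hw (hu.mdifferentiableAt (by simp))
      have hEd : HasFDerivAt (E ∘ e.symm) _ w := (hd hu).hasFDerivAt.exp
      have hgd : HasFDerivAt (g ∘ e.symm) _ w :=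
        (((hd hu).hasFDerivAt.const_mul (-3)).exp).const_mul (-(c / 2))
      refine isothermic_flat (E := E ∘ e.symm) (A := A ∘ e.symm) (B := B ∘ e.symm)
        (g := g ∘ e.symm) (hd hA) (hd hB) ?_ ?_ ?_ ?_ ?_ ?_ i j
      · rw [hEd.fderiv]; simp [hu1, E, A]
      · rw [hEd.fderiv]; simp [hu2, E, B]
      · have e1 : A ∘ e.symm =ᶠ[𝓝 w] fun w => fderiv ℝ (u ∘ e.symm) w 1 := by
          filter_upwards [e.open_target.mem_nhds hw] with y hy
          exact (he.fderiv_eq hy (hu.mdifferentiableAt (by simp))).1.symm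
        have e2 : B ∘ e.symm =ᶠ[𝓝 w] fun w => fderiv ℝ (u ∘ e.symm) w Complex.I := by
          filter_upwards [e.open_target.mem_nhds hw] with y hy
          exact (he.fderiv_eq hy (hu.mdifferentiableAt (by simp))).2.symm
        rw [e1.fderiv_eq, e2.fderiv_eq]
        exact fderiv_symm_of_partials e.open_target
          (by simpa using contDiffOn_comp_chart_symm he.mem (U := univ) hu.contMDiffOn)
          (fun _ _ => rfl) (fun _ _ => rfl) hw
      · rw [(he.fderiv_eq hw (hA.mdifferentiableAt (by simp))).1,
          (he.fderiv_eq hw (hB.mdifferentiableAt (by simp))).2]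
        change laplacian z u (e.symm w) = _
        simp only [Function.comp_apply]
        rw [hgJ, potentialJ]
        simp only [E]
        generalize e.symm w = p
        have : Real.exp (u p) * Real.exp (u p) * Real.exp (-2 * u p) = 1 := by
          rw [← Real.exp_add, ← Real.exp_add, ← Real.exp_zero]; congr 1; ring
        linear_combination -laplacian z u p * this
      · rw [hgd.fderiv]; simp [hu1, g, A]; ring
      · rw [hgd.fderiv]; simp [hu2, g, B]; ring) p₀ (Fin.cons 0 b)
  set a : M → Fin 4 → V := fun p j => s j.succ p
  set P := spectralInvariants z u fun _ => 0
  have hq : ∀ p, P.p₁ p * E p = g p ∧ P.p₃ p * E p = -g p ∧ P.q₁ p * E p = -B p ∧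
      P.q₂ p * E p = A p := by
    intro p
    have h1 : Real.exp (-u p) * Real.exp (u p) = 1 := by rw [← Real.exp_add]; simp
    simp only [P, spectralInvariants, hgJ]
    refine ⟨by ring, by ring, ?_, ?_⟩
    · simp only [E]; linear_combination -B p * h1
    · simp only [E]; linear_combination A p * h1
  have hform : ∀ p X i j, middleForm P p (potentialDx z u p X) (potentialDy z u p X) i j =
      (D z p X).re * isothermicX (E p) (A p) (B p) (g p) i.succ j.succ +
        (D z p X).im * isothermicY (E p) (A p) (B p) (g p) i.succ j.succ := by
    intro p X i j
    obtain ⟨h1, h3, k1, k2⟩ := hq p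
    have hβ : potentialDx z u p X = E p * (D z p X).re := rfl
    have hγ : potentialDy z u p X = E p * (D z p X).im := rfl
    have h2 : P.p₂ p = 0 := rfl
    rw [hβ, hγ]
    set r := (D z p X).re
    set t := (D z p X).im
    fin_cases i <;> fin_cases j <;> simp [middleForm, isothermicX, isothermicY, h2] <;>
      first
      | ring1
      | linear_combination r * h1
      | linear_combination t * h3
      | linear_combination -r * k1 - t * k2
      | linear_combination r * k1 + t * k2
      | linear_combination 2 * r * k2 - 2 * t * k1
      | linear_combination -2 * r * k2 + 2 * t * k1
  have hda : ∀ p X j, D (fun q => a q j) p X =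
      ∑ i, middleForm P p (potentialDx z u p X) (potentialDy z u p X) i j • a p i := by
    intro p X j
    change D (s j.succ) p X = _
    rw [hsD, Fin.sum_univ_succ]
    have h0 : ∀ j : Fin 4, isothermicX (E p) (A p) (B p) (g p) 0 j.succ = 0 ∧
        isothermicY (E p) (A p) (B p) (g p) 0 j.succ = 0 := by
      intro j; fin_cases j <;> simp [isothermicX, isothermicY]
    rw [(h0 j).1, (h0 j).2]
    simp only [hform, mul_zero, add_zero, zero_smul, zero_add]
    rfl
  have hframe : ∀ p, IsLaguerreFrame (a p) := isLaguerreFrame_of_D (fun j => hs j.succ) hda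
    (p₀ := p₀) (by
      have : a p₀ = b := funext fun j => by
        change s j.succ p₀ = _
        rw [hs0]; rfl
      rw [this]; exact hb)
  have hsm : ∀ i : Fin 4, ContMDiff 𝓘(ℝ, ℂ) 𝓘(ℝ, V) ∞ fun p => a p i := fun i => hs i.succ
  have hJ : ContMDiff 𝓘(ℝ, ℂ) 𝓘(ℝ, ℝ) ∞ (potentialJ z u) :=
    (contMDiff_const.mul (hexp (-2))).mul (contMDiff_laplacian hz hinj hu)
  have hexp' : ContMDiff 𝓘(ℝ, ℂ) 𝓘(ℝ, ℝ) ∞ fun p => Real.exp (-u p) :=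
    Real.contDiff_exp.contMDiff.comp hu.neg
  refine ⟨fun p => ⟨line (s 0 p) (a p 0), s 0 p, a p 0, (hframe p).fst_mem, rfl⟩, s 0, a,
    isOpen_univ, (hs 0).contMDiffOn, ContMDiff.contMDiffOn ?_,
    (contMDiff_const.add hJ).contMDiffOn, contMDiffOn_const, (contMDiff_const.sub hJ).contMDiffOn,
    (hexp'.neg.mul hB).contMDiffOn, (hexp'.mul hA).contMDiffOn, fun p _ => hframe p,
    fun p _ => rfl, fun p _ => indep_of_D_injective (hinj p), fun p _ X => ?_,
    fun p _ X j => hda p X j⟩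
  · exact contMDiff_pi_space.2 hsm
  · rw [hsD]
    simp [Fin.sum_univ_five, isothermicX, isothermicY]
    simp only [potentialDx, potentialDy, E, a]
    simp [mul_comm]

end Frames

section Equivalence

variable {M : Type*} [TopologicalSpace M] [ChartedSpace ℂ M] {F : M → LaguerreSpace}
  {z : M → ℂ} {u : M → ℝ} {U : Set M} {x : M → V} {a : M → Fin 4 → V}
  {β γ : M → ℂ →L[ℝ] ℝ} {P : Invariants M}

/-! ### Immersions with a global middle frame -/

lemma IsMiddleFrameField.isLegendreLift (h : IsMiddleFrameField F univ x a β γ P) :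
    IsLegendreLift x fun p => a p 0 := by
  refine ⟨fun p => (h.frame p (mem_univ p)).fst_mem, fun p X => ?_, fun p X hX => ?_⟩
  · have hf := h.frame p (mem_univ p)
    rw [h.d_a₀ p (mem_univ p)]
    simp [mink_add_left, mink_smul_left, hf.mink10, hf.mink20]
  · have hf := h.frame p (mem_univ p)
    rw [h.D_a0 (mem_univ p)]
    simp only [mink_add_left, mink_add_right, mink_smul_left, mink_smul_right, hf.mink00,
      hf.mink01, hf.mink02, hf.mink10, hf.mink11, hf.mink12, hf.mink20, hf.mink21, hf.mink22]
    have h1 : β p X ≠ 0 ∨ γ p X ≠ 0 := by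
      by_contra! h0
      exact hX (eq_zero_of_coframe_eq_zero (h.coframe_indep p (mem_univ p)) h0.1 h0.2)
    rcases h1 with h1 | h1
    · nlinarith [sq_pos_of_ne_zero h1, sq_nonneg (γ p X)]
    · nlinarith [sq_pos_of_ne_zero h1, sq_nonneg (β p X)]

lemma IsMiddleFrameField.isSmoothLift (h : IsMiddleFrameField F univ x a β γ P) :
    IsSmoothLift F x fun p => a p 0 :=
  ⟨contMDiffOn_univ.1 h.smooth_a₀, contMDiffOn_univ.1 (h.contMDiffOn_a 0),
    fun p => h.along p (mem_univ p)⟩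

lemma IsMiddleFrameField.isNondegenerate (h : IsMiddleFrameField F univ x a β γ P) :
    IsNondegenerateLegendreImmersion F := by
  refine ⟨x, fun p => a p 0, h.isSmoothLift, h.isLegendreLift, fun p => ?_⟩
  have hf := h.frame p (mem_univ p)
  have h1 : ∀ X, mink (D x p X) (D (fun p => a p 0) p X) = β p X ^ 2 - γ p X ^ 2 := fun X => by
    rw [h.d_a₀ p (mem_univ p), h.D_a0 (mem_univ p)]
    simp only [mink_add_left, mink_add_right, mink_smul_left, mink_smul_right,
      hf.mink10, hf.mink11, hf.mink12, hf.mink20, hf.mink21, hf.mink22]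
    ring
  have h2 : ∀ X, mink (D (fun p => a p 0) p X) (D (fun p => a p 0) p X) =
      β p X ^ 2 + γ p X ^ 2 := fun X => by
    rw [h.D_a0 (mem_univ p)]
    simp only [mink_add_left, mink_add_right, mink_smul_left, mink_smul_right, hf.mink00,
      hf.mink01, hf.mink02, hf.mink10, hf.mink11, hf.mink12, hf.mink20, hf.mink21, hf.mink22]
    ring
  obtain ⟨X, Y, hX1, hX2, hY1, hY2⟩ := exists_dual_basis (h.coframe_indep p (mem_univ p))
  rw [LinearIndependent.pair_iff]
  intro s t hst
  have e1 := congrFun hst X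
  have e2 := congrFun hst Y
  simp only [Pi.add_apply, Pi.smul_apply, h1, h2, hX1, hX2, hY1, hY2, smul_eq_mul,
    Pi.zero_apply] at e1 e2
  constructor <;> linarith

lemma IsMiddleFrameField.isLIsothermic
    (h : IsMiddleFrameField F univ x a (potentialDx z u) (potentialDy z u) P)
    (hz : ContMDiff 𝓘(ℝ, ℂ) 𝓘(ℝ, ℂ) ∞ z) (hu : ContMDiff 𝓘(ℝ, ℂ) 𝓘(ℝ, ℝ) ∞ u) :
    IsLIsothermic F z u :=
  ⟨h.isNondegenerate, hz, hu, fun p => ⟨univ, x, a, P, mem_univ p, h⟩⟩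

/-! ### The action of the Laguerre group -/

/-- The linear part of an element of the Laguerre group. -/
noncomputable def frameMapL (b : Fin 4 → V) : V →L[ℝ] V :=
  LinearMap.toContinuousLinearMap
    { toFun := frameMap b
      map_add' := frameMap_add b
      map_smul' := frameMap_smul b }

lemma D_clm {E G : Type*} [NormedAddCommGroup E] [NormedSpace ℝ E] [NormedAddCommGroup G]
    [NormedSpace ℝ G] (L : E →L[ℝ] G) {f : M → E} {p : M}
    (hf : MDifferentiableAt 𝓘(ℝ, ℂ) 𝓘(ℝ, E) f p) (X : ℂ) :
    D (fun q => L (f q)) p X = L (D f p X) :=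
  DFunLike.congr_fun ((L.hasFDerivAt (x := f p)).hasMFDerivAt.comp p hf.hasMFDerivAt).mfderiv X

lemma D_const_add {E : Type*} [NormedAddCommGroup E] [NormedSpace ℝ E] (c : E) {f : M → E} {p : M}
    (hf : MDifferentiableAt 𝓘(ℝ, ℂ) 𝓘(ℝ, E) f p) (X : ℂ) :
    D (fun q => c + f q) p X = D f p X := by
  have h : HasFDerivAt (fun y : E => c + y) (ContinuousLinearMap.id ℝ E) (f p) :=
    (hasFDerivAt_id _).const_add c
  exact DFunLike.congr_fun (h.hasMFDerivAt.comp p hf.hasMFDerivAt).mfderiv X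

/-- The Laguerre group acts on middle frames without changing the coframe and the invariants. -/
lemma IsMiddleFrameField.laguerre (h : IsMiddleFrameField F U x a β γ P) {F' : M → LaguerreSpace}
    {x₀ : V} {b : Fin 4 → V} (hb : IsLaguerreFrame b)
    (hF : ∀ p ∈ U, (F' p).1 = laguerreMap x₀ b '' (F p).1) :
    IsMiddleFrameField F' U (fun p => laguerreMap x₀ b (x p))
      (fun p j => frameMap b (a p j)) β γ P := by
  refine ⟨h.isOpen, ?_, ?_, h.smooth_p₁, h.smooth_p₂, h.smooth_p₃, h.smooth_q₁, h.smooth_q₂,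
    fun p hp => hb.frameMap (h.frame p hp), fun p hp => ?_, h.coframe_indep, fun p hp X => ?_,
    fun p hp X j => ?_⟩
  · have h1 : ContDiff ℝ ∞ fun y : V => x₀ + frameMapL b y :=
      contDiff_const.add (frameMapL b).contDiff
    exact h1.contMDiff.comp_contMDiffOn h.smooth_a₀
  · refine contMDiffOn_pi_space.2 fun j => ?_
    exact (frameMapL b).contDiff.contMDiff.comp_contMDiffOn (h.contMDiffOn_a j)
  · rw [hF p hp, h.along p hp, image_line]
  · have h2 : MDifferentiableAt 𝓘(ℝ, ℂ) 𝓘(ℝ, V) (fun q => frameMapL b (x q)) p :=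
      ((frameMapL b).hasFDerivAt.hasMFDerivAt.comp p
        (h.mdifferentiableAt_x hp).hasMFDerivAt).mdifferentiableAt
    have h3 := D_const_add x₀ h2 X
    rw [D_clm _ (h.mdifferentiableAt_x hp), h.d_a₀ p hp, map_add, map_smul, map_smul] at h3
    exact h3
  · have h3 := D_clm (frameMapL b) (h.mdifferentiableAt_a hp j) X
    rw [h.d_a p hp, map_sum] at h3
    simp only [map_smul] at h3
    exact h3

lemma dMap_diffeomorph_bijective (φ : Diffeomorph 𝓘(ℝ, ℂ) 𝓘(ℝ, ℂ) M M ∞) (p : M) :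
    Function.Bijective (dMap φ p) :=
  (φ.mfderivToContinuousLinearEquiv (by simp) p).bijective

/-- Laguerre equivalence preserves the invariant `W` up to the diffeomorphism. -/
theorem LaguerreEquivalent.exists_diffeomorph {F₀ F : M → LaguerreSpace} {y : M → V}
    {c : M → Fin 4 → V} {β₀ γ₀ : M → ℂ →L[ℝ] ℝ} {P₀ : Invariants M}
    (h₀ : IsMiddleFrameField F₀ univ y c β₀ γ₀ P₀) (h : IsMiddleFrameField F univ x a β γ P)
    (heq : LaguerreEquivalent F₀ F) :
    ∃ φ : M → M, ∀ p, P.p₁ (φ p) + P.p₃ (φ p) = P₀.p₁ p + P₀.p₃ p := by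
  obtain ⟨φ, x₀, b, hb, hF⟩ := heq
  refine ⟨φ, fun p => ?_⟩
  have h1 := h.comp (ψ := φ) isOpen_univ φ.contMDiff.contMDiffOn (fun _ _ => mem_univ _)
    (fun q _ => dMap_diffeomorph_bijective φ q)
  have h2 := h₀.laguerre (F' := F ∘ φ) hb (fun p _ => hF p)
  obtain ⟨-, -, e1, e3⟩ := middle_unique h2 h1 (p := p) (by simp)
  change P.p₁ (φ p) = _ at e1
  change P.p₃ (φ p) = _ at e3
  rw [e1, e3]

/-- If `F₀` and `F` have global middle frames with the same coframe and with `W = 0` and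
`W = k e^{-2u}`, then `k` is the only spectral parameter that transforms `F₀` into `F`, and the two
are not Laguerre equivalent unless `k = 0`. -/
theorem transforms_of_frames [IsManifold 𝓘(ℝ, ℂ) ∞ M] [Nonempty M] {F₀ F : M → LaguerreSpace}
    {y : M → V} {c : M → Fin 4 → V} {k : ℝ} (hz : ContMDiff 𝓘(ℝ, ℂ) 𝓘(ℝ, ℂ) ∞ z)
    (hu : ContMDiff 𝓘(ℝ, ℂ) 𝓘(ℝ, ℝ) ∞ u)
    (h₀ : IsMiddleFrameField F₀ univ y c (potentialDx z u) (potentialDy z u)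
      (spectralInvariants z u fun _ => 0))
    (h : IsMiddleFrameField F univ x a (potentialDx z u) (potentialDy z u)
      (spectralInvariants z u fun p => k * Real.exp (-2 * u p))) :
    (∀ m : ℝ, IsTmTransform z u m F₀ F ↔ m = k) ∧ (k ≠ 0 → AreTTransforms F₀ F) := by
  obtain ⟨p⟩ := ‹Nonempty M›
  refine ⟨fun m => ⟨?_, ?_⟩, fun hk => ⟨⟨z, u, h₀.isLIsothermic hz hu, h.isLIsothermic hz hu⟩,
    fun heq => ?_⟩⟩
  · rintro ⟨W, hW, x', a', h'⟩
    have h1 := (hW.unique h₀.hasInvariants p).1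
    have h2 := (h.hasInvariants.unique h'.hasInvariants p).1
    rw [← h1, zero_add] at h2
    exact mul_right_cancel₀ (Real.exp_ne_zero _) h2
  · rintro rfl
    refine ⟨fun _ => 0, h₀.hasInvariants, x, a, ?_⟩
    simpa only [zero_add] using h
  · obtain ⟨φ, hφ⟩ := heq.exists_diffeomorph h₀ h
    have := hφ p
    simp [spectralInvariants, Real.exp_ne_zero, hk] at this

end Equivalence

noncomputable section WeingartenAlgebra

/-! ### The Weingarten density at a point -/

/-- The determinant of the third fundamental form. -/
def thirdDet (v₁ v₂ : V) : ℝ := mink v₁ v₁ * mink v₂ v₂ - mink v₁ v₂ * mink v₂ v₁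

/-- The trace of the shape operator `S = III⁻¹ II`. -/
def shapeTrace (x₁ x₂ v₁ v₂ : V) : ℝ :=
  (mink v₂ v₂ * mink x₁ v₁ - mink v₁ v₂ * mink x₂ v₁ - mink v₂ v₁ * mink x₁ v₂ +
    mink v₁ v₁ * mink x₂ v₂) / thirdDet v₁ v₂

/-- The determinant of the shape operator `S = III⁻¹ II`. -/
def shapeDet (x₁ x₂ v₁ v₂ : V) : ℝ :=
  (mink x₁ v₁ * mink x₂ v₂ - mink x₁ v₂ * mink x₂ v₁) / thirdDet v₁ v₂

/-- The Weingarten density as a function of the first derivatives of the lift. -/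
def densityForm (x₁ x₂ v₁ v₂ : V) : ℝ :=
  (shapeTrace x₁ x₂ v₁ v₂ ^ 2 / 4 - shapeDet x₁ x₂ v₁ v₂) * Real.sqrt (thirdDet v₁ v₂)

lemma weingartenDensity_eq {x v : ℂ → V} {w : ℂ}
    (h : thirdDet (fderiv ℝ v w 1) (fderiv ℝ v w Complex.I) ≠ 0) :
    weingartenDensity x v w = densityForm (fderiv ℝ x w 1) (fderiv ℝ x w Complex.I)
      (fderiv ℝ v w 1) (fderiv ℝ v w Complex.I) := by
  simp only [weingartenDensity, densityForm, shapeTrace, shapeDet]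
  generalize fderiv ℝ x w 1 = x₁ at *
  generalize fderiv ℝ x w Complex.I = x₂ at *
  generalize fderiv ℝ v w 1 = v₁ at *
  generalize fderiv ℝ v w Complex.I = v₂ at *
  rw [Matrix.det_mul, Matrix.det_nonsing_inv, Matrix.inv_def, Matrix.adjugate_fin_two_of,
    Matrix.det_fin_two_of, Matrix.det_fin_two_of]
  simp only [← thirdDet.eq_1, Ring.inverse_eq_inv']
  congr 2
  · congr 2
    simp [Matrix.trace_fin_two]
    field_simp
    ring
  · field_simp

/-- The scalar product on the tangent space `v^⊥` of the cone is a sum of two squares, with kernel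
the line through `v`. -/
lemma exists_forms_of_mem_posCone {v : V} (hv : v ∈ posCone) :
    ∃ f g : V →ₗ[ℝ] ℝ, ∀ x y, mink x v = 0 → mink y v = 0 → mink x y = f x * f y + g x * g y := by
  obtain ⟨h1, h2⟩ := mem_posCone.1 hv
  by_cases h0 : v 0 = 0
  · have h3 : v 3 ≠ 0 := by rw [h0] at h2; linarith
    refine ⟨LinearMap.proj 1 - (v 1 / v 3) • LinearMap.proj 3,
      LinearMap.proj 2 - (v 2 / v 3) • LinearMap.proj 3, fun x y hx hy => ?_⟩
    simp only [mink, h0] at h1 hx hy ⊢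
    have e1 : v 1 = 0 := by nlinarith [sq_nonneg (v 1), sq_nonneg (v 2)]
    have e2 : v 2 = 0 := by nlinarith [sq_nonneg (v 1), sq_nonneg (v 2)]
    simp only [e1, e2] at hx hy ⊢
    have e3 : x 0 = 0 := by simpa [h3] using hx
    have e4 : y 0 = 0 := by simpa [h3] using hy
    simp [e3, e4]
  · refine ⟨LinearMap.proj 1 - (v 1 / v 0) • LinearMap.proj 0,
      LinearMap.proj 2 - (v 2 / v 0) • LinearMap.proj 0, fun x y hx hy => ?_⟩
    simp only [mink] at h1 hx hy ⊢
    have e1 : v 3 = (v 1 * v 1 + v 2 * v 2) / (2 * v 0) := by field_simp; linarith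
    have e2 : x 3 = (x 1 * v 1 + x 2 * v 2 - x 0 * v 3) / v 0 := by field_simp; linarith
    have e3 : y 3 = (y 1 * v 1 + y 2 * v 2 - y 0 * v 3) / v 0 := by field_simp; linarith
    rw [e2, e3, e1]
    simp
    field_simp
    ring

lemma thirdDet_pos {v₁ v₂ : V} (h : ∀ s t : ℝ, (s ≠ 0 ∨ t ≠ 0) →
    0 < mink (s • v₁ + t • v₂) (s • v₁ + t • v₂)) : 0 < thirdDet v₁ v₂ := by
  have h1 := h 1 0 (by simp)
  simp only [one_smul, zero_smul, add_zero] at h1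
  have h2 := h (-mink v₁ v₂) (mink v₁ v₁) (Or.inr h1.ne')
  simp only [mink_add_left, mink_add_right, mink_smul_left, mink_smul_right,
    mink_comm v₂ v₁] at h2
  rw [thirdDet, mink_comm v₂ v₁]
  refine pos_of_mul_pos_right (a := mink v₁ v₁) ?_ h1.le
  linarith

/-- The Weingarten density is at most the Dirichlet density of the middle sphere
`y = x - (tr S / 2) v` with respect to any conformal structure. The Dirichlet density is
written in a frame `P, Q` of the conformal structure. -/
lemma densityForm_mul_le {v x₁ x₂ v₁ v₂ : V} (hv : v ∈ posCone) (hx₁ : mink x₁ v = 0)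
    (hx₂ : mink x₂ v = 0) (hv₁ : mink v₁ v = 0) (hv₂ : mink v₂ v = 0)
    (hpos : 0 < thirdDet v₁ v₂) (σ₁ σ₂ P₁ P₂ Q₁ Q₂ : ℝ) {y₁ y₂ : V}
    (hy₁ : y₁ = x₁ + (-(shapeTrace x₁ x₂ v₁ v₂ / 2)) • v₁ + σ₁ • v)
    (hy₂ : y₂ = x₂ + (-(shapeTrace x₁ x₂ v₁ v₂ / 2)) • v₂ + σ₂ • v) :
    densityForm x₁ x₂ v₁ v₂ * |P₁ * Q₂ - P₂ * Q₁| ≤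
      (mink (P₁ • y₁ + P₂ • y₂) (P₁ • y₁ + P₂ • y₂) +
        mink (Q₁ • y₁ + Q₂ • y₂) (Q₁ • y₁ + Q₂ • y₂)) / 2 := by
  obtain ⟨f, g, hfg⟩ := exists_forms_of_mem_posCone hv
  have hvv := (mem_posCone.1 hv).1
  have hfv : f v = 0 ∧ g v = 0 := by
    have := hfg v v hvv hvv
    rw [hvv] at this
    constructor <;> nlinarith [sq_nonneg (f v), sq_nonneg (g v)]
  have hyv₁ : mink y₁ v = 0 := by
    rw [hy₁, mink_add_left, mink_add_left, mink_smul_left, mink_smul_left, hx₁, hv₁, hvv]; simp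
  have hyv₂ : mink y₂ v = 0 := by
    rw [hy₂, mink_add_left, mink_add_left, mink_smul_left, mink_smul_left, hx₂, hv₂, hvv]; simp
  set τ := -(shapeTrace x₁ x₂ v₁ v₂ / 2) with hτ
  have hfy₁ : f y₁ = f x₁ + τ * f v₁ := by rw [hy₁]; simp [hfv.1]
  have hfy₂ : f y₂ = f x₂ + τ * f v₂ := by rw [hy₂]; simp [hfv.1]
  have hgy₁ : g y₁ = g x₁ + τ * g v₁ := by rw [hy₁]; simp [hfv.2]
  have hgy₂ : g y₂ = g x₂ + τ * g v₂ := by rw [hy₂]; simp [hfv.2]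
  have hcomb : ∀ s t : ℝ, mink (s • y₁ + t • y₂) (s • y₁ + t • y₂) =
      (s * f y₁ + t * f y₂) ^ 2 + (s * g y₁ + t * g y₂) ^ 2 := by
    intro s t
    rw [hfg _ _ (by simp [mink_add_left, mink_smul_left, hyv₁, hyv₂])
      (by simp [mink_add_left, mink_smul_left, hyv₁, hyv₂])]
    simp; ring
  rw [hcomb, hcomb]
  have hΔ : thirdDet v₁ v₂ = (f v₁ * g v₂ - f v₂ * g v₁) ^ 2 := by
    rw [thirdDet, hfg _ _ hv₁ hv₁, hfg _ _ hv₁ hv₂, hfg _ _ hv₂ hv₁, hfg _ _ hv₂ hv₂]; ring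
  set d := f v₁ * g v₂ - f v₂ * g v₁ with hd
  have hd0 : d ≠ 0 := by
    intro h0; rw [hΔ, h0] at hpos; simp at hpos
  have htr : shapeTrace x₁ x₂ v₁ v₂ * d =
      f x₁ * g v₂ - f x₂ * g v₁ + f v₁ * g x₂ - f v₂ * g x₁ := by
    rw [shapeTrace, hΔ, hfg _ _ hv₁ hv₁, hfg _ _ hv₁ hv₂, hfg _ _ hv₂ hv₁, hfg _ _ hv₂ hv₂,
      hfg _ _ hx₁ hv₁, hfg _ _ hx₂ hv₁, hfg _ _ hx₁ hv₂, hfg _ _ hx₂ hv₂]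
    field_simp
    rw [hd]; ring
  have hdet : shapeDet x₁ x₂ v₁ v₂ * d = f x₁ * g x₂ - f x₂ * g x₁ := by
    rw [shapeDet, hΔ, hfg _ _ hx₁ hv₁, hfg _ _ hx₂ hv₁, hfg _ _ hx₁ hv₂, hfg _ _ hx₂ hv₂]
    field_simp
    rw [hd]; ring
  have hkey : (shapeTrace x₁ x₂ v₁ v₂ ^ 2 / 4 - shapeDet x₁ x₂ v₁ v₂) * d =
      -(f y₁ * g y₂ - f y₂ * g y₁) := by
    rw [hfy₁, hfy₂, hgy₁, hgy₂, hτ]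
    linear_combination (shapeTrace x₁ x₂ v₁ v₂ / 2) * htr - hdet -
      (shapeTrace x₁ x₂ v₁ v₂ ^ 2 / 4) * hd
  have h1 : densityForm x₁ x₂ v₁ v₂ ≤ |f y₁ * g y₂ - f y₂ * g y₁| := by
    rw [densityForm, hΔ, Real.sqrt_sq_eq_abs, ← abs_neg (f y₁ * g y₂ - f y₂ * g y₁), ← hkey,
      abs_mul]
    exact mul_le_mul_of_nonneg_right (le_abs_self _) (abs_nonneg _)
  refine (mul_le_mul_of_nonneg_right h1 (abs_nonneg _)).trans ?_
  have hABCD : ∀ A B C E : ℝ, |A * E - B * C| ≤ (A ^ 2 + B ^ 2 + (C ^ 2 + E ^ 2)) / 2 := by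
    intro A B C E
    rw [abs_le]
    constructor
    · linarith [sq_nonneg (A + E), sq_nonneg (B - C)]
    · linarith [sq_nonneg (A - E), sq_nonneg (B + C)]
  have h2 : (f y₁ * g y₂ - f y₂ * g y₁) * (P₁ * Q₂ - P₂ * Q₁) =
      (P₁ * f y₁ + P₂ * f y₂) * (Q₁ * g y₁ + Q₂ * g y₂) -
        (P₁ * g y₁ + P₂ * g y₂) * (Q₁ * f y₁ + Q₂ * f y₂) := by ring
  rw [← abs_mul, h2]
  exact hABCD _ _ _ _

/-- The Weingarten density and the trace of the shape operator in terms of a middle frame. -/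
lemma densityForm_of_frame {a : Fin 4 → V} (ha : IsLaguerreFrame a) {b₁ b₂ c₁ c₂ t r : ℝ}
    (hr : 0 < r) (hj : b₁ * c₂ - b₂ * c₁ ≠ 0) (σ₁ σ₂ ρ₁ ρ₂ : ℝ) {x₁ x₂ v₁ v₂ : V}
    (hx₁ : x₁ = σ₁ • a 0 + ((1 + t) * b₁) • a 1 + ((1 - t) * c₁) • a 2)
    (hx₂ : x₂ = σ₂ • a 0 + ((1 + t) * b₂) • a 1 + ((1 - t) * c₂) • a 2)
    (hv₁ : v₁ = ρ₁ • a 0 + (r * b₁) • a 1 + (-(r * c₁)) • a 2)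
    (hv₂ : v₂ = ρ₂ • a 0 + (r * b₂) • a 1 + (-(r * c₂)) • a 2) :
    shapeTrace x₁ x₂ v₁ v₂ = 2 * t / r ∧ densityForm x₁ x₂ v₁ v₂ = |b₁ * c₂ - b₂ * c₁| := by
  have hm : ∀ σ b c σ' b' c' : ℝ, mink (σ • a 0 + b • a 1 + c • a 2)
      (σ' • a 0 + b' • a 1 + c' • a 2) = b * b' + c * c' := by
    intro σ b c σ' b' c'
    simp only [mink_add_left, mink_add_right, mink_smul_left, mink_smul_right, ha.mink00,
      ha.mink01, ha.mink02, ha.mink10, ha.mink11, ha.mink12, ha.mink20, ha.mink21, ha.mink22]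
    ring
  have hΔ : thirdDet v₁ v₂ = (r ^ 2 * (b₁ * c₂ - b₂ * c₁)) ^ 2 := by
    rw [thirdDet, hv₁, hv₂, hm, hm, hm, hm]; ring
  have htr : shapeTrace x₁ x₂ v₁ v₂ = 2 * t / r := by
    rw [shapeTrace, hΔ, hx₁, hx₂, hv₁, hv₂]
    simp only [hm]
    rw [div_eq_div_iff (by positivity) hr.ne']
    ring
  have hdet : shapeDet x₁ x₂ v₁ v₂ = -(1 - t ^ 2) / r ^ 2 := by
    rw [shapeDet, hΔ, hx₁, hx₂, hv₁, hv₂]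
    simp only [hm]
    rw [div_eq_div_iff (by positivity) (by positivity)]
    ring
  refine ⟨htr, ?_⟩
  rw [densityForm, htr, hdet, hΔ, Real.sqrt_sq_eq_abs, abs_mul, abs_of_pos (by positivity)]
  field_simp
  ring

end WeingartenAlgebra

section Lifts

/-! ### Lifts of an immersion with a middle frame -/

variable {M : Type*} [TopologicalSpace M] [ChartedSpace ℂ M] {F : M → LaguerreSpace}
  {U : Set M} {x₀ : M → V} {a : M → Fin 4 → V} {β γ : M → ℂ →L[ℝ] ℝ} {P : Invariants M}

/-- The differentials of an arbitrary lift `(a₀ + t a₁, r a₁)` in terms of the middle frame. -/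
lemma IsMiddleFrameField.D_lift (h : IsMiddleFrameField F U x₀ a β γ P) {x v : M → V} {p : M}
    (hp : p ∈ U) (hx : MDifferentiableAt 𝓘(ℝ, ℂ) 𝓘(ℝ, V) x p)
    (hv : MDifferentiableAt 𝓘(ℝ, ℂ) 𝓘(ℝ, V) v p) (hcone : ∀ᶠ q in 𝓝 p, v q ∈ posCone)
    (heq : ∀ᶠ q in 𝓝 p, line (x₀ q) (a q 0) = line (x q) (v q)) :
    ∃ (t r : ℝ) (σ ρ : ℂ → ℝ), 0 < r ∧ x p = x₀ p + t • a p 0 ∧ v p = r • a p 0 ∧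
      ∀ X, D x p X = σ X • a p 0 + ((1 + t) * β p X) • a p 1 + ((1 - t) * γ p X) • a p 2 ∧
        D v p X = ρ X • a p 0 + (r * β p X) • a p 1 + (-(r * γ p X)) • a p 2 := by
  set t : M → ℝ := fun q => -mink (x q - x₀ q) (a q 3)
  set r : M → ℝ := fun q => -mink (v q) (a q 3)
  have htr : ∀ᶠ q in 𝓝 p, 0 < r q ∧ x q = x₀ q + t q • a q 0 ∧ v q = r q • a q 0 := by
    filter_upwards [h.isOpen.mem_nhds hp, hcone, heq] with q hq hc he
    obtain ⟨s, ρ, hρ, h1, h2⟩ := exists_of_line_eq (h.frame q hq).fst_mem hc he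
    have h3 : t q = s := by
      simp only [t]
      rw [h1, add_sub_cancel_left, mink_smul_left, (h.frame q hq).mink03]; ring
    have h4 : r q = ρ := by
      simp only [r]
      rw [h2, mink_smul_left, (h.frame q hq).mink03]; ring
    rw [h3, h4]; exact ⟨hρ, h1, h2⟩
  have hx₀ := h.mdifferentiableAt_x hp
  have ha := h.mdifferentiableAt_a hp
  have ht : MDifferentiableAt 𝓘(ℝ, ℂ) 𝓘(ℝ, ℝ) t p :=
    (mdifferentiableAt_mink (hx.sub hx₀) (ha 3)).neg
  have hr : MDifferentiableAt 𝓘(ℝ, ℂ) 𝓘(ℝ, ℝ) r p := (mdifferentiableAt_mink hv (ha 3)).neg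
  have hta : MDifferentiableAt 𝓘(ℝ, ℂ) 𝓘(ℝ, V) (fun q => t q • a q 0) p :=
    mdifferentiableAt_bilinear (ContinuousLinearMap.lsmul ℝ ℝ) ht (ha 0)
  obtain ⟨hr0, h1, h2⟩ := htr.self_of_nhds
  refine ⟨t p, r p, fun X => D t p X + t p * (2 * P.q₂ p * β p X - 2 * P.q₁ p * γ p X),
    fun X => D r p X + r p * (2 * P.q₂ p * β p X - 2 * P.q₁ p * γ p X), hr0, h1, h2,
    fun X => ⟨?_, ?_⟩⟩
  · rw [D_congr (g := x) (g' := fun q => x₀ q + t q • a q 0)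
      (by filter_upwards [htr] with q hq using hq.2.1), D_add hx₀ hta, D_smul ht (ha 0),
      h.d_a₀ p hp, h.D_a0 hp]
    module
  · rw [D_congr (g := v) (g' := fun q => r q • a q 0)
      (by filter_upwards [htr] with q hq using hq.2.2), D_smul hr (ha 0), h.D_a0 hp]
    module

end Lifts

noncomputable section Variation

lemma hasDerivAt_slice {E : Type*} [NormedAddCommGroup E] [NormedSpace ℝ E] {f : ℝ × ℂ → E}
    {t : ℝ} {w : ℂ} (hf : DifferentiableAt ℝ f (t, w)) :
    HasDerivAt (fun s => f (s, w)) (fderiv ℝ f (t, w) (1, 0)) t := by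
  have h : HasDerivAt (fun s : ℝ => (s, w)) ((1 : ℝ), (0 : ℂ)) t :=
    (hasDerivAt_id t).prodMk (hasDerivAt_const t w)
  exact hf.hasFDerivAt.comp_hasDerivAt t h

lemma fderiv_slice {E : Type*} [NormedAddCommGroup E] [NormedSpace ℝ E] {f : ℝ × ℂ → E}
    {t : ℝ} {w : ℂ} (hf : DifferentiableAt ℝ f (t, w)) (X : ℂ) :
    fderiv ℝ (fun y => f (t, y)) w X = fderiv ℝ f (t, w) (0, X) := by
  have h : HasFDerivAt (fun y : ℂ => (t, y))
      ((0 : ℂ →L[ℝ] ℝ).prod (ContinuousLinearMap.id ℝ ℂ)) w :=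
    (hasFDerivAt_const t w).prodMk (hasFDerivAt_id w)
  exact DFunLike.congr_fun (hf.hasFDerivAt.comp w h).fderiv X

lemma contDiffOn_mink {E : Type*} [NormedAddCommGroup E] [NormedSpace ℝ E] {f g : E → V}
    {S : Set E} (hf : ContDiffOn ℝ ∞ f S) (hg : ContDiffOn ℝ ∞ g S) :
    ContDiffOn ℝ ∞ (fun q => mink (f q) (g q)) S :=
  minkL.isBoundedBilinearMap.contDiff.comp_contDiffOn (hf.prodMk hg)

lemma contDiffOn_fderiv_apply {E G : Type*} [NormedAddCommGroup E] [NormedSpace ℝ E]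
    [NormedAddCommGroup G] [NormedSpace ℝ G] {f : E → G} {S : Set E} (hS : IsOpen S)
    (hf : ContDiffOn ℝ ∞ f S) (X : E) : ContDiffOn ℝ ∞ (fun q => fderiv ℝ f q X) S :=
  (hf.fderiv_of_isOpen hS (m := ∞) (by simp)).clm_apply contDiffOn_const

/-- The density is smooth although it involves a square root, because the radicand `det III`
does not vanish. -/
lemma contDiffOn_shape {E : Type*} [NormedAddCommGroup E] [NormedSpace ℝ E]
    {x₁ x₂ v₁ v₂ : E → V} {S : Set E} (hx₁ : ContDiffOn ℝ ∞ x₁ S) (hx₂ : ContDiffOn ℝ ∞ x₂ S)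
    (hv₁ : ContDiffOn ℝ ∞ v₁ S) (hv₂ : ContDiffOn ℝ ∞ v₂ S)
    (hpos : ∀ q ∈ S, thirdDet (v₁ q) (v₂ q) ≠ 0) :
    ContDiffOn ℝ ∞ (fun q => shapeTrace (x₁ q) (x₂ q) (v₁ q) (v₂ q)) S ∧
      ContDiffOn ℝ ∞ (fun q => densityForm (x₁ q) (x₂ q) (v₁ q) (v₂ q)) S := by
  have h11 := contDiffOn_mink hv₁ hv₁
  have h12 := contDiffOn_mink hv₁ hv₂
  have h21 := contDiffOn_mink hv₂ hv₁
  have h22 := contDiffOn_mink hv₂ hv₂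
  have k11 := contDiffOn_mink hx₁ hv₁
  have k12 := contDiffOn_mink hx₁ hv₂
  have k21 := contDiffOn_mink hx₂ hv₁
  have k22 := contDiffOn_mink hx₂ hv₂
  have hd : ContDiffOn ℝ ∞ (fun q => thirdDet (v₁ q) (v₂ q)) S := (h11.mul h22).sub (h12.mul h21)
  have htr : ContDiffOn ℝ ∞ (fun q => shapeTrace (x₁ q) (x₂ q) (v₁ q) (v₂ q)) S :=
    ((((h22.mul k11).sub (h12.mul k21)).sub (h21.mul k12)).add (h11.mul k22)).div hd hpos
  have hdet : ContDiffOn ℝ ∞ (fun q => shapeDet (x₁ q) (x₂ q) (v₁ q) (v₂ q)) S :=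
    ((k11.mul k22).sub (k12.mul k21)).div hd hpos
  exact ⟨htr, (((htr.pow 2).div_const 4).sub hdet).mul (hd.sqrt hpos)⟩

/-- A variation, in a coordinate patch `Ω`, of the Legendre immersion `[x₀, a₁]` through Legendre
immersions `[x t, v t]`, fixed outside `K`. -/
structure IsPlanarVariation (Ω K : Set ℂ) (x₀ : ℂ → V) (a : ℂ → Fin 4 → V) (x v : ℝ → ℂ → V) :
    Prop where
  smooth_fst : ContDiffOn ℝ ∞ (fun q : ℝ × ℂ => x q.1 q.2) (univ ×ˢ Ω)
  smooth_snd : ContDiffOn ℝ ∞ (fun q : ℝ × ℂ => v q.1 q.2) (univ ×ˢ Ω)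
  cone : ∀ t, ∀ w ∈ Ω, v t w ∈ posCone
  contact : ∀ t, ∀ w ∈ Ω, ∀ X, mink (fderiv ℝ (x t) w X) (v t w) = 0
  pos : ∀ t, ∀ w ∈ Ω, ∀ X, X ≠ 0 → 0 < mink (fderiv ℝ (v t) w X) (fderiv ℝ (v t) w X)
  at_zero : ∀ w ∈ Ω, line (x₀ w) (a w 0) = line (x 0 w) (v 0 w)
  fixed : ∀ t, ∀ w ∈ Ω \ K, line (x₀ w) (a w 0) = line (x t w) (v t w)

variable {Ω K : Set ℂ} {G : ℂ → LaguerreSpace} {x₀ : ℂ → V} {a : ℂ → Fin 4 → V}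
  {β γ : ℂ → ℂ →L[ℝ] ℝ} {P : Invariants ℂ} {x v : ℝ → ℂ → V}

/-- The coframe determinant in the coordinates of the patch. -/
def coframeDet (β γ : ℂ → ℂ →L[ℝ] ℝ) (w : ℂ) : ℝ :=
  β w 1 * γ w Complex.I - β w Complex.I * γ w 1

/-- The trace of the shape operator along a variation. -/
def variationTrace (x v : ℝ → ℂ → V) (q : ℝ × ℂ) : ℝ :=
  shapeTrace (fderiv ℝ (fun q : ℝ × ℂ => x q.1 q.2) q (0, 1))
    (fderiv ℝ (fun q : ℝ × ℂ => x q.1 q.2) q (0, Complex.I))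
    (fderiv ℝ (fun q : ℝ × ℂ => v q.1 q.2) q (0, 1))
    (fderiv ℝ (fun q : ℝ × ℂ => v q.1 q.2) q (0, Complex.I))

/-- The Weingarten density along a variation. -/
def variationDensity (x v : ℝ → ℂ → V) (q : ℝ × ℂ) : ℝ :=
  densityForm (fderiv ℝ (fun q : ℝ × ℂ => x q.1 q.2) q (0, 1))
    (fderiv ℝ (fun q : ℝ × ℂ => x q.1 q.2) q (0, Complex.I))
    (fderiv ℝ (fun q : ℝ × ℂ => v q.1 q.2) q (0, 1))
    (fderiv ℝ (fun q : ℝ × ℂ => v q.1 q.2) q (0, Complex.I))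

/-- The middle spheres along a variation, as points of Minkowski space. -/
def variationSphere (x v : ℝ → ℂ → V) (q : ℝ × ℂ) : V :=
  x q.1 q.2 + (-(variationTrace x v q / 2)) • v q.1 q.2

namespace IsPlanarVariation

variable (hvar : IsPlanarVariation Ω K x₀ a x v) (hΩ : IsOpen Ω)
include hvar hΩ

lemma differentiableAt {t : ℝ} {w : ℂ} (hw : w ∈ Ω) :
    DifferentiableAt ℝ (fun q : ℝ × ℂ => x q.1 q.2) (t, w) ∧
      DifferentiableAt ℝ (fun q : ℝ × ℂ => v q.1 q.2) (t, w) := by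
  have hn : (univ : Set ℝ) ×ˢ Ω ∈ 𝓝 (t, w) := (isOpen_univ.prod hΩ).mem_nhds ⟨mem_univ t, hw⟩
  exact ⟨(hvar.smooth_fst.contDiffAt hn).differentiableAt (by simp),
    (hvar.smooth_snd.contDiffAt hn).differentiableAt (by simp)⟩

lemma fderiv_eq {t : ℝ} {w : ℂ} (hw : w ∈ Ω) (X : ℂ) :
    fderiv ℝ (x t) w X = fderiv ℝ (fun q : ℝ × ℂ => x q.1 q.2) (t, w) (0, X) ∧
      fderiv ℝ (v t) w X = fderiv ℝ (fun q : ℝ × ℂ => v q.1 q.2) (t, w) (0, X) :=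
  ⟨fderiv_slice (hvar.differentiableAt hΩ hw).1 X, fderiv_slice (hvar.differentiableAt hΩ hw).2 X⟩

omit hΩ in
lemma thirdDet_pos {t : ℝ} {w : ℂ} (hw : w ∈ Ω) :
    0 < thirdDet (fderiv ℝ (v t) w 1) (fderiv ℝ (v t) w Complex.I) := by
  refine Laguerre.thirdDet_pos fun r s hrs => ?_
  have h1 := hvar.pos t w hw ⟨r, s⟩ (by
    intro h0
    have h1 := congrArg Complex.re h0
    have h2 := congrArg Complex.im h0
    simp at h1 h2
    rcases hrs with h | h
    exacts [h h1, h h2])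
  rwa [clm_apply_eq_re_im] at h1

lemma contDiffOn_trace_density : ContDiffOn ℝ ∞ (variationTrace x v) (univ ×ˢ Ω) ∧
    ContDiffOn ℝ ∞ (variationDensity x v) (univ ×ˢ Ω) := by
  have hS : IsOpen ((univ : Set ℝ) ×ˢ Ω) := isOpen_univ.prod hΩ
  refine contDiffOn_shape (contDiffOn_fderiv_apply hS hvar.smooth_fst _)
    (contDiffOn_fderiv_apply hS hvar.smooth_fst _) (contDiffOn_fderiv_apply hS hvar.smooth_snd _)
    (contDiffOn_fderiv_apply hS hvar.smooth_snd _) ?_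
  rintro ⟨t, w⟩ hq
  rw [← (hvar.fderiv_eq hΩ hq.2 _).2, ← (hvar.fderiv_eq hΩ hq.2 _).2]
  exact (hvar.thirdDet_pos hq.2).ne'

lemma contDiffOn_sphere : ContDiffOn ℝ ∞ (variationSphere x v) (univ ×ˢ Ω) :=
  hvar.smooth_fst.add
    (((hvar.contDiffOn_trace_density hΩ).1.div_const 2).neg.smul hvar.smooth_snd)

lemma weingartenDensity_eq {t : ℝ} {w : ℂ} (hw : w ∈ Ω) :
    weingartenDensity (x t) (v t) w = variationDensity x v (t, w) := by
  rw [Laguerre.weingartenDensity_eq (hvar.thirdDet_pos hw).ne', variationDensity,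
    (hvar.fderiv_eq hΩ hw _).1, (hvar.fderiv_eq hΩ hw _).2, (hvar.fderiv_eq hΩ hw _).1,
    (hvar.fderiv_eq hΩ hw _).2]

lemma fderiv_sphere {t : ℝ} {w : ℂ} (hw : w ∈ Ω) (X : ℝ × ℂ) :
    fderiv ℝ (variationSphere x v) (t, w) X = fderiv ℝ (fun q : ℝ × ℂ => x q.1 q.2) (t, w) X +
      (-(variationTrace x v (t, w) / 2)) • fderiv ℝ (fun q : ℝ × ℂ => v q.1 q.2) (t, w) X +
      (-(fderiv ℝ (variationTrace x v) (t, w) X / 2)) • v t w := by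
  obtain ⟨h1, h2⟩ := hvar.differentiableAt hΩ hw (t := t)
  have hn : (univ : Set ℝ) ×ˢ Ω ∈ 𝓝 (t, w) := (isOpen_univ.prod hΩ).mem_nhds ⟨mem_univ t, hw⟩
  have h3 : DifferentiableAt ℝ (variationTrace x v) (t, w) :=
    ((hvar.contDiffOn_trace_density hΩ).1.contDiffAt hn).differentiableAt (by simp)
  have h4 : HasFDerivAt (fun q => -(variationTrace x v q * 2⁻¹)) _ (t, w) :=
    (h3.hasFDerivAt.mul_const 2⁻¹).neg
  have h5 : HasFDerivAt (variationSphere x v) _ (t, w) :=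
    h1.hasFDerivAt.add (h4.smul h2.hasFDerivAt)
  rw [h5.fderiv]
  simp only [add_apply, smul_apply, neg_apply, ContinuousLinearMap.smulRight_apply, smul_eq_mul]
  rw [div_eq_mul_inv, div_eq_mul_inv, mul_comm (2⁻¹ : ℝ), add_assoc]

/-- Where the variation is fixed, the middle sphere is that of the frame and the Weingarten density
is the area density of the middle coframe. -/
lemma sphere_eq (h : IsMiddleFrameField G Ω x₀ a β γ P) {t : ℝ} {w : ℂ} (hw : w ∈ Ω)
    (heq : ∀ᶠ y in 𝓝 w, line (x₀ y) (a y 0) = line (x t y) (v t y)) :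
    variationSphere x v (t, w) = x₀ w ∧ variationDensity x v (t, w) = |coframeDet β γ w| := by
  obtain ⟨d1, d2⟩ := hvar.differentiableAt hΩ hw (t := t)
  have hsl : DifferentiableAt ℝ (fun y : ℂ => (t, y)) w := by fun_prop
  obtain ⟨s, r, σ, ρ, hr, e1, e2, hD⟩ := h.D_lift (x := x t) (v := v t) hw
    (DifferentiableAt.comp (g := fun q : ℝ × ℂ => x q.1 q.2) w d1 hsl).mdifferentiableAt
    (DifferentiableAt.comp (g := fun q : ℝ × ℂ => v q.1 q.2) w d2 hsl).mdifferentiableAt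
    (by filter_upwards [hΩ.mem_nhds hw] with y hy using hvar.cone t y hy) heq
  simp only [D_eq_fderiv] at hD
  obtain ⟨k1, k2⟩ := densityForm_of_frame (h.frame w hw) hr
    (coframe_det_ne_zero (h.coframe_indep w hw)) (σ 1) (σ Complex.I) (ρ 1) (ρ Complex.I)
    (hD 1).1 (hD Complex.I).1 (hD 1).2 (hD Complex.I).2
  rw [(hvar.fderiv_eq hΩ hw _).1, (hvar.fderiv_eq hΩ hw _).2, (hvar.fderiv_eq hΩ hw _).1,
    (hvar.fderiv_eq hΩ hw _).2] at k1 k2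
  refine ⟨?_, k2⟩
  simp only [variationSphere, variationTrace]
  rw [k1, e1, e2, smul_smul, add_assoc, ← add_smul]
  have : s + -(2 * s / r / 2) * r = 0 := by field_simp; ring
  rw [this]; simp

end IsPlanarVariation

end Variation

noncomputable section FirstVariation

variable {Ω K : Set ℂ} {G : ℂ → LaguerreSpace} {x₀ : ℂ → V} {a : ℂ → Fin 4 → V}
  {β γ : ℂ → ℂ →L[ℝ] ℝ} {P : Invariants ℂ} {x v : ℝ → ℂ → V}

/-! ### The closed form `γ a₂ - β a₃` -/

/-- The `V`-valued form `γ a₂ - β a₃`. -/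
def conjugateForm (a : ℂ → Fin 4 → V) (β γ : ℂ → ℂ →L[ℝ] ℝ) (X w : ℂ) : V :=
  γ w X • a w 1 - β w X • a w 2

lemma IsMiddleFrameField.contDiffOn_coframe (h : IsMiddleFrameField G Ω x₀ a β γ P) (X : ℂ) :
    ContDiffOn ℝ ∞ (fun w => β w X) Ω ∧ ContDiffOn ℝ ∞ (fun w => γ w X) Ω := by
  have h1 : ContDiffOn ℝ ∞ (fun w => fderiv ℝ x₀ w X) Ω :=
    contDiffOn_fderiv_apply h.isOpen h.smooth_a₀.contDiffOn X
  have h2 : ∀ j, ContDiffOn ℝ ∞ (fun w => a w j) Ω := fun j => (h.contMDiffOn_a j).contDiffOn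
  constructor
  · refine (contDiffOn_mink h1 (h2 1)).congr fun w hw => ?_
    have hf := h.frame w hw
    rw [← D_eq_fderiv, h.d_a₀ w hw]
    simp [mink_add_left, mink_smul_left, hf.mink11, hf.mink21]
  · refine (contDiffOn_mink h1 (h2 2)).congr fun w hw => ?_
    have hf := h.frame w hw
    rw [← D_eq_fderiv, h.d_a₀ w hw]
    simp [mink_add_left, mink_smul_left, hf.mink12, hf.mink22]

lemma IsMiddleFrameField.contDiffOn_conjugateForm (h : IsMiddleFrameField G Ω x₀ a β γ P) (X : ℂ) :
    ContDiffOn ℝ ∞ (conjugateForm a β γ X) Ω :=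
  ((h.contDiffOn_coframe X).2.smul (h.contMDiffOn_a 1).contDiffOn).sub
    ((h.contDiffOn_coframe X).1.smul (h.contMDiffOn_a 2).contDiffOn)

/-- If `W = 0`, the form `γ a₂ - β a₃` is closed. -/
lemma IsMiddleFrameField.conjugateForm_closed (h : IsMiddleFrameField G Ω x₀ a β γ P) {w : ℂ}
    (hw : w ∈ Ω) (hW : P.p₁ w + P.p₃ w = 0) :
    fderiv ℝ (conjugateForm a β γ Complex.I) w 1 =
      fderiv ℝ (conjugateForm a β γ 1) w Complex.I := by
  have hn := h.isOpen.mem_nhds hw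
  have hb : ∀ X, DifferentiableAt ℝ (fun w => β w X) w := fun X =>
    ((h.contDiffOn_coframe X).1.contDiffAt hn).differentiableAt (by simp)
  have hc : ∀ X, DifferentiableAt ℝ (fun w => γ w X) w := fun X =>
    ((h.contDiffOn_coframe X).2.contDiffAt hn).differentiableAt (by simp)
  have ha : ∀ j, DifferentiableAt ℝ (fun w => a w j) w := fun j =>
    ((h.contMDiffOn_a j).contDiffOn.contDiffAt hn).differentiableAt (by simp)
  have hf := h.frame w hw
  have hsymm := fderiv_symm_of_partials h.isOpen h.smooth_a₀.contDiffOn (X := 1) (Y := Complex.I)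
    (A := fun w => β w 1 • a w 1 + γ w 1 • a w 2)
    (B := fun w => β w Complex.I • a w 1 + γ w Complex.I • a w 2)
    (fun w hw => by rw [← D_eq_fderiv, h.d_a₀ w hw])
    (fun w hw => by rw [← D_eq_fderiv, h.d_a₀ w hw]) hw
  have e1 : ∀ X Y, fderiv ℝ (fun w => β w X • a w 1 + γ w X • a w 2) w Y =
      fderiv ℝ (fun w => β w X) w Y • a w 1 + β w X • D (fun w => a w 1) w Y +
        (fderiv ℝ (fun w => γ w X) w Y • a w 2 + γ w X • D (fun w => a w 2) w Y) := by
    intro X Y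
    have h1 : HasFDerivAt (fun w => β w X • a w 1 + γ w X • a w 2) _ w :=
      ((hb X).hasFDerivAt.smul (ha 1).hasFDerivAt).add ((hc X).hasFDerivAt.smul (ha 2).hasFDerivAt)
    rw [h1.fderiv, D_eq_fderiv, D_eq_fderiv]
    simp only [add_apply, smul_apply, ContinuousLinearMap.smulRight_apply]
    abel
  have e2 : ∀ X Y, fderiv ℝ (conjugateForm a β γ X) w Y =
      fderiv ℝ (fun w => γ w X) w Y • a w 1 + γ w X • D (fun w => a w 1) w Y -
        (fderiv ℝ (fun w => β w X) w Y • a w 2 + β w X • D (fun w => a w 2) w Y) := by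
    intro X Y
    have h1 : HasFDerivAt (conjugateForm a β γ X) _ w :=
      ((hc X).hasFDerivAt.smul (ha 1).hasFDerivAt).sub ((hb X).hasFDerivAt.smul (ha 2).hasFDerivAt)
    rw [h1.fderiv, D_eq_fderiv, D_eq_fderiv]
    simp only [add_apply, sub_apply, smul_apply, ContinuousLinearMap.smulRight_apply]
    abel
  rw [e1, e1] at hsymm
  rw [e2, e2]
  simp only [h.D_a1 hw, h.D_a2 hw] at hsymm ⊢
  have k1 := congrArg (fun v => mink v (a w 1)) hsymm
  have k2 := congrArg (fun v => mink v (a w 2)) hsymm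
  simp only [mink_add_left, mink_smul_left, hf.mink01, hf.mink02, hf.mink11, hf.mink12,
    hf.mink21, hf.mink22, hf.mink31, hf.mink32] at k1 k2
  have l1 : fderiv ℝ (fun w => β w Complex.I) w 1 = fderiv ℝ (fun w => β w 1) w Complex.I +
      P.q₁ w * (β w Complex.I * -γ w 1 + β w 1 * γ w Complex.I) := by linear_combination -k1
  have l2 : fderiv ℝ (fun w => γ w Complex.I) w 1 = fderiv ℝ (fun w => γ w 1) w Complex.I +
      P.q₂ w * (β w 1 * γ w Complex.I - β w Complex.I * γ w 1) := by linear_combination -k2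
  rw [l1, l2, eq_neg_of_add_eq_zero_right hW]
  module

/-- The derivative of a map into the light cone is orthogonal to its value. -/
lemma mink_fderiv_of_null {w : ℂ} (hΩ : IsOpen Ω) (hw : w ∈ Ω) {f : ℂ → V}
    (hf : ∀ y ∈ Ω, mink (f y) (f y) = 0) (hd : DifferentiableAt ℝ f w) (X : ℂ) :
    mink (fderiv ℝ f w X) (f w) = 0 := by
  have h1 : D (fun y => mink (f y) (f y)) w X = 0 := by
    rw [D_congr (g' := fun _ => (0 : ℝ)) (by
      filter_upwards [hΩ.mem_nhds hw] with y hy using hf y hy), D_eq_fderiv]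
    simp
  rw [D_mink hd.mdifferentiableAt hd.mdifferentiableAt, D_eq_fderiv, mink_comm (f w)] at h1
  linarith

/-! ### The first variation of the Weingarten functional -/

/-- The variation field of the middle spheres. -/
def variationField (x v : ℝ → ℂ → V) (w : ℂ) : V := fderiv ℝ (variationSphere x v) (0, w) (1, 0)

namespace IsPlanarVariation

variable (hvar : IsPlanarVariation Ω K x₀ a x v) (h : IsMiddleFrameField G Ω x₀ a β γ P)
include hvar h

lemma contDiffOn_field : ContDiffOn ℝ ∞ (variationField x v) Ω :=
  (contDiffOn_fderiv_apply (isOpen_univ.prod h.isOpen) (hvar.contDiffOn_sphere h.isOpen)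
    (1, 0)).comp (contDiff_const.prodMk contDiff_id).contDiffOn fun _ hw => ⟨mem_univ _, hw⟩

lemma field_eq_zero (hK : IsClosed K) {w : ℂ} (hw : w ∈ Ω \ K) : variationField x v w = 0 := by
  have hn : (univ : Set ℝ) ×ˢ Ω ∈ 𝓝 ((0 : ℝ), w) :=
    (isOpen_univ.prod h.isOpen).mem_nhds ⟨mem_univ _, hw.1⟩
  have hd : DifferentiableAt ℝ (variationSphere x v) (0, w) :=
    ((hvar.contDiffOn_sphere h.isOpen).contDiffAt hn).differentiableAt (by simp)
  have h1 := hasDerivAt_slice hd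
  have h2 : (fun s => variationSphere x v (s, w)) = fun _ => x₀ w := by
    funext s
    refine (hvar.sphere_eq h.isOpen h hw.1 ?_).1
    filter_upwards [(h.isOpen.sdiff hK).mem_nhds hw] with y hy using hvar.fixed s y hy
  rw [h2] at h1
  exact h1.unique (hasDerivAt_const _ _)

/-- The first variation of the Weingarten density at an immersion with a middle frame. The
density is bounded by the Dirichlet density of the middle spheres for the conformal structure of
the middle coframe, with equality for the given immersion, so that both have the same first
variation. -/
lemma fderiv_density {w : ℂ} (hw : w ∈ Ω) :
    fderiv ℝ (variationDensity x v) (0, w) (1, 0) = Real.sign (coframeDet β γ w) *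
      (mink (fderiv ℝ (variationField x v) w 1) (conjugateForm a β γ Complex.I w) -
        mink (fderiv ℝ (variationField x v) w Complex.I) (conjugateForm a β γ 1 w)) := by
  have hΩ := h.isOpen
  have hS : IsOpen ((univ : Set ℝ) ×ˢ Ω) := isOpen_univ.prod hΩ
  have hn : (univ : Set ℝ) ×ˢ Ω ∈ 𝓝 ((0 : ℝ), w) := hS.mem_nhds ⟨mem_univ _, hw⟩
  have hY := hvar.contDiffOn_sphere hΩ
  set Y := variationSphere x v with hYdef
  have hj : coframeDet β γ w ≠ 0 := coframe_det_ne_zero (h.coframe_indep w hw)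
  set j := coframeDet β γ w with hjdef
  -- the derivatives of the middle spheres and their velocities
  have hYd : ∀ X : ℂ, HasDerivAt (fun t => fderiv ℝ Y (t, w) (0, X))
      (fderiv ℝ (variationField x v) w X) 0 := by
    intro X
    have h1 : DifferentiableAt ℝ (fun q => fderiv ℝ Y q (0, X)) (0, w) :=
      ((contDiffOn_fderiv_apply hS hY (0, X)).contDiffAt hn).differentiableAt (by simp)
    have h2 : DifferentiableAt ℝ (fun q => fderiv ℝ Y q (1, 0)) (0, w) :=
      ((contDiffOn_fderiv_apply hS hY (1, 0)).contDiffAt hn).differentiableAt (by simp)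
    have h3 := fderiv_symm_of_partials hS hY (X := (0, X)) (Y := (1, 0)) (fun _ _ => rfl)
      (fun _ _ => rfl) (w := ((0 : ℝ), w)) ⟨mem_univ _, hw⟩
    have h4 : fderiv ℝ (variationField x v) w X = _ := fderiv_slice h2 X
    rw [h4, ← h3]
    exact hasDerivAt_slice h1
  have hY0 : ∀ X, fderiv ℝ Y (0, w) (0, X) = β w X • a w 1 + γ w X • a w 2 := by
    intro X
    have hd : DifferentiableAt ℝ Y (0, w) := (hY.contDiffAt hn).differentiableAt (by simp)
    rw [← fderiv_slice hd X, ← h.d_a₀ w hw, D_eq_fderiv]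
    have : (fun y => Y (0, y)) =ᶠ[𝓝 w] x₀ := by
      filter_upwards [hΩ.mem_nhds hw] with y hy
      refine (hvar.sphere_eq hΩ h hy ?_).1
      filter_upwards [hΩ.mem_nhds hy] with y' hy' using hvar.at_zero y' hy'
    rw [this.fderiv_eq]
  have hd0 : variationDensity x v (0, w) = |j| := by
    refine (hvar.sphere_eq hΩ h hw ?_).2
    filter_upwards [hΩ.mem_nhds hw] with y' hy' using hvar.at_zero y' hy'
  have hdd : HasDerivAt (fun t => variationDensity x v (t, w))
      (fderiv ℝ (variationDensity x v) (0, w) (1, 0)) 0 :=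
    hasDerivAt_slice (((hvar.contDiffOn_trace_density hΩ).2.contDiffAt hn).differentiableAt
      (by simp))
  set b₁ := β w 1
  set b₂ := β w Complex.I
  set c₁ := γ w 1
  set c₂ := γ w Complex.I
  set N₁ := fderiv ℝ (variationField x v) w 1
  set N₂ := fderiv ℝ (variationField x v) w Complex.I
  -- `p / j` and `q / j` are the derivatives along the frame dual to the coframe
  set p : ℝ → V := fun t => c₂ • fderiv ℝ Y (t, w) (0, 1) + (-c₁) • fderiv ℝ Y (t, w) (0, Complex.I)
  set q : ℝ → V := fun t => (-b₂) • fderiv ℝ Y (t, w) (0, 1) + b₁ • fderiv ℝ Y (t, w) (0, Complex.I)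
  have hp : HasDerivAt p (c₂ • N₁ + (-c₁) • N₂) 0 :=
    ((hYd 1).const_smul c₂).add ((hYd Complex.I).const_smul (-c₁))
  have hq : HasDerivAt q ((-b₂) • N₁ + b₁ • N₂) 0 :=
    ((hYd 1).const_smul (-b₂)).add ((hYd Complex.I).const_smul b₁)
  have hp0 : p 0 = j • a w 1 := by
    simp only [p, hY0, hjdef, coframeDet]; module
  have hq0 : q 0 = j • a w 2 := by
    simp only [q, hY0, hjdef, coframeDet]; module
  have hm : ∀ {f : ℝ → V} {f' : V}, HasDerivAt f f' 0 →
      HasDerivAt (fun t => mink (f t) (f t)) (mink (f 0) f' + mink f' (f 0)) 0 := by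
    intro f f' hf
    exact (minkL.isBoundedBilinearMap.hasFDerivAt (f 0, f 0)).comp_hasDerivAt (0 : ℝ)
      (hf.prodMk hf)
  set φ : ℝ → ℝ := fun t => (mink (p t) (p t) + mink (q t) (q t)) * 2⁻¹ -
    variationDensity x v (t, w) * |j|
  have hφ := (((hm hp).add (hm hq)).mul_const 2⁻¹).sub (hdd.mul_const |j|)
  have hf := h.frame w hw
  have hφ0 : φ 0 = 0 := by
    simp only [φ, hp0, hq0, hd0, mink_smul_left, mink_smul_right, hf.mink11, hf.mink22]
    rw [abs_mul_abs_self]; ring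
  have hφnn : ∀ t, 0 ≤ φ t := by
    intro t
    have hle := densityForm_mul_le (v := v t w) (hvar.cone t w hw)
      (x₁ := fderiv ℝ (x t) w 1) (x₂ := fderiv ℝ (x t) w Complex.I)
      (v₁ := fderiv ℝ (v t) w 1) (v₂ := fderiv ℝ (v t) w Complex.I)
      (hvar.contact t w hw 1) (hvar.contact t w hw Complex.I)
      (mink_fderiv_of_null hΩ hw (fun y hy => (mem_posCone.1 (hvar.cone t y hy)).1)
        (((hvar.smooth_snd.comp (contDiff_const.prodMk contDiff_id).contDiffOn
          fun y hy => ⟨mem_univ _, hy⟩).contDiffAt (hΩ.mem_nhds hw)).differentiableAt (by simp)) 1)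
      (mink_fderiv_of_null hΩ hw (fun y hy => (mem_posCone.1 (hvar.cone t y hy)).1)
        (((hvar.smooth_snd.comp (contDiff_const.prodMk contDiff_id).contDiffOn
          fun y hy => ⟨mem_univ _, hy⟩).contDiffAt (hΩ.mem_nhds hw)).differentiableAt (by simp))
          Complex.I)
      (hvar.thirdDet_pos hw)
      (-(fderiv ℝ (variationTrace x v) (t, w) (0, 1) / 2))
      (-(fderiv ℝ (variationTrace x v) (t, w) (0, Complex.I) / 2)) c₂ (-c₁) (-b₂) b₁
      (y₁ := fderiv ℝ Y (t, w) (0, 1)) (y₂ := fderiv ℝ Y (t, w) (0, Complex.I))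
      (by rw [hYdef, hvar.fderiv_sphere hΩ hw]
          simp only [variationTrace, (hvar.fderiv_eq hΩ hw _).1, (hvar.fderiv_eq hΩ hw _).2])
      (by rw [hYdef, hvar.fderiv_sphere hΩ hw]
          simp only [variationTrace, (hvar.fderiv_eq hΩ hw _).1, (hvar.fderiv_eq hΩ hw _).2])
    rw [(hvar.fderiv_eq hΩ hw _).1, (hvar.fderiv_eq hΩ hw _).2, (hvar.fderiv_eq hΩ hw _).1,
      (hvar.fderiv_eq hΩ hw _).2, show c₂ * b₁ - -c₁ * -b₂ = j by
        simp only [hjdef, coframeDet]; ring] at hle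
    change variationDensity x v (t, w) * |j| ≤ (mink (p t) (p t) + mink (q t) (q t)) / 2 at hle
    simp only [φ]
    linarith
  have hmin : IsLocalMin φ 0 := Eventually.of_forall fun t => by rw [hφ0]; exact hφnn t
  have hzero := hmin.hasDerivAt_eq_zero hφ
  rw [hp0, hq0] at hzero
  simp only [mink_add_left, mink_add_right, mink_smul_left, mink_smul_right] at hzero
  have hsign : Real.sign j * |j| = j := by
    rcases lt_or_gt_of_ne hj with h0 | h0
    · rw [Real.sign_of_neg h0, abs_of_neg h0]; ring
    · rw [Real.sign_of_pos h0, abs_of_pos h0]; ring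
  refine mul_right_cancel₀ (abs_ne_zero.2 hj) ?_
  rw [mul_right_comm, hsign]
  simp only [conjugateForm, mink_sub_right, mink_smul_right]
  rw [mink_comm N₁ (a w 1), mink_comm N₁ (a w 2), mink_comm N₂ (a w 1),
    mink_comm N₂ (a w 2)] at *
  linear_combination -hzero

end IsPlanarVariation

end FirstVariation

/-! ### Integration of the first variation -/

section Integral

open MeasureTheory

/-- The integral of a derivative of a smooth function with compact support vanishes. -/
lemma integral_fderiv_eq_zero {g : ℂ → ℝ} (hg : ContDiff ℝ ∞ g) (hc : HasCompactSupport g) (X : ℂ) :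
    Integrable (fun w => fderiv ℝ g w X) ∧ ∫ w, fderiv ℝ g w X = 0 := by
  have h1 : Integrable (fun w => fderiv ℝ g w X) := by
    refine Continuous.integrable_of_hasCompactSupport ?_ (hc.fderiv_apply ℝ X)
    exact (hg.continuous_fderiv (by simp)).clm_apply continuous_const
  have h2 := integral_mul_fderiv_eq_neg_fderiv_mul_of_integrable (μ := volume)
    (f := fun _ : ℂ => (1 : ℝ)) (g := g) (v := X) (by simp) (by simpa using h1)
    (by simpa using hg.continuous.integrable_of_hasCompactSupport hc)
    (fun _ _ => differentiableAt_const _) (fun w _ => hg.differentiable (by simp) w)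
  exact ⟨h1, by simpa using h2⟩

variable {Ω K : Set ℂ} {G : ℂ → LaguerreSpace} {x₀ : ℂ → V} {a : ℂ → Fin 4 → V}
  {β γ : ℂ → ℂ →L[ℝ] ℝ} {P : Invariants ℂ} {x v : ℝ → ℂ → V}

namespace IsPlanarVariation

/-- If `W = 0`, the first variation of the Weingarten density is the divergence of a vector field
supported in `K`, because `γ a₂ - β a₃` is closed; so its integral vanishes. -/
lemma setIntegral_fderiv_density (hvar : IsPlanarVariation Ω K x₀ a x v)
    (h : IsMiddleFrameField G Ω x₀ a β γ P) (hW : ∀ w ∈ Ω, P.p₁ w + P.p₃ w = 0)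
    (hK : IsCompact K) (hKΩ : K ⊆ Ω) :
    ∫ w in K, fderiv ℝ (variationDensity x v) (0, w) (1, 0) = 0 := by
  have hΩ := h.isOpen
  set N := variationField x v
  set s : ℂ → ℝ := fun w => Real.sign (coframeDet β γ w)
  have hN : ContDiffOn ℝ ∞ N Ω := hvar.contDiffOn_field h
  have hs : ∀ w ∈ Ω, ∀ᶠ y in 𝓝 w, s y = s w := by
    intro w hw
    have hc : ContinuousAt (coframeDet β γ) w := by
      have hb := fun X => ((h.contDiffOn_coframe X).1.contDiffAt (hΩ.mem_nhds hw)).continuousAt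
      have hc := fun X => ((h.contDiffOn_coframe X).2.contDiffAt (hΩ.mem_nhds hw)).continuousAt
      exact ((hb 1).mul (hc Complex.I)).sub ((hb Complex.I).mul (hc 1))
    have hj : coframeDet β γ w ≠ 0 := coframe_det_ne_zero (h.coframe_indep w hw)
    rcases lt_or_gt_of_ne hj with h0 | h0
    · filter_upwards [hc.eventually_lt_const h0] with y hy
      simp only [s]
      rw [Real.sign_of_neg hy, Real.sign_of_neg h0]
    · filter_upwards [hc.eventually_const_lt h0] with y hy
      simp only [s]
      rw [Real.sign_of_pos hy, Real.sign_of_pos h0]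
  -- the components of the vector field, extended by zero
  set g : ℂ → ℂ → ℝ := fun X => Ω.indicator fun w => s w * mink (N w) (conjugateForm a β γ X w)
    with hgdef
  have hoff : ∀ X, ∀ w ∉ K, g X w = 0 := by
    intro X w hw
    by_cases hwΩ : w ∈ Ω
    · simp only [hgdef]
      rw [indicator_of_mem hwΩ, show N w = 0 from hvar.field_eq_zero h hK.isClosed ⟨hwΩ, hw⟩,
        mink_zero_left, mul_zero]
    · exact indicator_of_notMem hwΩ _
  have hon : ∀ X, ∀ w ∈ Ω, g X =ᶠ[𝓝 w] fun y => s w * mink (N y) (conjugateForm a β γ X y) := by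
    intro X w hw
    filter_upwards [hΩ.mem_nhds hw, hs w hw] with y hy hsy
    simp only [hgdef]
    rw [indicator_of_mem hy, hsy]
  have hgsm : ∀ X, ContDiff ℝ ∞ (g X) := by
    intro X
    rw [contDiff_iff_contDiffAt]
    intro w
    by_cases hw : w ∈ Ω
    · refine ContDiffAt.congr_of_eventuallyEq ?_ (hon X w hw)
      exact contDiffAt_const.mul ((contDiffOn_mink hN
        (h.contDiffOn_conjugateForm X)).contDiffAt (hΩ.mem_nhds hw))
    · refine (contDiffAt_const (c := (0 : ℝ))).congr_of_eventuallyEq ?_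
      filter_upwards [hK.isClosed.isOpen_compl.mem_nhds fun hwK => hw (hKΩ hwK)] with y hy
      exact hoff X y hy
  have hcs : ∀ X, HasCompactSupport (g X) := fun X => HasCompactSupport.intro hK (hoff X)
  have hfd : ∀ X Y, ∀ w ∈ Ω, fderiv ℝ (g X) w Y = s w *
      (mink (fderiv ℝ N w Y) (conjugateForm a β γ X w) +
        mink (N w) (fderiv ℝ (conjugateForm a β γ X) w Y)) := by
    intro X Y w hw
    have d1 : DifferentiableAt ℝ N w :=
      (hN.contDiffAt (hΩ.mem_nhds hw)).differentiableAt (by simp)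
    have d2 : DifferentiableAt ℝ (conjugateForm a β γ X) w :=
      ((h.contDiffOn_conjugateForm X).contDiffAt (hΩ.mem_nhds hw)).differentiableAt (by simp)
    have d3 : DifferentiableAt ℝ (fun y => mink (N y) (conjugateForm a β γ X y)) w :=
      ((contDiffOn_mink hN (h.contDiffOn_conjugateForm X)).contDiffAt
        (hΩ.mem_nhds hw)).differentiableAt (by simp)
    rw [(hon X w hw).fderiv_eq, fderiv_const_mul d3, smul_apply, smul_eq_mul, ← D_eq_fderiv,
      D_mink d1.mdifferentiableAt d2.mdifferentiableAt, D_eq_fderiv, D_eq_fderiv]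
  have hdiv : ∀ w ∈ K, fderiv ℝ (variationDensity x v) (0, w) (1, 0) =
      fderiv ℝ (g Complex.I) w 1 - fderiv ℝ (g 1) w Complex.I := by
    intro w hw
    rw [hvar.fderiv_density h (hKΩ hw), hfd _ _ w (hKΩ hw), hfd _ _ w (hKΩ hw),
      h.conjugateForm_closed (hKΩ hw) (hW w (hKΩ hw))]
    ring
  have hz : ∀ X Y, ∀ w ∉ K, fderiv ℝ (g X) w Y = 0 := by
    intro X Y w hw
    have : g X =ᶠ[𝓝 w] fun _ => (0 : ℝ) := by
      filter_upwards [hK.isClosed.isOpen_compl.mem_nhds hw] with y hy using hoff X y hy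
    rw [this.fderiv_eq]; simp
  rw [setIntegral_congr_fun hK.measurableSet hdiv,
    setIntegral_eq_integral_of_forall_compl_eq_zero fun w hw => by
      rw [hz _ _ w hw, hz _ _ w hw, sub_zero],
    integral_sub (integral_fderiv_eq_zero (hgsm _) (hcs _) _).1
      (integral_fderiv_eq_zero (hgsm _) (hcs _) _).1,
    (integral_fderiv_eq_zero (hgsm _) (hcs _) _).2, (integral_fderiv_eq_zero (hgsm _) (hcs _) _).2,
    sub_zero]

/-- The Weingarten functional is stationary at an immersion with `W = 0`. -/
theorem hasDerivAt_integral (hvar : IsPlanarVariation Ω K x₀ a x v)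
    (h : IsMiddleFrameField G Ω x₀ a β γ P) (hW : ∀ w ∈ Ω, P.p₁ w + P.p₃ w = 0)
    (hK : IsCompact K) (hKΩ : K ⊆ Ω) :
    HasDerivAt (fun t => ∫ w in K, weingartenDensity (x t) (v t) w) 0 0 := by
  have hΩ := h.isOpen
  have hS : IsOpen ((univ : Set ℝ) ×ˢ Ω) := isOpen_univ.prod hΩ
  have hd := (hvar.contDiffOn_trace_density hΩ).2
  have hd' := contDiffOn_fderiv_apply hS hd (1, 0)
  have hcont : ∀ {f : ℝ × ℂ → ℝ}, ContDiffOn ℝ ∞ f (univ ×ˢ Ω) → ∀ t,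
      ContinuousOn (fun w => f (t, w)) K := fun hf t =>
    hf.continuousOn.comp (by fun_prop) fun w hw => ⟨mem_univ _, hKΩ hw⟩
  have heq : (fun t => ∫ w in K, weingartenDensity (x t) (v t) w) =
      fun t => ∫ w in K, variationDensity x v (t, w) := by
    funext t
    exact setIntegral_congr_fun hK.measurableSet fun w hw =>
      hvar.weingartenDensity_eq hΩ (hKΩ hw)
  rw [heq]
  obtain ⟨C, hC⟩ := ((isCompact_closedBall (0 : ℝ) 1).prod hK).exists_bound_of_continuousOn
    (hd'.continuousOn.mono fun q hq => ⟨mem_univ _, hKΩ hq.2⟩)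
  refine HasDerivAt.congr_deriv (hasDerivAt_integral_of_dominated_loc_of_deriv_le
    (μ := volume.restrict K) (bound := fun _ => C)
    (closedBall_mem_nhds (0 : ℝ) one_pos)
    (F := fun t w => variationDensity x v (t, w))
    (F' := fun t w => fderiv ℝ (variationDensity x v) (t, w) (1, 0))
    (Eventually.of_forall fun t =>
      ((hcont hd t).integrableOn_compact (μ := volume) hK).aestronglyMeasurable)
    ((hcont hd 0).integrableOn_compact (μ := volume) hK)
    ((hcont hd' 0).integrableOn_compact (μ := volume) hK).aestronglyMeasurable ?_ ?_ ?_).2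
    (hvar.setIntegral_fderiv_density h hW hK hKΩ)
  · exact (ae_restrict_iff' hK.measurableSet).2 (Eventually.of_forall fun w hw t ht =>
      hC (t, w) ⟨ht, hw⟩)
  · exact integrableOn_const (μ := volume) (hK.measure_lt_top (μ := volume)).ne
  · refine (ae_restrict_iff' hK.measurableSet).2 (Eventually.of_forall fun w hw t _ => ?_)
    exact hasDerivAt_slice ((hd.contDiffAt (hS.mem_nhds ⟨mem_univ _, hKΩ hw⟩)).differentiableAt
      (by simp))

end IsPlanarVariation

end Integral

section Minimal

variable {M : Type*} [TopologicalSpace M] [ChartedSpace ℂ M] [IsManifold 𝓘(ℝ, ℂ) ∞ M]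
  {F : M → LaguerreSpace} {x₀ : M → V} {a : M → Fin 4 → V} {β γ : M → ℂ →L[ℝ] ℝ}
  {P : Invariants M}

/-- An immersion with a global middle frame and `W = 0` is L-minimal. -/
theorem IsMiddleFrameField.isLMinimal (h : IsMiddleFrameField F univ x₀ a β γ P)
    (hW : ∀ p, P.p₁ p + P.p₃ p = 0) : IsLMinimal F := by
  intro e he K hK hKe x v hvar
  have hK' : IsCompact (e '' K) := hK.image_of_continuousOn (e.continuousOn.mono hKe)
  have hKt : e '' K ⊆ e.target := by
    rintro _ ⟨p, hp, rfl⟩; exact e.map_source (hKe hp)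
  have hpl := h.comp (ψ := e.symm) e.open_target (contMDiffOn_symm_of_mem_maximalAtlas he)
    (fun _ _ => mem_univ _) (fun w hw => dSymm_bijective he hw)
  have hψ : ContMDiffOn 𝓘(ℝ, ℝ × ℂ) (𝓘(ℝ, ℝ).prod 𝓘(ℝ, ℂ)) ∞
      (fun q : ℝ × ℂ => (q.1, e.symm q.2)) (univ ×ˢ e.target) :=
    (contDiff_fst.contMDiff.contMDiffOn).prodMk
      ((contMDiffOn_symm_of_mem_maximalAtlas he).comp contDiff_snd.contMDiff.contMDiffOn
        fun q hq => hq.2)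
  have hsl : ∀ {f : ℝ → M → V}, ContMDiff (𝓘(ℝ, ℝ).prod 𝓘(ℝ, ℂ)) 𝓘(ℝ, V) ∞
      (fun q : ℝ × M => f q.1 q.2) → ∀ t p, MDifferentiableAt 𝓘(ℝ, ℂ) 𝓘(ℝ, V) (f t) p := by
    intro f hf t p
    exact (hf.comp (contMDiff_const.prodMk contMDiff_id)).mdifferentiableAt (by simp)
  have hfd : ∀ {f : ℝ → M → V}, ContMDiff (𝓘(ℝ, ℝ).prod 𝓘(ℝ, ℂ)) 𝓘(ℝ, V) ∞
      (fun q : ℝ × M => f q.1 q.2) → ∀ t, ∀ w ∈ e.target, ∀ X,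
      fderiv ℝ (f t ∘ e.symm) w X = D (f t) (e.symm w) (dSymm e w X) := by
    intro f hf t w hw X
    rw [(hasFDerivAt_comp_chart_symm he hw (hsl hf t _)).fderiv]; rfl
  have hpvar : IsPlanarVariation e.target (e '' K) (x₀ ∘ e.symm) (a ∘ e.symm)
      (fun t => x t ∘ e.symm) (fun t => v t ∘ e.symm) := by
    refine ⟨(hvar.smooth_fst.comp_contMDiffOn hψ).contDiffOn,
      (hvar.smooth_snd.comp_contMDiffOn hψ).contDiffOn, fun t w _ => (hvar.legendre t).1 _,
      fun t w hw X => ?_, fun t w hw X hX => ?_, fun w _ => ?_, fun t w hw => ?_⟩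
    · rw [hfd hvar.smooth_fst t w hw]
      exact (hvar.legendre t).2.1 _ _
    · rw [hfd hvar.smooth_snd t w hw]
      refine (hvar.legendre t).2.2 _ _ fun h0 => hX ?_
      exact (dSymm_bijective he hw).1 (h0.trans (map_zero _).symm)
    · exact (h.along _ (mem_univ _)).symm.trans (hvar.at_zero _)
    · refine (h.along _ (mem_univ _)).symm.trans (hvar.fixed t _ fun hwK => hw.2 ?_)
      exact ⟨_, hwK, e.right_inv hw.1⟩
  exact hpvar.hasDerivAt_integral hpl (fun w _ => hW _) hK' hKt

end Minimal

end Laguerre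

theorem proposition3p10 {M : Type*} [TopologicalSpace M] [T2Space M]
    [SecondCountableTopology M] [SimplyConnectedSpace M]
    [ChartedSpace ℂ M] [IsManifold 𝓘(ℝ, ℂ) ∞ M]
    (F : M → Laguerre.LaguerreSpace) (z : M → ℂ) (u : M → ℝ)
    (hF : Laguerre.IsSpecialLIsothermic F z u) :
    (∃! k : ℝ, Laguerre.IsDeformationParameter F z u k) ∧
    ∃ F₀ : M → Laguerre.LaguerreSpace,
      Laguerre.IsLIsothermic F₀ z u ∧
      Laguerre.IsLMinimal F₀ ∧
      ∀ k : ℝ, Laguerre.IsDeformationParameter F z u k →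
        (∀ m : ℝ, Laguerre.IsTmTransform z u m F₀ F ↔ m = k) ∧
        (k ≠ 0 → Laguerre.AreTTransforms F₀ F) := by
  obtain ⟨x, a, k, h⟩ := hF.exists_global_frame
  obtain ⟨hiso, c, hc⟩ := id hF
  have p₀ : M := Classical.arbitrary M
  have huniq : ∀ k', Laguerre.IsDeformationParameter F z u k' → k' = k := fun k' hk' =>
    mul_right_cancel₀ (Real.exp_ne_zero _) (h.hasInvariants.unique hk' p₀).1
  obtain ⟨F₀, y, b, h₀⟩ := Laguerre.exists_frame_of_special
    hiso.smooth_z hiso.smooth_u hiso.D_injective hc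
    (p₀ := p₀) (h.frame p₀ (Set.mem_univ _))
  refine ⟨⟨k, h.hasInvariants, huniq⟩, F₀, h₀.isLIsothermic hiso.smooth_z hiso.smooth_u,
    h₀.isLMinimal fun p => by simp [Laguerre.spectralInvariants], fun k' hk' => ?_⟩
  rw [huniq k' hk']
  exact Laguerre.transforms_of_frames hiso.smooth_z hiso.smooth_u h₀ h
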